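/- \textbf{Setting.} Let $f(z)=z+\sum_{k\ge 1}f_kz^{k+1}$ be a formal power series with $f_k\in\mathbb{C}$, and put $Q(z)=z/f(z)=1+\sum_{k\ge1}q_kz^k$. For $(q_1,q_2,q_3,q_4)\in\mathbb{C}^4$, a \emph{series solution with parameters} $(q_1,q_2,q_3,q_4)$ is such a series $f$ for which $q_1,\dots,q_4$ are the first four coefficients of $Q$ and $$f f'''-3f'f''=6q_1(f')^2+12q_2ff'+12q_3f^2 .\qquad(*)$$ For a lattice $L\subset\mathbb{C}$ (of rank two), an \emph{elliptic function of level $N$} with lattice $L$ is a meromorphic function $f$ on $\mathbb{C}$ with $f(0)=0$, $f'(0)=1$ such that $f^N$ is an elliptic function with lattice $L$ and divisor $N\cdot 0-N\cdot\rho$ on $\mathbb{C}/L$ for some $\rho\in\mathbb{C}$, where $N\ge1$ is the smallest positive integer with this property for $f$. Let $U_N\subset\mathbb{C}^4$ be the set of all $(q_1,q_2,q_3,q_4)$ for which a series solution of $(*)$ with these parameters coincides with the Taylor expansion at $0$ of an elliptic function of level $N$ (for some lattice), and let $M_N$ be the Zariski closure of $U_N$ in $\mathbb{C}^4$. A series \emph{corresponds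 to the elliptic function of level $N$} if it is a series solution of $(*)$ with parameters in $M_N$. \textbf{Theorem.} Let $f(z)=z+\sum_{k\ge1}f_kz^{k+1}$, $f_k\in\mathbb{C}$, be a formal series satisfying the Hirzebruch functional equation for $n=6$ with $c=0$, $$\sum_{i=1}^{6}\ \prod_{j\ne i}\frac{1}{f(z_j-z_i)}=0,$$ as an identity in the field of fractions of $\mathbb{C}[[z_1,\dots,z_6]]$. Then $f$ corresponds to the elliptic function of level $2$, $3$ or $6$. -/

import Mathlib

namespace Hirzebruch

noncomputable section

/-- A formal power series of the form `z + f₁ z² + f₂ z³ + ⋯`. -/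
def IsNormalized (f : PowerSeries ℂ) : Prop :=
  PowerSeries.coeff 0 f = 0 ∧ PowerSeries.coeff 1 f = 1

/-- The formal series `f (z_j - z_i)` in the variables `z_1, …, z_n`. -/
def evalDiff {n : ℕ} (f : PowerSeries ℂ) (i j : Fin n) : MvPowerSeries (Fin n) ℂ :=
  PowerSeries.subst (MvPowerSeries.X j - MvPowerSeries.X i : MvPowerSeries (Fin n) ℂ) f

/-- The sum `∑ i, ∏ j ≠ i, 1 / g i j` in a field. -/
def reciprocalSum {K : Type*} [Field K] {n : ℕ} (g : Fin n → Fin n → K) : K :=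
  ∑ i : Fin n, ∏ j ∈ Finset.univ.erase i, (g i j)⁻¹

/-- The Hirzebruch functional equation `∑ i, ∏ j ≠ i, 1 / f (z_j - z_i) = c` for a formal
series `f`, as an identity in the field of fractions of `ℂ⟦z_1, …, z_n⟧`. -/
def SolvesFunctionalEquation (n : ℕ) (c : ℂ) (f : PowerSeries ℂ) : Prop :=
  reciprocalSum (fun i j : Fin n =>
      algebraMap (MvPowerSeries (Fin n) ℂ) (FractionRing (MvPowerSeries (Fin n) ℂ))
        (evalDiff f i j)) =
    algebraMap (MvPowerSeries (Fin n) ℂ) (FractionRing (MvPowerSeries (Fin n) ℂ))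
      (MvPowerSeries.C c)

/-- The series `Q(z) = z / f(z) = 1 + q₁ z + q₂ z² + ⋯` of a normalized series `f`. -/
def qSeries (f : PowerSeries ℂ) : PowerSeries ℂ :=
  (PowerSeries.mk fun k => PowerSeries.coeff (k + 1) f)⁻¹

theorem qSeries_mul {f : PowerSeries ℂ} (hf : IsNormalized f) :
    qSeries f * f = PowerSeries.X := by
  have h : f = (PowerSeries.mk fun k => PowerSeries.coeff (k + 1) f) * PowerSeries.X := by
    have := PowerSeries.eq_shift_mul_X_add_const f
    rw [← PowerSeries.coeff_zero_eq_constantCoeff_apply, hf.1] at this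
    simpa using this
  have h1 : PowerSeries.constantCoeff (PowerSeries.mk fun k => PowerSeries.coeff (k + 1) f) ≠ 0 := by
    rw [← PowerSeries.coeff_zero_eq_constantCoeff_apply, PowerSeries.coeff_mk, zero_add, hf.2]
    exact one_ne_zero
  calc qSeries f * f
      = qSeries f * ((PowerSeries.mk fun k => PowerSeries.coeff (k + 1) f) * PowerSeries.X) := by
        rw [← h]
    _ = PowerSeries.X := by
        rw [← mul_assoc, qSeries, PowerSeries.inv_mul_cancel _ h1, one_mul]

/-- `f` is a normalized series solution of
`f f''' - 3 f' f'' = 6 q₁ (f')² + 12 q₂ f f' + 12 q₃ f²`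
with parameters `(q₁, q₂, q₃, q₄) = (q 0, q 1, q 2, q 3)`, where `q₁, …, q₄` are the first
coefficients of `Q(z) = z / f(z)`. -/
structure IsODESolution (q : Fin 4 → ℂ) (f : PowerSeries ℂ) : Prop where
  normalized : IsNormalized f
  coeff_q : ∀ k : Fin 4, PowerSeries.coeff ((k : ℕ) + 1) (qSeries f) = q k
  ode :
    let D := PowerSeries.derivative ℂ
    f * D (D (D f)) - 3 * D f * D (D f) =
      PowerSeries.C (6 * q 0) * D f ^ 2 + PowerSeries.C (12 * q 1) * f * D f
        + PowerSeries.C (12 * q 2) * f ^ 2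

open Classical in
/-- `f` is meromorphic on `ℂ`, `f(0) = 0`, `f'(0) = 1`, and `f ^ N` is an elliptic function with
lattice `L` and divisor `N · 0 - N · ρ` for some `ρ`. A meromorphic function on the plane is
represented by its normal form (it is continuous wherever it is finite, and takes the
default value `0` at its poles). -/
structure HasLevelProperty (L : PeriodPair) (N : ℕ) (f : ℂ → ℂ) : Prop where
  meromorphic : MeromorphicNFOn f Set.univ
  map_zero : f 0 = 0
  deriv_zero : HasDerivAt f 1 0
  periodic : ∀ ω ∈ L.lattice, ∀ z : ℂ, f (z + ω) ^ N = f z ^ N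
  divisor : ∃ ρ : ℂ, ∀ z : ℂ, meromorphicOrderAt (fun w => f w ^ N) z =
    (((if z ∈ L.lattice then (N : ℤ) else 0) -
      (if z - ρ ∈ L.lattice then (N : ℤ) else 0) : ℤ) : WithTop ℤ)

/-- `f` is an elliptic function of level `N` with lattice `L`. -/
def IsEllipticOfLevel (L : PeriodPair) (N : ℕ) (f : ℂ → ℂ) : Prop :=
  IsLeast {k : ℕ | 0 < k ∧ HasLevelProperty L k f} N

/-- `φ` is the power series expansion of `f` at zero. -/
def IsExpansionAtZero (φ : PowerSeries ℂ) (f : ℂ → ℂ) : Prop :=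
  HasFPowerSeriesAt f
    (FormalMultilinearSeries.ofScalars ℂ fun k => PowerSeries.coeff k φ) 0

/-- The set `U_N` of parameters `(q₁, q₂, q₃, q₄)` whose series solution of the differential
equation is the expansion at zero of an elliptic function of level `N`. -/
def levelParameters (N : ℕ) : Set (Fin 4 → ℂ) :=
  {q | ∃ φ : PowerSeries ℂ, IsODESolution q φ ∧
    ∃ (L : PeriodPair) (f : ℂ → ℂ), IsEllipticOfLevel L N f ∧ IsExpansionAtZero φ f}

/-- The Zariski closure `M_N` of `U_N` in `ℂ⁴`. -/
def levelVariety (N : ℕ) : Set (Fin 4 → ℂ) :=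
  MvPolynomial.zeroLocus ℂ (MvPolynomial.vanishingIdeal ℂ (levelParameters N))

/-- `f` is a series corresponding to the elliptic function of level `N`: a series solution of the
differential equation with parameters in `M_N`. -/
def CorrespondsToLevel (N : ℕ) (f : PowerSeries ℂ) : Prop :=
  ∃ q ∈ levelVariety N, IsODESolution q f

end

end Hirzebruch

/-!
Write `Q = z / f` and `log Q = ∑ s_k z ^ k`. The proof compares the solutions of the functional
equation with explicit elliptic functions, in three steps.

*Classification.* On the line `z_j = a_j t` the functional equation becomes the vanishing of the
power series `lineSeries a Q` in `t` (`vanishesOnLines_of_solvesFunctionalEquation`). Its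
coefficient of `t ^ m` is a polynomial relation of weight `m` between the `s_k`, where `s_k` has
weight `k`. The relations of weight `5` to `12` along a few integral lines, solved by elimination,
show that the first four coefficients of `Q` lie in one of three families with two parameters
(`VanishesOnLines.classification`): `s₁ = s₃ = 0`; or `s₂` and `s₄` as for solutions in three
variables; or `familySix`. They also determine `s₆`. For `m = 5` and `m ≥ 7` the relation of weight
`m` along a single line is linear in `s_m` with a nonzero coefficient. Hence there is a universal
series whose coefficients are polynomials in `q₁, …, q₄` and which specializes to `Q` for every
solution (`exists_universalSeries`).

*Elliptic functions.* Quotients `θ(z) / θ(z - 1 / N)` of theta functions, suitably normalized, are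
elliptic functions of level `N` (`LevelDatum.isEllipticOfLevel_fn`). Both sides of the theorem hold
for them by Liouville's theorem. If `N` divides `n`, the functional equation in `n` variables holds
(`LevelDatum.vanishesOnLines`): as a function of one variable its left-hand side has no poles, as
the residues cancel, and under a period it is multiplied by a root of unity, which is not always
`1`. The differential equation holds (`LevelDatum.isODESolution_series`): divided by `f ^ 2`, the
difference of its sides is doubly periodic, vanishes at the zeros of `f`, and is invariant under
the reflection that interchanges the zeros and the poles of `f`.

*Density.* The elliptic functions of level `2`, `3` and `6` satisfy the functional equation in six
variables, so their parameters lie in the three families. Those of level `2` belong to the first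
family, since `Q` is even, and those of level `3` to the second. Those of level `6` belong to the
third: in the first family `Q` would be even, which forces level `2`
(`LevelDatum.level_eq_two_of_even`), and in the second the functional equation in three variables
would hold, which forces a level dividing `3` (`LevelDatum.level_dvd_three`). The lattices
`ℤ + ℤ (k + 2) i` are pairwise not homothetic. So the parameters of level `N` contain infinitely
many orbits under rescaling `z`, and a polynomial that vanishes on them vanishes on the whole family
(`IsWeightedFamily.eval_eq_zero`). It follows that each family lies in `M_N`. Moreover, an identity
between coefficients of `Q` that holds for the elliptic functions of level `N` extends, through the
universal series, to all solutions with parameters in the family (`IsWeightedFamily.map_eq_zero`).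
Applied to the differential equation, this proves the theorem.
-/

namespace Hirzebruch

noncomputable section

section

open Finset

/-! ### The functional equation along lines -/

/-- The product `∏ j ≠ i, (a j - a i)`. -/
def differenceProduct {n : ℕ} (a : Fin n → ℂ) (i : Fin n) : ℂ :=
  ∏ j ∈ univ.erase i, (a j - a i)

/-- The series `t ^ (n - 1) * ∑ i, ∏ j ≠ i, 1 / f ((a j - a i) t)` written in terms of
`Q = z / f`. The coefficients may lie in any `ℂ`-algebra, so that `Q` can be a universal series. -/
def lineSeries {R : Type*} [CommRing R] [Algebra ℂ R] {n : ℕ} (a : Fin n → ℂ)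
    (Q : PowerSeries R) : PowerSeries R :=
  ∑ i, PowerSeries.C (algebraMap ℂ R (differenceProduct a i)⁻¹) *
    ∏ j ∈ univ.erase i, PowerSeries.rescale (algebraMap ℂ R (a j - a i)) Q

/-- The functional equation with right-hand side `0` along all lines `z_j = a_j t` with distinct
`a_j`. -/
def VanishesOnLines (n : ℕ) (Q : PowerSeries ℂ) : Prop :=
  ∀ a : Fin n → ℂ, Function.Injective a → lineSeries a Q = 0

theorem differenceProduct_ne_zero {n : ℕ} {a : Fin n → ℂ} (ha : Function.Injective a)
    (i : Fin n) : differenceProduct a i ≠ 0 := by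
  refine prod_ne_zero_iff.2 fun j hj => sub_ne_zero.2 fun h => ?_
  exact (mem_erase.1 hj).1 (ha h)

theorem injective_finCast (n : ℕ) : Function.Injective (fun i : Fin n => ((i : ℕ) : ℂ)) := by
  intro i j h
  exact Fin.ext (Nat.cast_injective h)

theorem rescale_mul_rescale_qSeries {f : PowerSeries ℂ} (hf : IsNormalized f) (d : ℂ) :
    PowerSeries.rescale d (qSeries f) * PowerSeries.rescale d f =
      PowerSeries.C d * PowerSeries.X := by
  rw [← map_mul, qSeries_mul hf, PowerSeries.rescale_X]

theorem rescale_ne_zero {f : PowerSeries ℂ} (hf : IsNormalized f) {d : ℂ} (hd : d ≠ 0) :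
    PowerSeries.rescale d f ≠ 0 := by
  intro h
  have := congrArg (PowerSeries.coeff 1) h
  simp [PowerSeries.coeff_rescale, hf.2, hd] at this

/-- The substitution `z_j ↦ a_j t`. -/
theorem hasSubst_line {n : ℕ} (a : Fin n → ℂ) :
    MvPowerSeries.HasSubst
      (fun j => (a j • PowerSeries.X : PowerSeries ℂ)) :=
  MvPowerSeries.hasSubst_of_constantCoeff_zero fun j => by
    change PowerSeries.constantCoeff (a j • (PowerSeries.X : PowerSeries ℂ)) = 0
    simp [PowerSeries.smul_eq_C_mul]

theorem subst_evalDiff {n : ℕ} (a : Fin n → ℂ) (f : PowerSeries ℂ) (i j : Fin n) :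
    MvPowerSeries.substAlgHom (hasSubst_line a) (evalDiff f i j) =
      PowerSeries.rescale (a j - a i) f := by
  have h0 : PowerSeries.HasSubst
      (MvPowerSeries.X j - MvPowerSeries.X i : MvPowerSeries (Fin n) ℂ) :=
    PowerSeries.HasSubst.of_constantCoeff_zero (by simp)
  rw [evalDiff, PowerSeries.rescale_eq_subst, PowerSeries.subst, PowerSeries.subst,
    MvPowerSeries.coe_substAlgHom, MvPowerSeries.subst_comp_subst_apply h0.const (hasSubst_line a)]
  congr 1
  funext s
  rw [← MvPowerSeries.coe_substAlgHom (hasSubst_line a), map_sub,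
    MvPowerSeries.substAlgHom_X, MvPowerSeries.substAlgHom_X, sub_smul]

theorem prod_prod_erase {R : Type*} [CommRing R] {n : ℕ} (g : Fin n → Fin n → R) (i : Fin n) :
    ∏ k, ∏ j ∈ univ.erase k, g k j =
      (∏ j ∈ univ.erase i, g i j) * ∏ k ∈ univ.erase i, ∏ j ∈ univ.erase k, g k j :=
  (mul_prod_erase univ (fun k => ∏ j ∈ univ.erase k, g k j) (mem_univ i)).symm

/-- Clearing the denominators of the reciprocal sum. -/
theorem sum_prod_eq_zero_of_reciprocalSum {K : Type*} [Field K] {n : ℕ}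
    {g : Fin n → Fin n → K} (hg : ∀ i j, i ≠ j → g i j ≠ 0) (h : reciprocalSum g = 0) :
    ∑ i, ∏ k ∈ univ.erase i, ∏ j ∈ univ.erase k, g k j = 0 := by
  have h1 : (∏ k, ∏ j ∈ univ.erase k, g k j) * reciprocalSum g = 0 := by rw [h, mul_zero]
  rw [reciprocalSum, mul_sum] at h1
  rw [← h1]
  refine sum_congr rfl fun i _ => ?_
  have h2 : ∏ j ∈ univ.erase i, g i j ≠ 0 :=
    prod_ne_zero_iff.2 fun j hj => hg i j (mem_erase.1 hj).1.symm
  rw [prod_prod_erase g i, prod_inv_distrib]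
  field_simp

/-- The formal functional equation implies the functional equation along lines: the denominators
are cleared, and then `z_j = a_j t` is substituted. -/
theorem vanishesOnLines_of_solvesFunctionalEquation {n : ℕ} {f : PowerSeries ℂ}
    (hf : IsNormalized f) (h : SolvesFunctionalEquation n 0 f) :
    VanishesOnLines n (qSeries f) := by
  have hne : ∀ i j : Fin n, i ≠ j → evalDiff f i j ≠ 0 := by
    intro i j hij h0
    have h1 := subst_evalDiff (fun i : Fin n => ((i : ℕ) : ℂ)) f i j
    rw [h0, map_zero] at h1
    exact rescale_ne_zero hf (sub_ne_zero.2 ((injective_finCast n).ne hij.symm)) h1.symm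
  have hinj : Function.Injective (algebraMap (MvPowerSeries (Fin n) ℂ)
      (FractionRing (MvPowerSeries (Fin n) ℂ))) := IsFractionRing.injective _ _
  have h1 : ∑ i : Fin n, ∏ k ∈ univ.erase i, ∏ j ∈ univ.erase k, evalDiff f k j = 0 := by
    apply hinj
    rw [map_zero, ← sum_prod_eq_zero_of_reciprocalSum (g := fun i j : Fin n =>
      algebraMap (MvPowerSeries (Fin n) ℂ) (FractionRing (MvPowerSeries (Fin n) ℂ))
        (evalDiff f i j)) (fun i j hij => by
          rw [Ne, map_eq_zero_iff _ hinj]; exact hne i j hij)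
      (by rw [SolvesFunctionalEquation] at h; rw [h]; simp)]
    simp only [map_sum, map_prod]
  intro a ha
  have h2 := congrArg (MvPowerSeries.substAlgHom (hasSubst_line a)) h1
  simp only [map_sum, map_prod, map_zero, subst_evalDiff] at h2
  set Q := qSeries f
  set W := ∏ k, differenceProduct a k with hW
  have hWne : W ≠ 0 := prod_ne_zero_iff.2 fun k _ => differenceProduct_ne_zero ha k
  -- multiply by all factors `Q ((a j - a k) t)` to turn the values of `f` into monomials
  have h3 : ∀ i, (∏ k, ∏ j ∈ univ.erase k, PowerSeries.rescale (a j - a k) Q) *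
      ∏ k ∈ univ.erase i, ∏ j ∈ univ.erase k, PowerSeries.rescale (a j - a k) f =
      PowerSeries.C W * PowerSeries.X ^ ((n - 1) * (n - 1)) *
        (PowerSeries.C (differenceProduct a i)⁻¹ *
          ∏ j ∈ univ.erase i, PowerSeries.rescale (a j - a i) Q) := by
    intro i
    rw [prod_prod_erase _ i, mul_assoc, ← prod_mul_distrib]
    have h4 : ∀ k ∈ univ.erase i,
        ((∏ j ∈ univ.erase k, PowerSeries.rescale (a j - a k) Q) *
          ∏ j ∈ univ.erase k, PowerSeries.rescale (a j - a k) f) =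
        PowerSeries.C (differenceProduct a k) * PowerSeries.X ^ (n - 1) := by
      intro k _
      rw [← prod_mul_distrib]
      simp only [Q, rescale_mul_rescale_qSeries hf]
      rw [prod_mul_distrib, prod_const, card_erase_of_mem (mem_univ _), card_univ,
        Fintype.card_fin, differenceProduct, map_prod]
    rw [prod_congr rfl h4, prod_mul_distrib, prod_const, card_erase_of_mem (mem_univ _),
      card_univ, Fintype.card_fin, ← pow_mul, ← map_prod]
    have h5 : W = differenceProduct a i * ∏ k ∈ univ.erase i, differenceProduct a k :=
      (mul_prod_erase univ (differenceProduct a) (mem_univ i)).symm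
    have h6 : PowerSeries.C W * PowerSeries.C (differenceProduct a i)⁻¹ =
        PowerSeries.C (R := ℂ) (∏ k ∈ univ.erase i, differenceProduct a k) := by
      rw [← map_mul, h5]
      congr 1
      field_simp [differenceProduct_ne_zero ha i]
    rw [← h6]
    ring
  have h7 := congrArg
    (fun s => (∏ k, ∏ j ∈ univ.erase k, PowerSeries.rescale (a j - a k) Q) * s) h2
  simp only [mul_sum, h3, mul_zero] at h7
  rw [← mul_sum] at h7
  refine (mul_eq_zero.1 h7).resolve_left (mul_ne_zero ?_ (pow_ne_zero _ PowerSeries.X_ne_zero))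
  rw [Ne, map_eq_zero_iff _ PowerSeries.C_injective]
  exact hWne

/-! ### Coefficients of the line series -/

theorem map_lineSeries {R S : Type*} [CommRing R] [Algebra ℂ R] [CommRing S] [Algebra ℂ S]
    {n : ℕ} (a : Fin n → ℂ) (φ : R →ₐ[ℂ] S) (Q : PowerSeries R) :
    PowerSeries.map (φ : R →+* S) (lineSeries a Q) =
      lineSeries a (PowerSeries.map (φ : R →+* S) Q) := by
  have h : ∀ c : ℂ, PowerSeries.map (φ : R →+* S)
      (PowerSeries.rescale (algebraMap ℂ R c) Q) =
      PowerSeries.rescale (algebraMap ℂ S c) (PowerSeries.map (φ : R →+* S) Q) := by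
    intro c
    ext m
    simp [PowerSeries.coeff_rescale]
  simp only [lineSeries, map_sum, map_mul, map_prod, h, PowerSeries.map_C, RingHom.coe_coe,
    AlgHom.commutes]

theorem lineSeries_rescale {n : ℕ} (a : Fin n → ℂ) (c : ℂ) (Q : PowerSeries ℂ) :
    lineSeries a (PowerSeries.rescale c Q) = PowerSeries.rescale c (lineSeries a Q) := by
  have h : ∀ d : ℂ, PowerSeries.rescale d (PowerSeries.rescale c Q) =
      PowerSeries.rescale c (PowerSeries.rescale d Q) := by
    intro d
    rw [PowerSeries.rescale_rescale, PowerSeries.rescale_rescale, mul_comm]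
  have h' : ∀ d : ℂ, PowerSeries.rescale c (PowerSeries.C d) = PowerSeries.C d := by
    intro d
    ext m
    rw [PowerSeries.coeff_rescale, PowerSeries.coeff_C]
    split_ifs with hm <;> simp [hm]
  simp only [lineSeries, map_sum, map_mul, map_prod, h, h', Algebra.algebraMap_self,
    RingHom.id_apply]

theorem VanishesOnLines.rescale {n : ℕ} {Q : PowerSeries ℂ} (h : VanishesOnLines n Q) (c : ℂ) :
    VanishesOnLines n (PowerSeries.rescale c Q) := by
  intro a ha
  rw [lineSeries_rescale, h a ha, map_zero]

/-- The coefficients `ℓ_k` of `z Q'(z) / Q(z)`. -/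
def logCoeff (Q : PowerSeries ℂ) (k : ℕ) : ℂ :=
  PowerSeries.coeff k (PowerSeries.X * PowerSeries.derivative ℂ Q * Q⁻¹)

/-- The coefficients of `exp (∑ k ≥ 1, x k * t ^ k / k)`, by the recursion that comes from
the logarithmic derivative. -/
def expCoeff (x : ℕ → ℂ) : ℕ → ℂ
  | 0 => 1
  | m + 1 => (∑ k : Fin (m + 1), x (m + 1 - k) * expCoeff x k) / (m + 1)

/-- A series with constant coefficient `1` and logarithmic derivative `∑ x k * t ^ k`
has coefficients `expCoeff x`. -/
theorem coeff_eq_expCoeff {P : PowerSeries ℂ} {x : ℕ → ℂ}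
    (h0 : PowerSeries.coeff 0 P = 1) (hx : x 0 = 0)
    (h : PowerSeries.X * PowerSeries.derivative ℂ P = PowerSeries.mk x * P) (m : ℕ) :
    PowerSeries.coeff m P = expCoeff x m := by
  induction m using Nat.strong_induction_on with
  | _ m ih =>
    rcases m with _ | m
    · rw [h0, expCoeff]
    · have h1 := congrArg (PowerSeries.coeff (m + 1)) h
      rw [PowerSeries.coeff_succ_X_mul, PowerSeries.coeff_derivative, mul_comm (PowerSeries.mk x),
        PowerSeries.coeff_mul, Finset.Nat.sum_antidiagonal_eq_sum_range_succ_mk,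
        Finset.sum_range_succ] at h1
      simp only [PowerSeries.coeff_mk, Nat.sub_self, hx, mul_zero, add_zero] at h1
      have hm : (m : ℂ) + 1 ≠ 0 := Nat.cast_add_one_ne_zero m
      rw [expCoeff, eq_div_iff hm, h1, Finset.sum_range]
      refine Finset.sum_congr rfl fun k _ => ?_
      rw [ih k k.2, mul_comm]

theorem logCoeff_zero (Q : PowerSeries ℂ) : logCoeff Q 0 = 0 := by
  simp [logCoeff, mul_assoc]

theorem X_mul_derivative {Q : PowerSeries ℂ} (h0 : PowerSeries.coeff 0 Q = 1) :
    PowerSeries.X * PowerSeries.derivative ℂ Q = PowerSeries.mk (logCoeff Q) * Q := by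
  have h : PowerSeries.mk (logCoeff Q) = PowerSeries.X * PowerSeries.derivative ℂ Q * Q⁻¹ := by
    ext k
    simp [logCoeff]
  have hc : PowerSeries.constantCoeff Q ≠ 0 := by
    rw [← PowerSeries.coeff_zero_eq_constantCoeff_apply, h0]; exact one_ne_zero
  rw [h, mul_assoc, PowerSeries.inv_mul_cancel _ hc, mul_one]

theorem coeff_eq_expCoeff_logCoeff {Q : PowerSeries ℂ} (h0 : PowerSeries.coeff 0 Q = 1) (m : ℕ) :
    PowerSeries.coeff m Q = expCoeff (logCoeff Q) m :=
  coeff_eq_expCoeff h0 (logCoeff_zero Q) (X_mul_derivative h0) m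

theorem X_mul_derivative_rescale {Q : PowerSeries ℂ} (h0 : PowerSeries.coeff 0 Q = 1) (d : ℂ) :
    PowerSeries.X * PowerSeries.derivative ℂ (PowerSeries.rescale d Q) =
      PowerSeries.mk (fun k => logCoeff Q k * d ^ k) * PowerSeries.rescale d Q := by
  have h : PowerSeries.X * PowerSeries.derivative ℂ (PowerSeries.rescale d Q) =
      PowerSeries.rescale d (PowerSeries.X * PowerSeries.derivative ℂ Q) := by
    ext m
    rcases m with _ | m
    · simp
    · rw [PowerSeries.coeff_succ_X_mul, PowerSeries.coeff_derivative, PowerSeries.coeff_rescale,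
        PowerSeries.coeff_rescale, PowerSeries.coeff_succ_X_mul, PowerSeries.coeff_derivative]
      ring
  rw [h, X_mul_derivative h0, map_mul]
  congr 1
  ext m
  simp [PowerSeries.coeff_rescale, mul_comm]

/-- The logarithmic coefficients of a product of rescalings of `Q` are those of `Q` times power
sums. -/
theorem coeff_prod_rescale {Q : PowerSeries ℂ} (h0 : PowerSeries.coeff 0 Q = 1) {ι : Type*}
    (s : Finset ι) (d : ι → ℂ) (m : ℕ) :
    PowerSeries.coeff m (∏ j ∈ s, PowerSeries.rescale (d j) Q) =
      expCoeff (fun k => logCoeff Q k * ∑ j ∈ s, d j ^ k) m := by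
  classical
  refine coeff_eq_expCoeff ?_ (by simp [logCoeff_zero]) ?_ m
  · rw [PowerSeries.coeff_zero_eq_constantCoeff_apply, map_prod]
    refine prod_eq_one fun j _ => ?_
    rw [← PowerSeries.coeff_zero_eq_constantCoeff_apply, PowerSeries.coeff_rescale, h0]
    simp
  · clear m
    induction s using Finset.induction_on with
    | empty =>
      simp
      ext m
      simp
    | insert j s hj ih =>
      rw [prod_insert hj, Derivation.leibniz, smul_eq_mul, smul_eq_mul, mul_add,
        mul_left_comm, ih, mul_left_comm PowerSeries.X, X_mul_derivative_rescale h0]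
      have h : PowerSeries.mk (fun k => logCoeff Q k * ∑ i ∈ insert j s, d i ^ k) =
          PowerSeries.mk (fun k => logCoeff Q k * d j ^ k) +
            PowerSeries.mk (fun k => logCoeff Q k * ∑ i ∈ s, d i ^ k) := by
        ext k
        simp [sum_insert hj, mul_add]
      rw [h]
      ring

theorem coeff_lineSeries {Q : PowerSeries ℂ} (h0 : PowerSeries.coeff 0 Q = 1) {n : ℕ}
    (a : Fin n → ℂ) (m : ℕ) :
    PowerSeries.coeff m (lineSeries a Q) =
      ∑ i, (differenceProduct a i)⁻¹ *
        expCoeff (fun k => logCoeff Q k * ∑ j ∈ univ.erase i, (a j - a i) ^ k) m := by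
  simp only [lineSeries, map_sum, PowerSeries.coeff_C_mul, Algebra.algebraMap_self,
    RingHom.id_apply, coeff_prod_rescale h0]

/-! ### Expansion of the exponential up to order twelve -/

theorem expCoeff_zero (x : ℕ → ℂ) : expCoeff x 0 = 1 := by rw [expCoeff]

theorem expCoeff_succ (x : ℕ → ℂ) (m : ℕ) :
    expCoeff x (m + 1) = (∑ k ∈ range (m + 1), x (m + 1 - k) * expCoeff x k) / (m + 1) := by
  rw [expCoeff, Finset.sum_range]

theorem expCoeff_1 (x : ℕ → ℂ) : expCoeff x 1 = x 1 := by
  rw [expCoeff_succ]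
  simp only [sum_range_succ, sum_range_zero, expCoeff_zero, Nat.reduceAdd, Nat.reduceSub]
  push_cast
  ring

theorem expCoeff_2 (x : ℕ → ℂ) : expCoeff x 2 = (
      x 2 + x 1 ^ 2) / 2 := by
  rw [expCoeff_succ]
  simp only [sum_range_succ, sum_range_zero, expCoeff_zero, expCoeff_1, Nat.reduceAdd,
      Nat.reduceSub]
  push_cast
  ring

theorem expCoeff_3 (x : ℕ → ℂ) : expCoeff x 3 = (
      2 * x 3 + 3 * x 1 * x 2 + x 1 ^ 3) / 6 := by
  rw [expCoeff_succ]
  simp only [sum_range_succ, sum_range_zero, expCoeff_zero, expCoeff_1, expCoeff_2, Nat.reduceAdd,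
      Nat.reduceSub]
  push_cast
  ring

theorem expCoeff_4 (x : ℕ → ℂ) : expCoeff x 4 = (
      6 * x 4 + 8 * x 1 * x 3 + 3 * x 2 ^ 2 + 6 * x 1 ^ 2 * x 2 + x 1 ^ 4) / 24 := by
  rw [expCoeff_succ]
  simp only [sum_range_succ, sum_range_zero, expCoeff_zero, expCoeff_1, expCoeff_2, expCoeff_3,
      Nat.reduceAdd, Nat.reduceSub]
  push_cast
  ring

theorem expCoeff_5 (x : ℕ → ℂ) : expCoeff x 5 = (
      24 * x 5 + 30 * x 1 * x 4 + 20 * x 2 * x 3 + 20 * x 1 ^ 2 * x 3 + 15 * x 1 * x 2 ^ 2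
      + 10 * x 1 ^ 3 * x 2 + x 1 ^ 5) / 120 := by
  rw [expCoeff_succ]
  simp only [sum_range_succ, sum_range_zero, expCoeff_zero, expCoeff_1, expCoeff_2, expCoeff_3,
      expCoeff_4, Nat.reduceAdd, Nat.reduceSub]
  push_cast
  ring

theorem expCoeff_6 (x : ℕ → ℂ) : expCoeff x 6 = (
      120 * x 6 + 144 * x 1 * x 5 + 90 * x 2 * x 4 + 90 * x 1 ^ 2 * x 4 + 40 * x 3 ^ 2
      + 120 * x 1 * x 2 * x 3 + 40 * x 1 ^ 3 * x 3 + 15 * x 2 ^ 3 + 45 * x 1 ^ 2 * x 2 ^ 2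
      + 15 * x 1 ^ 4 * x 2 + x 1 ^ 6) / 720 := by
  rw [expCoeff_succ]
  simp only [sum_range_succ, sum_range_zero, expCoeff_zero, expCoeff_1, expCoeff_2, expCoeff_3,
      expCoeff_4, expCoeff_5, Nat.reduceAdd, Nat.reduceSub]
  push_cast
  ring

theorem expCoeff_7 (x : ℕ → ℂ) : expCoeff x 7 = (
      720 * x 7 + 840 * x 1 * x 6 + 504 * x 2 * x 5 + 504 * x 1 ^ 2 * x 5 + 420 * x 3 * x 4
      + 630 * x 1 * x 2 * x 4 + 210 * x 1 ^ 3 * x 4 + 280 * x 1 * x 3 ^ 2 + 210 * x 2 ^ 2 * x 3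
      + 420 * x 1 ^ 2 * x 2 * x 3 + 70 * x 1 ^ 4 * x 3 + 105 * x 1 * x 2 ^ 3
      + 105 * x 1 ^ 3 * x 2 ^ 2 + 21 * x 1 ^ 5 * x 2 + x 1 ^ 7) / 5040 := by
  rw [expCoeff_succ]
  simp only [sum_range_succ, sum_range_zero, expCoeff_zero, expCoeff_1, expCoeff_2, expCoeff_3,
      expCoeff_4, expCoeff_5, expCoeff_6, Nat.reduceAdd, Nat.reduceSub]
  push_cast
  ring

theorem expCoeff_8 (x : ℕ → ℂ) : expCoeff x 8 = (
      5040 * x 8 + 5760 * x 1 * x 7 + 3360 * x 2 * x 6 + 3360 * x 1 ^ 2 * x 6 + 2688 * x 3 * x 5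
      + 4032 * x 1 * x 2 * x 5 + 1344 * x 1 ^ 3 * x 5 + 1260 * x 4 ^ 2 + 3360 * x 1 * x 3 * x 4
      + 1260 * x 2 ^ 2 * x 4 + 2520 * x 1 ^ 2 * x 2 * x 4 + 420 * x 1 ^ 4 * x 4
      + 1120 * x 2 * x 3 ^ 2 + 1120 * x 1 ^ 2 * x 3 ^ 2 + 1680 * x 1 * x 2 ^ 2 * x 3
      + 1120 * x 1 ^ 3 * x 2 * x 3 + 112 * x 1 ^ 5 * x 3 + 105 * x 2 ^ 4 + 420 * x 1 ^ 2 * x 2 ^ 3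
      + 210 * x 1 ^ 4 * x 2 ^ 2 + 28 * x 1 ^ 6 * x 2 + x 1 ^ 8) / 40320 := by
  rw [expCoeff_succ]
  simp only [sum_range_succ, sum_range_zero, expCoeff_zero, expCoeff_1, expCoeff_2, expCoeff_3,
      expCoeff_4, expCoeff_5, expCoeff_6, expCoeff_7, Nat.reduceAdd, Nat.reduceSub]
  push_cast
  ring

theorem expCoeff_9 (x : ℕ → ℂ) : expCoeff x 9 = (
      40320 * x 9 + 45360 * x 1 * x 8 + 25920 * x 2 * x 7 + 25920 * x 1 ^ 2 * x 7
      + 20160 * x 3 * x 6 + 30240 * x 1 * x 2 * x 6 + 10080 * x 1 ^ 3 * x 6 + 18144 * x 4 * x 5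
      + 24192 * x 1 * x 3 * x 5 + 9072 * x 2 ^ 2 * x 5 + 18144 * x 1 ^ 2 * x 2 * x 5
      + 3024 * x 1 ^ 4 * x 5 + 11340 * x 1 * x 4 ^ 2 + 15120 * x 2 * x 3 * x 4
      + 15120 * x 1 ^ 2 * x 3 * x 4 + 11340 * x 1 * x 2 ^ 2 * x 4 + 7560 * x 1 ^ 3 * x 2 * x 4
      + 756 * x 1 ^ 5 * x 4 + 2240 * x 3 ^ 3 + 10080 * x 1 * x 2 * x 3 ^ 2 + 2520 * x 2 ^ 3 * x 3
      + 3360 * x 1 ^ 3 * x 3 ^ 2 + 7560 * x 1 ^ 2 * x 2 ^ 2 * x 3 + 2520 * x 1 ^ 4 * x 2 * x 3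
      + 168 * x 1 ^ 6 * x 3 + 945 * x 1 * x 2 ^ 4 + 1260 * x 1 ^ 3 * x 2 ^ 3
      + 378 * x 1 ^ 5 * x 2 ^ 2 + 36 * x 1 ^ 7 * x 2 + x 1 ^ 9) / 362880 := by
  rw [expCoeff_succ]
  simp only [sum_range_succ, sum_range_zero, expCoeff_zero, expCoeff_1, expCoeff_2, expCoeff_3,
      expCoeff_4, expCoeff_5, expCoeff_6, expCoeff_7, expCoeff_8, Nat.reduceAdd, Nat.reduceSub]
  push_cast
  ring

theorem expCoeff_10 (x : ℕ → ℂ) : expCoeff x 10 = (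
      362880 * x 10 + 403200 * x 1 * x 9 + 226800 * x 2 * x 8 + 226800 * x 1 ^ 2 * x 8
      + 172800 * x 3 * x 7 + 259200 * x 1 * x 2 * x 7 + 86400 * x 1 ^ 3 * x 7 + 151200 * x 4 * x 6
      + 201600 * x 1 * x 3 * x 6 + 75600 * x 2 ^ 2 * x 6 + 151200 * x 1 ^ 2 * x 2 * x 6
      + 25200 * x 1 ^ 4 * x 6 + 72576 * x 5 ^ 2 + 181440 * x 1 * x 4 * x 5
      + 120960 * x 2 * x 3 * x 5 + 120960 * x 1 ^ 2 * x 3 * x 5 + 90720 * x 1 * x 2 ^ 2 * x 5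
      + 60480 * x 1 ^ 3 * x 2 * x 5 + 6048 * x 1 ^ 5 * x 5 + 56700 * x 2 * x 4 ^ 2
      + 50400 * x 3 ^ 2 * x 4 + 56700 * x 1 ^ 2 * x 4 ^ 2 + 151200 * x 1 * x 2 * x 3 * x 4
      + 18900 * x 2 ^ 3 * x 4 + 50400 * x 1 ^ 3 * x 3 * x 4 + 56700 * x 1 ^ 2 * x 2 ^ 2 * x 4
      + 18900 * x 1 ^ 4 * x 2 * x 4 + 1260 * x 1 ^ 6 * x 4 + 22400 * x 1 * x 3 ^ 3
      + 25200 * x 2 ^ 2 * x 3 ^ 2 + 50400 * x 1 ^ 2 * x 2 * x 3 ^ 2 + 25200 * x 1 * x 2 ^ 3 * x 3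
      + 8400 * x 1 ^ 4 * x 3 ^ 2 + 25200 * x 1 ^ 3 * x 2 ^ 2 * x 3 + 5040 * x 1 ^ 5 * x 2 * x 3
      + 240 * x 1 ^ 7 * x 3 + 945 * x 2 ^ 5 + 4725 * x 1 ^ 2 * x 2 ^ 4 + 3150 * x 1 ^ 4 * x 2 ^ 3
      + 630 * x 1 ^ 6 * x 2 ^ 2 + 45 * x 1 ^ 8 * x 2 + x 1 ^ 10) / 3628800 := by
  rw [expCoeff_succ]
  simp only [sum_range_succ, sum_range_zero, expCoeff_zero, expCoeff_1, expCoeff_2, expCoeff_3,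
      expCoeff_4, expCoeff_5, expCoeff_6, expCoeff_7, expCoeff_8, expCoeff_9, Nat.reduceAdd,
      Nat.reduceSub]
  push_cast
  ring

theorem expCoeff_11 (x : ℕ → ℂ) : expCoeff x 11 = (
      3628800 * x 11 + 3991680 * x 1 * x 10 + 2217600 * x 2 * x 9 + 2217600 * x 1 ^ 2 * x 9
      + 1663200 * x 3 * x 8 + 2494800 * x 1 * x 2 * x 8 + 831600 * x 1 ^ 3 * x 8
      + 1425600 * x 4 * x 7 + 1900800 * x 1 * x 3 * x 7 + 712800 * x 2 ^ 2 * x 7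
      + 1425600 * x 1 ^ 2 * x 2 * x 7 + 237600 * x 1 ^ 4 * x 7 + 1330560 * x 5 * x 6
      + 1663200 * x 1 * x 4 * x 6 + 1108800 * x 2 * x 3 * x 6 + 1108800 * x 1 ^ 2 * x 3 * x 6
      + 831600 * x 1 * x 2 ^ 2 * x 6 + 554400 * x 1 ^ 3 * x 2 * x 6 + 55440 * x 1 ^ 5 * x 6
      + 798336 * x 1 * x 5 ^ 2 + 997920 * x 2 * x 4 * x 5 + 443520 * x 3 ^ 2 * x 5
      + 997920 * x 1 ^ 2 * x 4 * x 5 + 1330560 * x 1 * x 2 * x 3 * x 5 + 166320 * x 2 ^ 3 * x 5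
      + 443520 * x 1 ^ 3 * x 3 * x 5 + 498960 * x 1 ^ 2 * x 2 ^ 2 * x 5
      + 166320 * x 1 ^ 4 * x 2 * x 5 + 11088 * x 1 ^ 6 * x 5 + 415800 * x 3 * x 4 ^ 2
      + 623700 * x 1 * x 2 * x 4 ^ 2 + 554400 * x 1 * x 3 ^ 2 * x 4 + 415800 * x 2 ^ 2 * x 3 * x 4
      + 207900 * x 1 ^ 3 * x 4 ^ 2 + 831600 * x 1 ^ 2 * x 2 * x 3 * x 4
      + 207900 * x 1 * x 2 ^ 3 * x 4 + 138600 * x 1 ^ 4 * x 3 * x 4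
      + 207900 * x 1 ^ 3 * x 2 ^ 2 * x 4 + 41580 * x 1 ^ 5 * x 2 * x 4 + 1980 * x 1 ^ 7 * x 4
      + 123200 * x 2 * x 3 ^ 3 + 123200 * x 1 ^ 2 * x 3 ^ 3 + 277200 * x 1 * x 2 ^ 2 * x 3 ^ 2
      + 34650 * x 2 ^ 4 * x 3 + 184800 * x 1 ^ 3 * x 2 * x 3 ^ 2
      + 138600 * x 1 ^ 2 * x 2 ^ 3 * x 3 + 18480 * x 1 ^ 5 * x 3 ^ 2
      + 69300 * x 1 ^ 4 * x 2 ^ 2 * x 3 + 9240 * x 1 ^ 6 * x 2 * x 3 + 330 * x 1 ^ 8 * x 3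
      + 10395 * x 1 * x 2 ^ 5 + 17325 * x 1 ^ 3 * x 2 ^ 4 + 6930 * x 1 ^ 5 * x 2 ^ 3
      + 990 * x 1 ^ 7 * x 2 ^ 2 + 55 * x 1 ^ 9 * x 2 + x 1 ^ 11) / 39916800 := by
  rw [expCoeff_succ]
  simp only [sum_range_succ, sum_range_zero, expCoeff_zero, expCoeff_1, expCoeff_2, expCoeff_3,
      expCoeff_4, expCoeff_5, expCoeff_6, expCoeff_7, expCoeff_8, expCoeff_9, expCoeff_10,
      Nat.reduceAdd, Nat.reduceSub]
  push_cast
  ring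

theorem expCoeff_12 (x : ℕ → ℂ) : expCoeff x 12 = (
      39916800 * x 12 + 43545600 * x 1 * x 11 + 23950080 * x 2 * x 10 + 23950080 * x 1 ^ 2 * x 10
      + 17740800 * x 3 * x 9 + 26611200 * x 1 * x 2 * x 9 + 8870400 * x 1 ^ 3 * x 9
      + 14968800 * x 4 * x 8 + 19958400 * x 1 * x 3 * x 8 + 7484400 * x 2 ^ 2 * x 8
      + 14968800 * x 1 ^ 2 * x 2 * x 8 + 2494800 * x 1 ^ 4 * x 8 + 13685760 * x 5 * x 7
      + 17107200 * x 1 * x 4 * x 7 + 11404800 * x 2 * x 3 * x 7 + 11404800 * x 1 ^ 2 * x 3 * x 7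
      + 8553600 * x 1 * x 2 ^ 2 * x 7 + 5702400 * x 1 ^ 3 * x 2 * x 7 + 570240 * x 1 ^ 5 * x 7
      + 6652800 * x 6 ^ 2 + 15966720 * x 1 * x 5 * x 6 + 9979200 * x 2 * x 4 * x 6
      + 4435200 * x 3 ^ 2 * x 6 + 9979200 * x 1 ^ 2 * x 4 * x 6 + 13305600 * x 1 * x 2 * x 3 * x 6
      + 1663200 * x 2 ^ 3 * x 6 + 4435200 * x 1 ^ 3 * x 3 * x 6
      + 4989600 * x 1 ^ 2 * x 2 ^ 2 * x 6 + 1663200 * x 1 ^ 4 * x 2 * x 6 + 110880 * x 1 ^ 6 * x 6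
      + 4790016 * x 2 * x 5 ^ 2 + 7983360 * x 3 * x 4 * x 5 + 4790016 * x 1 ^ 2 * x 5 ^ 2
      + 11975040 * x 1 * x 2 * x 4 * x 5 + 5322240 * x 1 * x 3 ^ 2 * x 5
      + 3991680 * x 2 ^ 2 * x 3 * x 5 + 3991680 * x 1 ^ 3 * x 4 * x 5
      + 7983360 * x 1 ^ 2 * x 2 * x 3 * x 5 + 1995840 * x 1 * x 2 ^ 3 * x 5
      + 1330560 * x 1 ^ 4 * x 3 * x 5 + 1995840 * x 1 ^ 3 * x 2 ^ 2 * x 5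
      + 399168 * x 1 ^ 5 * x 2 * x 5 + 19008 * x 1 ^ 7 * x 5 + 1247400 * x 4 ^ 3
      + 4989600 * x 1 * x 3 * x 4 ^ 2 + 1871100 * x 2 ^ 2 * x 4 ^ 2
      + 3326400 * x 2 * x 3 ^ 2 * x 4 + 3742200 * x 1 ^ 2 * x 2 * x 4 ^ 2
      + 3326400 * x 1 ^ 2 * x 3 ^ 2 * x 4 + 4989600 * x 1 * x 2 ^ 2 * x 3 * x 4
      + 311850 * x 2 ^ 4 * x 4 + 623700 * x 1 ^ 4 * x 4 ^ 2 + 3326400 * x 1 ^ 3 * x 2 * x 3 * x 4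
      + 1247400 * x 1 ^ 2 * x 2 ^ 3 * x 4 + 332640 * x 1 ^ 5 * x 3 * x 4
      + 623700 * x 1 ^ 4 * x 2 ^ 2 * x 4 + 83160 * x 1 ^ 6 * x 2 * x 4 + 2970 * x 1 ^ 8 * x 4
      + 246400 * x 3 ^ 4 + 1478400 * x 1 * x 2 * x 3 ^ 3 + 554400 * x 2 ^ 3 * x 3 ^ 2
      + 492800 * x 1 ^ 3 * x 3 ^ 3 + 1663200 * x 1 ^ 2 * x 2 ^ 2 * x 3 ^ 2
      + 415800 * x 1 * x 2 ^ 4 * x 3 + 554400 * x 1 ^ 4 * x 2 * x 3 ^ 2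
      + 554400 * x 1 ^ 3 * x 2 ^ 3 * x 3 + 36960 * x 1 ^ 6 * x 3 ^ 2
      + 166320 * x 1 ^ 5 * x 2 ^ 2 * x 3 + 15840 * x 1 ^ 7 * x 2 * x 3 + 440 * x 1 ^ 9 * x 3
      + 10395 * x 2 ^ 6 + 62370 * x 1 ^ 2 * x 2 ^ 5 + 51975 * x 1 ^ 4 * x 2 ^ 4
      + 13860 * x 1 ^ 6 * x 2 ^ 3 + 1485 * x 1 ^ 8 * x 2 ^ 2 + 66 * x 1 ^ 10 * x 2
          + x 1 ^ 12) / 479001600 := by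
  rw [expCoeff_succ]
  simp only [sum_range_succ, sum_range_zero, expCoeff_zero, expCoeff_1, expCoeff_2, expCoeff_3,
      expCoeff_4, expCoeff_5, expCoeff_6, expCoeff_7, expCoeff_8, expCoeff_9, expCoeff_10,
      expCoeff_11, Nat.reduceAdd, Nat.reduceSub]
  push_cast
  ring

/-! ### Relations along lines in six variables -/

/-- The coefficient of index `m` of the line series of `Q = exp (∑ s k * t ^ k)`. The sum over `j`
includes `j = i`, which does not contribute. -/
def lineCoeff {n : ℕ} (a : Fin n → ℂ) (s : ℕ → ℂ) (m : ℕ) : ℂ :=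
  ∑ i, (differenceProduct a i)⁻¹ * expCoeff (fun k => k * s k * ∑ j, (a j - a i) ^ k) m

theorem univ_erase_fin6 :
    (univ.erase (0 : Fin 6) = {1, 2, 3, 4, 5}) ∧ (univ.erase (1 : Fin 6) = {0, 2, 3, 4, 5}) ∧
    (univ.erase (2 : Fin 6) = {0, 1, 3, 4, 5}) ∧ (univ.erase (3 : Fin 6) = {0, 1, 2, 4, 5}) ∧
    (univ.erase (4 : Fin 6) = {0, 1, 2, 3, 5}) ∧ (univ.erase (5 : Fin 6) = {0, 1, 2, 3, 4}) := by
  decide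

theorem differenceProduct_fin6 (a : Fin 6 → ℂ) :
    differenceProduct a 0 =
      (a 1 - a 0) * ((a 2 - a 0) * ((a 3 - a 0) * ((a 4 - a 0) * (a 5 - a 0)))) ∧
    differenceProduct a 1 =
      (a 0 - a 1) * ((a 2 - a 1) * ((a 3 - a 1) * ((a 4 - a 1) * (a 5 - a 1)))) ∧
    differenceProduct a 2 =
      (a 0 - a 2) * ((a 1 - a 2) * ((a 3 - a 2) * ((a 4 - a 2) * (a 5 - a 2)))) ∧
    differenceProduct a 3 =
      (a 0 - a 3) * ((a 1 - a 3) * ((a 2 - a 3) * ((a 4 - a 3) * (a 5 - a 3)))) ∧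
    differenceProduct a 4 =
      (a 0 - a 4) * ((a 1 - a 4) * ((a 2 - a 4) * ((a 3 - a 4) * (a 5 - a 4)))) ∧
    differenceProduct a 5 =
      (a 0 - a 5) * ((a 1 - a 5) * ((a 2 - a 5) * ((a 3 - a 5) * (a 4 - a 5)))) := by
  obtain ⟨h0, h1, h2, h3, h4, h5⟩ := univ_erase_fin6
  simp only [differenceProduct, h0, h1, h2, h3, h4, h5]
  simp

theorem lineCoeff_fin6 (a₀ a₁ a₂ a₃ a₄ a₅ : ℂ) (s : ℕ → ℂ) (m : ℕ) :
    lineCoeff ![a₀, a₁, a₂, a₃, a₄, a₅] s m =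
      ((a₁ - a₀) * ((a₂ - a₀) * ((a₃ - a₀) * ((a₄ - a₀) * (a₅ - a₀)))))⁻¹ *
        expCoeff (fun k => k * s k * ((a₀ - a₀) ^ k + (a₁ - a₀) ^ k + (a₂ - a₀) ^ k + (a₃ - a₀) ^ k
          + (a₄ - a₀) ^ k + (a₅ - a₀) ^ k)) m +
      ((a₀ - a₁) * ((a₂ - a₁) * ((a₃ - a₁) * ((a₄ - a₁) * (a₅ - a₁)))))⁻¹ *
        expCoeff (fun k => k * s k * ((a₀ - a₁) ^ k + (a₁ - a₁) ^ k + (a₂ - a₁) ^ k + (a₃ - a₁) ^ k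
          + (a₄ - a₁) ^ k + (a₅ - a₁) ^ k)) m +
      ((a₀ - a₂) * ((a₁ - a₂) * ((a₃ - a₂) * ((a₄ - a₂) * (a₅ - a₂)))))⁻¹ *
        expCoeff (fun k => k * s k * ((a₀ - a₂) ^ k + (a₁ - a₂) ^ k + (a₂ - a₂) ^ k + (a₃ - a₂) ^ k
          + (a₄ - a₂) ^ k + (a₅ - a₂) ^ k)) m +
      ((a₀ - a₃) * ((a₁ - a₃) * ((a₂ - a₃) * ((a₄ - a₃) * (a₅ - a₃)))))⁻¹ *
        expCoeff (fun k => k * s k * ((a₀ - a₃) ^ k + (a₁ - a₃) ^ k + (a₂ - a₃) ^ k + (a₃ - a₃) ^ k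
          + (a₄ - a₃) ^ k + (a₅ - a₃) ^ k)) m +
      ((a₀ - a₄) * ((a₁ - a₄) * ((a₂ - a₄) * ((a₃ - a₄) * (a₅ - a₄)))))⁻¹ *
        expCoeff (fun k => k * s k * ((a₀ - a₄) ^ k + (a₁ - a₄) ^ k + (a₂ - a₄) ^ k + (a₃ - a₄) ^ k
          + (a₄ - a₄) ^ k + (a₅ - a₄) ^ k)) m +
      ((a₀ - a₅) * ((a₁ - a₅) * ((a₂ - a₅) * ((a₃ - a₅) * (a₄ - a₅)))))⁻¹ *
        expCoeff (fun k => k * s k * ((a₀ - a₅) ^ k + (a₁ - a₅) ^ k + (a₂ - a₅) ^ k + (a₃ - a₅) ^ k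
          + (a₄ - a₅) ^ k + (a₅ - a₅) ^ k)) m := by
  rw [lineCoeff, Fin.sum_univ_six]
  obtain ⟨h0, h1, h2, h3, h4, h5⟩ := differenceProduct_fin6 ![a₀, a₁, a₂, a₃, a₄, a₅]
  rw [h0, h1, h2, h3, h4, h5]
  simp only [Fin.sum_univ_six]
  rfl

/-- The relation of weight `5` along the line `(0, 1, 2, 3, 4, 5)`. In this and the following
lemmas, the first number in the name lists the entries of the line and the second is the weight;
the factor on the left-hand side makes the coefficients on the right coprime integers. -/
theorem lineCoeff_012345_5 (s : ℕ → ℂ) :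
    lineCoeff ![0, 1, 2, 3, 4, 5] s 5 * (5 / 6) =
      5 * s 5 + 30 * s 1 * s 4 + 30 * s 2 * s 3 + 90 * s 1 ^ 2 * s 3 + 90 * s 1 * s 2 ^ 2
      + 180 * s 1 ^ 3 * s 2 + 54 * s 1 ^ 5 := by
  rw [lineCoeff_fin6]
  simp only [expCoeff_5]
  norm_num
  ring

theorem lineCoeff_012345_7 (s : ℕ → ℂ) :
    lineCoeff ![0, 1, 2, 3, 4, 5] s 7 * (1 / 3) =
      140 * s 7 + 630 * s 1 * s 6 + 490 * s 2 * s 5 + 1365 * s 1 ^ 2 * s 5 + 420 * s 3 * s 4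
      + 2100 * s 1 * s 2 * s 4 + 1890 * s 1 ^ 3 * s 4 + 945 * s 1 * s 3 ^ 2 + 840 * s 2 ^ 2 * s 3
      + 4410 * s 1 ^ 2 * s 2 * s 3 + 1890 * s 1 ^ 4 * s 3 + 1260 * s 1 * s 2 ^ 3
      + 3150 * s 1 ^ 3 * s 2 ^ 2 + 1512 * s 1 ^ 5 * s 2 + 162 * s 1 ^ 7 := by
  rw [lineCoeff_fin6]
  simp only [expCoeff_7]
  norm_num
  ring

theorem lineCoeff_012346_8 (s : ℕ → ℂ) :
    lineCoeff ![0, 1, 2, 3, 4, 6] s 8 * (1 / 8) =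
      105 * s 8 + 385 * s 1 * s 7 + 210 * s 2 * s 6 + 630 * s 1 ^ 2 * s 6 + 105 * s 3 * s 5
      + 560 * s 1 * s 2 * s 5 + 560 * s 1 ^ 3 * s 5 + 35 * s 4 ^ 2 + 210 * s 1 * s 3 * s 4
      + 70 * s 2 ^ 2 * s 4 + 420 * s 1 ^ 2 * s 2 * s 4 + 210 * s 1 ^ 4 * s 4
      - 210 * s 1 * s 2 ^ 2 * s 3 - 420 * s 1 ^ 3 * s 2 * s 3 - 126 * s 1 ^ 5 * s 3 - 35 * s 2 ^ 4
      - 420 * s 1 ^ 2 * s 2 ^ 3 - 630 * s 1 ^ 4 * s 2 ^ 2 - 252 * s 1 ^ 6 * s 2 - 27 * s 1 ^ 8 := by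
  rw [lineCoeff_fin6]
  simp only [expCoeff_8]
  norm_num
  ring

theorem lineCoeff_012345_9 (s : ℕ → ℂ) :
    lineCoeff ![0, 1, 2, 3, 4, 5] s 9 * (20 / 9) =
      37800 * s 9 + 144480 * s 1 * s 8 + 105280 * s 2 * s 7 + 266840 * s 1 ^ 2 * s 7
      + 89880 * s 3 * s 6 + 392280 * s 1 * s 2 * s 6 + 318780 * s 1 ^ 3 * s 6 + 85400 * s 4 * s 5
      + 346080 * s 1 * s 3 * s 5 + 148540 * s 2 ^ 2 * s 5 + 719740 * s 1 ^ 2 * s 2 * s 5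
      + 280245 * s 1 ^ 4 * s 5 + 168560 * s 1 * s 4 ^ 2 + 268800 * s 2 * s 3 * s 4
      + 659400 * s 1 ^ 2 * s 3 * s 4 + 561400 * s 1 * s 2 ^ 2 * s 4 + 877800 * s 1 ^ 3 * s 2 * s 4
      + 197190 * s 1 ^ 5 * s 4 + 41580 * s 3 ^ 3 + 527940 * s 1 * s 2 * s 3 ^ 2
      + 151480 * s 2 ^ 3 * s 3 + 417690 * s 1 ^ 3 * s 3 ^ 2 + 1069320 * s 1 ^ 2 * s 2 ^ 2 * s 3
      + 812070 * s 1 ^ 4 * s 2 * s 3 + 118314 * s 1 ^ 6 * s 3 + 153720 * s 1 * s 2 ^ 4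
      + 467880 * s 1 ^ 3 * s 2 ^ 3 + 310842 * s 1 ^ 5 * s 2 ^ 2 + 63612 * s 1 ^ 7 * s 2
      + 3726 * s 1 ^ 9 := by
  rw [lineCoeff_fin6]
  simp only [expCoeff_9]
  norm_num
  ring

theorem lineCoeff_012346_9 (s : ℕ → ℂ) :
    lineCoeff ![0, 1, 2, 3, 4, 6] s 9 * (5 / 14) =
      12075 * s 9 + 45570 * s 1 * s 8 + 32270 * s 2 * s 7 + 82810 * s 1 ^ 2 * s 7
      + 26670 * s 3 * s 6 + 118020 * s 1 * s 2 * s 6 + 97020 * s 1 ^ 3 * s 6 + 24850 * s 4 * s 5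
      + 101220 * s 1 * s 3 * s 5 + 43610 * s 2 ^ 2 * s 5 + 212660 * s 1 ^ 2 * s 2 * s 5
      + 83580 * s 1 ^ 4 * s 5 + 48790 * s 1 * s 4 ^ 2 + 77700 * s 2 * s 3 * s 4
      + 191100 * s 1 ^ 2 * s 3 * s 4 + 163100 * s 1 * s 2 ^ 2 * s 4 + 256200 * s 1 ^ 3 * s 2 * s 4
      + 57960 * s 1 ^ 5 * s 4 + 11970 * s 3 ^ 3 + 152460 * s 1 * s 2 * s 3 ^ 2
      + 43820 * s 2 ^ 3 * s 3 + 120960 * s 1 ^ 3 * s 3 ^ 2 + 310380 * s 1 ^ 2 * s 2 ^ 2 * s 3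
      + 236880 * s 1 ^ 4 * s 2 * s 3 + 34776 * s 1 ^ 6 * s 3 + 44730 * s 1 * s 2 ^ 4
      + 136920 * s 1 ^ 3 * s 2 ^ 3 + 91728 * s 1 ^ 5 * s 2 ^ 2 + 19008 * s 1 ^ 7 * s 2
      + 1134 * s 1 ^ 9 := by
  rw [lineCoeff_fin6]
  simp only [expCoeff_9]
  norm_num
  ring

theorem lineCoeff_012346_10 (s : ℕ → ℂ) :
    lineCoeff ![0, 1, 2, 3, 4, 6] s 10 * (15 / 8) =
      155925 * s 10 + 494550 * s 1 * s 9 + 274050 * s 2 * s 8 + 711900 * s 1 ^ 2 * s 8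
      + 182175 * s 3 * s 7 + 725550 * s 1 * s 2 * s 7 + 590800 * s 1 ^ 3 * s 7
      + 153300 * s 4 * s 6 + 478800 * s 1 * s 3 * s 6 + 165900 * s 2 ^ 2 * s 6
      + 774900 * s 1 ^ 2 * s 2 * s 6 + 277200 * s 1 ^ 4 * s 6 + 74025 * s 5 ^ 2
      + 421050 * s 1 * s 4 * s 5 + 200550 * s 2 * s 3 * s 5 + 491400 * s 1 ^ 2 * s 3 * s 5
      + 234150 * s 1 * s 2 ^ 2 * s 5 + 272300 * s 1 ^ 3 * s 2 * s 5 + 22890 * s 1 ^ 5 * s 5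
      + 87150 * s 2 * s 4 ^ 2 + 50400 * s 3 ^ 2 * s 4 + 224700 * s 1 ^ 2 * s 4 ^ 2
      + 163800 * s 1 * s 2 * s 3 * s 4 - 21700 * s 2 ^ 3 * s 4 + 90300 * s 1 ^ 3 * s 3 * s 4
      - 268800 * s 1 ^ 2 * s 2 ^ 2 * s 4 - 342300 * s 1 ^ 4 * s 2 * s 4 - 83160 * s 1 ^ 6 * s 4
      - 9450 * s 1 * s 3 ^ 3 - 69300 * s 2 ^ 2 * s 3 ^ 2 - 415800 * s 1 ^ 2 * s 2 * s 3 ^ 2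
      - 424200 * s 1 * s 2 ^ 3 * s 3 - 207900 * s 1 ^ 4 * s 3 ^ 2
      - 1199100 * s 1 ^ 3 * s 2 ^ 2 * s 3 - 675360 * s 1 ^ 5 * s 2 * s 3 - 90180 * s 1 ^ 7 * s 3
      - 26110 * s 2 ^ 5 - 354900 * s 1 ^ 2 * s 2 ^ 4 - 636300 * s 1 ^ 4 * s 2 ^ 3
      - 337680 * s 1 ^ 6 * s 2 ^ 2 - 62910 * s 1 ^ 8 * s 2 - 3564 * s 1 ^ 10 := by
  rw [lineCoeff_fin6]
  simp only [expCoeff_10]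
  norm_num
  ring

theorem lineCoeff_012356_10 (s : ℕ → ℂ) :
    lineCoeff ![0, 1, 2, 3, 5, 6] s 10 * (15 / 8) =
      103950 * s 10 + 337050 * s 1 * s 9 + 200340 * s 2 * s 8 + 499590 * s 1 ^ 2 * s 8
      + 148890 * s 3 * s 7 + 555240 * s 1 * s 2 * s 7 + 431270 * s 1 ^ 3 * s 7
      + 136500 * s 4 * s 6 + 413280 * s 1 * s 3 * s 6 + 139020 * s 2 ^ 2 * s 6
      + 631260 * s 1 ^ 2 * s 2 * s 6 + 214200 * s 1 ^ 4 * s 6 + 67725 * s 5 ^ 2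
      + 388500 * s 1 * s 4 * s 5 + 185640 * s 2 * s 3 * s 5 + 455490 * s 1 ^ 2 * s 3 * s 5
      + 218820 * s 1 * s 2 ^ 2 * s 5 + 257320 * s 1 ^ 3 * s 2 * s 5 + 23100 * s 1 ^ 5 * s 5
      + 83580 * s 2 * s 4 ^ 2 + 49770 * s 3 ^ 2 * s 4 + 216930 * s 1 ^ 2 * s 4 ^ 2
      + 191520 * s 1 * s 2 * s 3 * s 4 - 13160 * s 2 ^ 3 * s 4 + 123900 * s 1 ^ 3 * s 3 * s 4
      - 186060 * s 1 ^ 2 * s 2 ^ 2 * s 4 - 253680 * s 1 ^ 4 * s 2 * s 4 - 64260 * s 1 ^ 6 * s 4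
      - 1890 * s 1 * s 3 ^ 3 - 53550 * s 2 ^ 2 * s 3 ^ 2 - 321300 * s 1 ^ 2 * s 2 * s 3 ^ 2
      - 349440 * s 1 * s 2 ^ 3 * s 3 - 160650 * s 1 ^ 4 * s 3 ^ 2
      - 980700 * s 1 ^ 3 * s 2 ^ 2 * s 3 - 547848 * s 1 ^ 5 * s 2 * s 3 - 72468 * s 1 ^ 7 * s 3
      - 21980 * s 2 ^ 5 - 295890 * s 1 ^ 2 * s 2 ^ 4 - 524160 * s 1 ^ 4 * s 2 ^ 3
      - 273924 * s 1 ^ 6 * s 2 ^ 2 - 50004 * s 1 ^ 8 * s 2 - 2754 * s 1 ^ 10 := by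
  rw [lineCoeff_fin6]
  simp only [expCoeff_10]
  norm_num
  ring

theorem lineCoeff_012345_11 (s : ℕ → ℂ) :
    lineCoeff ![0, 1, 2, 3, 4, 5] s 11 * 280 =
      154492800 * s 11 + 536936400 * s 1 * s 10 + 386996400 * s 2 * s 9
      + 910942200 * s 1 ^ 2 * s 9 + 327902400 * s 3 * s 8 + 1330257600 * s 1 * s 2 * s 8
      + 1011679200 * s 1 ^ 3 * s 8 + 299208000 * s 4 * s 7 + 1144508400 * s 1 * s 3 * s 7
      + 492198000 * s 2 ^ 2 * s 7 + 2256760800 * s 1 ^ 2 * s 2 * s 7 + 834189300 * s 1 ^ 4 * s 7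
      + 285129600 * s 5 * s 6 + 1055098800 * s 1 * s 4 * s 6 + 855061200 * s 2 * s 3 * s 6
      + 1970627400 * s 1 ^ 2 * s 3 * s 6 + 1700206200 * s 1 * s 2 ^ 2 * s 6
      + 2535435000 * s 1 ^ 3 * s 2 * s 6 + 549757530 * s 1 ^ 5 * s 6 + 512278200 * s 1 * s 5 ^ 2
      + 803115600 * s 2 * s 4 * s 5 + 378302400 * s 3 ^ 2 * s 5 + 1844425800 * s 1 ^ 2 * s 4 * s 5
      + 3013416000 * s 1 * s 2 * s 3 * s 5 + 435076600 * s 2 ^ 3 * s 5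
      + 2250309600 * s 1 ^ 3 * s 3 * s 5 + 2933097300 * s 1 ^ 2 * s 2 ^ 2 * s 5
      + 2139583950 * s 1 ^ 4 * s 2 * s 5 + 304328745 * s 1 ^ 6 * s 5 + 365954400 * s 3 * s 4 ^ 2
      + 1452376800 * s 1 * s 2 * s 4 ^ 2 + 1375201800 * s 1 * s 3 ^ 2 * s 4
      + 1186894800 * s 2 ^ 2 * s 3 * s 4 + 1080702000 * s 1 ^ 3 * s 4 ^ 2
      + 5343256800 * s 1 ^ 2 * s 2 * s 3 * s 4 + 1548531600 * s 1 * s 2 ^ 3 * s 4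
      + 1944639900 * s 1 ^ 4 * s 3 * s 4 + 3407707800 * s 1 ^ 3 * s 2 ^ 2 * s 4
      + 1463959980 * s 1 ^ 5 * s 2 * s 4 + 147022290 * s 1 ^ 7 * s 4 + 373199400 * s 2 * s 3 ^ 3
      + 844546500 * s 1 ^ 2 * s 3 ^ 3 + 2194686900 * s 1 * s 2 ^ 2 * s 3 ^ 2
      + 318292800 * s 2 ^ 4 * s 3 + 3225266100 * s 1 ^ 3 * s 2 * s 3 ^ 2
      + 2817473400 * s 1 ^ 2 * s 2 ^ 3 * s 3 + 691277895 * s 1 ^ 5 * s 3 ^ 2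
      + 3047284800 * s 1 ^ 4 * s 2 ^ 2 * s 3 + 860791050 * s 1 ^ 6 * s 2 * s 3
      + 64275930 * s 1 ^ 8 * s 3 + 246370320 * s 1 * s 2 ^ 5 + 892899000 * s 1 ^ 3 * s 2 ^ 4
      + 761976180 * s 1 ^ 5 * s 2 ^ 3 + 228645990 * s 1 ^ 7 * s 2 ^ 2 + 26418960 * s 1 ^ 9 * s 2
      + 992898 * s 1 ^ 11 := by
  rw [lineCoeff_fin6]
  simp only [expCoeff_11]
  norm_num
  ring

theorem lineCoeff_012456_11 (s : ℕ → ℂ) :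
    lineCoeff ![0, 1, 2, 4, 5, 6] s 11 * (175 / 4) =
      81987675 * s 11 + 289639350 * s 1 * s 10 + 215507250 * s 2 * s 9 + 500661000 * s 1 ^ 2 * s 9
      + 188562150 * s 3 * s 8 + 755376300 * s 1 * s 2 * s 8 + 567378000 * s 1 ^ 3 * s 8
      + 176206800 * s 4 * s 7 + 670439700 * s 1 * s 3 * s 7 + 288040200 * s 2 ^ 2 * s 7
      + 1306865700 * s 1 ^ 2 * s 2 * s 7 + 477319500 * s 1 ^ 4 * s 7 + 170104200 * s 5 * s 6
      + 631663200 * s 1 * s 4 * s 6 + 514974600 * s 2 * s 3 * s 6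
      + 1175409900 * s 1 ^ 2 * s 3 * s 6 + 1013342400 * s 1 * s 2 ^ 2 * s 6
      + 1495103400 * s 1 ^ 3 * s 2 * s 6 + 320173560 * s 1 ^ 5 * s 6 + 309178800 * s 1 * s 5 ^ 2
      + 492305100 * s 2 * s 4 * s 5 + 233547300 * s 3 ^ 2 * s 5 + 1120366800 * s 1 ^ 2 * s 4 * s 5
      + 1843128000 * s 1 * s 2 * s 3 * s 5 + 265650700 * s 2 ^ 3 * s 5
      + 1363408200 * s 1 ^ 3 * s 3 * s 5 + 1774999800 * s 1 ^ 2 * s 2 ^ 2 * s 5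
      + 1280153700 * s 1 ^ 4 * s 2 * s 5 + 179534880 * s 1 ^ 6 * s 5 + 228145050 * s 3 * s 4 ^ 2
      + 897794100 * s 1 * s 2 * s 4 ^ 2 + 856737000 * s 1 * s 3 ^ 2 * s 4
      + 737887500 * s 2 ^ 2 * s 3 * s 4 + 662256000 * s 1 ^ 3 * s 4 ^ 2
      + 3299335200 * s 1 ^ 2 * s 2 * s 3 * s 4 + 954277800 * s 1 * s 2 ^ 3 * s 4
      + 1189395900 * s 1 ^ 4 * s 3 * s 4 + 2080587600 * s 1 ^ 3 * s 2 ^ 2 * s 4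
      + 882728280 * s 1 ^ 5 * s 2 * s 4 + 87207840 * s 1 ^ 7 * s 4 + 233717400 * s 2 * s 3 ^ 3
      + 526119300 * s 1 ^ 2 * s 3 ^ 3 + 1364428800 * s 1 * s 2 ^ 2 * s 3 ^ 2
      + 197512350 * s 2 ^ 4 * s 3 + 1989829800 * s 1 ^ 3 * s 2 * s 3 ^ 2
      + 1734843600 * s 1 ^ 2 * s 2 ^ 3 * s 3 + 421916040 * s 1 ^ 5 * s 3 ^ 2
      + 1856754900 * s 1 ^ 4 * s 2 ^ 2 * s 3 + 517104000 * s 1 ^ 6 * s 2 * s 3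
      + 37900710 * s 1 ^ 8 * s 3 + 151443180 * s 1 * s 2 ^ 5 + 543286800 * s 1 ^ 3 * s 2 ^ 4
      + 457463160 * s 1 ^ 5 * s 2 ^ 3 + 134933040 * s 1 ^ 7 * s 2 ^ 2 + 15265260 * s 1 ^ 9 * s 2
      + 559872 * s 1 ^ 11 := by
  rw [lineCoeff_fin6]
  simp only [expCoeff_11]
  norm_num
  ring

theorem lineCoeff_023457_11 (s : ℕ → ℂ) :
    lineCoeff ![0, 2, 3, 4, 5, 7] s 11 * 1400 =
      4950422400 * s 11 + 16795270800 * s 1 * s 10 + 11542230000 * s 2 * s 9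
      + 27701919000 * s 1 ^ 2 * s 9 + 9310795200 * s 3 * s 8 + 38504894400 * s 1 * s 2 * s 8
      + 29824956000 * s 1 ^ 3 * s 8 + 8189966400 * s 4 * s 7 + 31594071600 * s 1 * s 3 * s 7
      + 13611687600 * s 2 ^ 2 * s 7 + 63382485600 * s 1 ^ 2 * s 2 * s 7
      + 23841310500 * s 1 ^ 4 * s 7 + 7650249600 * s 5 * s 6 + 28171407600 * s 1 * s 4 * s 6
      + 22631590800 * s 2 * s 3 * s 6 + 52927900200 * s 1 ^ 2 * s 3 * s 6
      + 45724354200 * s 1 * s 2 ^ 2 * s 6 + 69278290200 * s 1 ^ 3 * s 2 * s 6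
      + 15296860530 * s 1 ^ 5 * s 6 + 13508573400 * s 1 * s 5 ^ 2 + 20678422800 * s 2 * s 4 * s 5
      + 9631742400 * s 3 ^ 2 * s 5 + 48174575400 * s 1 ^ 2 * s 4 * s 5
      + 77881608000 * s 1 * s 2 * s 3 * s 5 + 11276312600 * s 2 ^ 3 * s 5
      + 59031957600 * s 1 ^ 3 * s 3 * s 5 + 77094000900 * s 1 ^ 2 * s 2 ^ 2 * s 5
      + 57229795350 * s 1 ^ 4 * s 2 * s 5 + 8314144965 * s 1 ^ 6 * s 5
      + 9170834400 * s 3 * s 4 ^ 2 + 36912808800 * s 1 * s 2 * s 4 ^ 2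
      + 34513857000 * s 1 * s 3 ^ 2 * s 4 + 29893626000 * s 2 ^ 2 * s 3 * s 4
      + 27856710000 * s 1 ^ 3 * s 4 ^ 2 + 136113717600 * s 1 ^ 2 * s 2 * s 3 * s 4
      + 39581144400 * s 1 * s 2 ^ 3 * s 4 + 50314502700 * s 1 ^ 4 * s 3 * s 4
      + 88434271800 * s 1 ^ 3 * s 2 ^ 2 * s 4 + 38756729340 * s 1 ^ 5 * s 2 * s 4
      + 3992341770 * s 1 ^ 7 * s 4 + 9287800200 * s 2 * s 3 ^ 3 + 21209598900 * s 1 ^ 2 * s 3 ^ 3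
      + 55312380900 * s 1 * s 2 ^ 2 * s 3 ^ 2 + 8048308800 * s 2 ^ 4 * s 3
      + 82346940900 * s 1 ^ 3 * s 2 * s 3 ^ 2 + 72183547800 * s 1 ^ 2 * s 2 ^ 3 * s 3
      + 17967484395 * s 1 ^ 5 * s 3 ^ 2 + 79444411200 * s 1 ^ 4 * s 2 ^ 2 * s 3
      + 22962564450 * s 1 ^ 6 * s 2 * s 3 + 1765324530 * s 1 ^ 8 * s 3
      + 6331404240 * s 1 * s 2 ^ 5 + 23340605400 * s 1 ^ 3 * s 2 ^ 4
      + 20358025380 * s 1 ^ 5 * s 2 ^ 3 + 6277781070 * s 1 ^ 7 * s 2 ^ 2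
      + 749353680 * s 1 ^ 9 * s 2 + 29213946 * s 1 ^ 11 := by
  rw [lineCoeff_fin6]
  simp only [expCoeff_11]
  norm_num
  ring

theorem lineCoeff_012346_11 (s : ℕ → ℂ) :
    lineCoeff ![0, 1, 2, 3, 4, 6] s 11 * (105 / 4) =
      43710975 * s 11 + 148024800 * s 1 * s 10 + 101940300 * s 2 * s 9 + 243695025 * s 1 ^ 2 * s 9
      + 83087550 * s 3 * s 8 + 340162200 * s 1 * s 2 * s 8 + 262009650 * s 1 ^ 3 * s 8
      + 74172000 * s 4 * s 7 + 282913050 * s 1 * s 3 * s 7 + 121159500 * s 2 ^ 2 * s 7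
      + 560927850 * s 1 ^ 2 * s 2 * s 7 + 209454350 * s 1 ^ 4 * s 7 + 70044450 * s 5 * s 6
      + 256244100 * s 1 * s 4 * s 6 + 204485400 * s 2 * s 3 * s 6
      + 476239050 * s 1 ^ 2 * s 3 * s 6 + 408993900 * s 1 * s 2 ^ 2 * s 6
      + 615583500 * s 1 ^ 3 * s 2 * s 6 + 134758260 * s 1 ^ 5 * s 6 + 123743025 * s 1 * s 5 ^ 2
      + 189193200 * s 2 * s 4 * s 5 + 88088175 * s 3 ^ 2 * s 5 + 439726350 * s 1 ^ 2 * s 4 * s 5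
      + 707815500 * s 1 * s 2 * s 3 * s 5 + 102071200 * s 2 ^ 3 * s 5
      + 534223200 * s 1 ^ 3 * s 3 * s 5 + 694267350 * s 1 ^ 2 * s 2 ^ 2 * s 5
      + 511911400 * s 1 ^ 4 * s 2 * s 5 + 73714340 * s 1 ^ 6 * s 5 + 84358050 * s 3 * s 4 ^ 2
      + 338112600 * s 1 * s 2 * s 4 ^ 2 + 316760850 * s 1 * s 3 ^ 2 * s 4
      + 273800100 * s 2 ^ 2 * s 3 * s 4 + 254437750 * s 1 ^ 3 * s 4 ^ 2
      + 1243034100 * s 1 ^ 2 * s 2 * s 3 * s 4 + 360665200 * s 1 * s 2 ^ 3 * s 4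
      + 457648800 * s 1 ^ 4 * s 3 * s 4 + 802279100 * s 1 ^ 3 * s 2 ^ 2 * s 4
      + 349552560 * s 1 ^ 5 * s 2 * s 4 + 35735880 * s 1 ^ 7 * s 4 + 85418550 * s 2 * s 3 ^ 3
      + 194670000 * s 1 ^ 2 * s 3 ^ 3 + 507298050 * s 1 * s 2 ^ 2 * s 3 ^ 2
      + 73822350 * s 2 ^ 4 * s 3 + 753127200 * s 1 ^ 3 * s 2 * s 3 ^ 2
      + 660414300 * s 1 ^ 2 * s 2 ^ 3 * s 3 + 163704240 * s 1 ^ 5 * s 3 ^ 2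
      + 724470600 * s 1 ^ 4 * s 2 ^ 2 * s 3 + 208538400 * s 1 ^ 6 * s 2 * s 3
      + 15953310 * s 1 ^ 8 * s 3 + 58039240 * s 1 * s 2 ^ 5 + 213484250 * s 1 ^ 3 * s 2 ^ 4
      + 185735760 * s 1 ^ 5 * s 2 ^ 3 + 57127680 * s 1 ^ 7 * s 2 ^ 2 + 6804720 * s 1 ^ 9 * s 2
      + 265086 * s 1 ^ 11 := by
  rw [lineCoeff_fin6]
  simp only [expCoeff_11]
  norm_num
  ring

theorem lineCoeff_012346_12 (s : ℕ → ℂ) :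
    lineCoeff ![0, 1, 2, 3, 4, 6] s 12 * (45 / 56) =
      4054050 * s 12 + 11798325 * s 1 * s 11 + 6860700 * s 2 * s 10 + 15904350 * s 1 ^ 2 * s 10
      + 5041575 * s 3 * s 9 + 17822700 * s 1 * s 2 * s 9 + 12877200 * s 1 ^ 3 * s 9
      + 4290300 * s 4 * s 8 + 13088250 * s 1 * s 3 * s 8 + 4743900 * s 2 ^ 2 * s 8
      + 20241900 * s 1 ^ 2 * s 2 * s 8 + 6561450 * s 1 ^ 4 * s 8 + 3906000 * s 5 * s 7
      + 11144700 * s 1 * s 4 * s 7 + 6655950 * s 2 * s 3 * s 7 + 14502600 * s 1 ^ 2 * s 3 * s 7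
      + 9324000 * s 1 * s 2 ^ 2 * s 7 + 11392500 * s 1 ^ 3 * s 2 * s 7 + 1645350 * s 1 ^ 5 * s 7
      + 1886850 * s 6 ^ 2 + 10231200 * s 1 * s 5 * s 6 + 5594400 * s 2 * s 4 * s 6
      + 2258550 * s 3 ^ 2 * s 6 + 12184200 * s 1 ^ 2 * s 4 * s 6
      + 11925900 * s 1 * s 2 * s 3 * s 6 + 991200 * s 2 ^ 3 * s 6 + 7137900 * s 1 ^ 3 * s 3 * s 6
      + 3943800 * s 1 ^ 2 * s 2 ^ 2 * s 6 + 69300 * s 1 ^ 4 * s 2 * s 6 - 540540 * s 1 ^ 6 * s 6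
      + 2642850 * s 2 * s 5 ^ 2 + 3909150 * s 3 * s 4 * s 5 + 5707800 * s 1 ^ 2 * s 5 ^ 2
      + 9815400 * s 1 * s 2 * s 4 * s 5 + 3581550 * s 1 * s 3 ^ 2 * s 5
      + 1174950 * s 2 ^ 2 * s 3 * s 5 + 5604900 * s 1 ^ 3 * s 4 * s 5
      + 1033200 * s 1 ^ 2 * s 2 * s 3 * s 5 - 2263800 * s 1 * s 2 ^ 3 * s 5
      - 1940400 * s 1 ^ 4 * s 3 * s 5 - 9132900 * s 1 ^ 3 * s 2 ^ 2 * s 5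
      - 6296640 * s 1 ^ 5 * s 2 * s 5 - 932220 * s 1 ^ 7 * s 5 + 598500 * s 4 ^ 3
      + 3153150 * s 1 * s 3 * s 4 ^ 2 + 409500 * s 2 ^ 2 * s 4 ^ 2 - 37800 * s 2 * s 3 ^ 2 * s 4
      - 157500 * s 1 ^ 2 * s 2 * s 4 ^ 2 - 1625400 * s 1 ^ 2 * s 3 ^ 2 * s 4
      - 10023300 * s 1 * s 2 ^ 2 * s 3 * s 4 - 1215900 * s 2 ^ 4 * s 4
      - 1202250 * s 1 ^ 4 * s 4 ^ 2 - 21684600 * s 1 ^ 3 * s 2 * s 3 * s 4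
      - 13939800 * s 1 ^ 2 * s 2 ^ 3 * s 4 - 6776280 * s 1 ^ 5 * s 3 * s 4
      - 19565700 * s 1 ^ 4 * s 2 ^ 2 * s 4 - 7141680 * s 1 ^ 6 * s 2 * s 4
      - 676080 * s 1 ^ 8 * s 4 - 70875 * s 3 ^ 4 - 4025700 * s 1 * s 2 * s 3 ^ 3
      - 2671200 * s 2 ^ 3 * s 3 ^ 2 - 3931200 * s 1 ^ 3 * s 3 ^ 3
      - 21961800 * s 1 ^ 2 * s 2 ^ 2 * s 3 ^ 2 - 8193150 * s 1 * s 2 ^ 4 * s 3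
      - 19882800 * s 1 ^ 4 * s 2 * s 3 ^ 2 - 28530600 * s 1 ^ 3 * s 2 ^ 3 * s 3
      - 3560760 * s 1 ^ 6 * s 3 ^ 2 - 22080240 * s 1 ^ 5 * s 2 ^ 2 * s 3
      - 5343840 * s 1 ^ 7 * s 2 * s 3 - 370170 * s 1 ^ 9 * s 3 - 289940 * s 2 ^ 6
      - 4435620 * s 1 ^ 2 * s 2 ^ 5 - 9314550 * s 1 ^ 4 * s 2 ^ 4 - 6179040 * s 1 ^ 6 * s 2 ^ 3
      - 1624320 * s 1 ^ 8 * s 2 ^ 2 - 174636 * s 1 ^ 10 * s 2 - 6318 * s 1 ^ 12 := by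
  rw [lineCoeff_fin6]
  simp only [expCoeff_12]
  norm_num
  ring

theorem lineCoeff_012356_12 (s : ℕ → ℂ) :
    lineCoeff ![0, 1, 2, 3, 5, 6] s 12 * (225 / 14) =
      48648600 * s 12 + 145114200 * s 1 * s 11 + 91060200 * s 2 * s 10
      + 201455100 * s 1 ^ 2 * s 10 + 74655000 * s 3 * s 9 + 246267000 * s 1 * s 2 * s 9
      + 168745500 * s 1 ^ 3 * s 9 + 70232400 * s 4 * s 8 + 204195600 * s 1 * s 3 * s 8
      + 71933400 * s 2 ^ 2 * s 8 + 293365800 * s 1 ^ 2 * s 2 * s 8 + 89230050 * s 1 ^ 4 * s 8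
      + 68657400 * s 5 * s 7 + 193662000 * s 1 * s 4 * s 7 + 115151400 * s 2 * s 3 * s 7
      + 242720100 * s 1 ^ 2 * s 3 * s 7 + 152094600 * s 1 * s 2 ^ 2 * s 7
      + 176484000 * s 1 ^ 3 * s 2 * s 7 + 23187570 * s 1 ^ 5 * s 7 + 34064100 * s 6 ^ 2
      + 189970200 * s 1 * s 5 * s 6 + 108334800 * s 2 * s 4 * s 6 + 44698500 * s 3 ^ 2 * s 6
      + 230819400 * s 1 ^ 2 * s 4 * s 6 + 233226000 * s 1 * s 2 * s 3 * s 6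
      + 19740000 * s 2 ^ 3 * s 6 + 138171600 * s 1 ^ 3 * s 3 * s 6
      + 81736200 * s 1 ^ 2 * s 2 ^ 2 * s 6 + 9141300 * s 1 ^ 4 * s 2 * s 6
      - 8024940 * s 1 ^ 6 * s 6 + 53531100 * s 2 * s 5 ^ 2 + 84394800 * s 3 * s 4 * s 5
      + 113863050 * s 1 ^ 2 * s 5 ^ 2 + 219718800 * s 1 * s 2 * s 4 * s 5
      + 85144500 * s 1 * s 3 ^ 2 * s 5 + 35166600 * s 2 ^ 2 * s 3 * s 5
      + 130363800 * s 1 ^ 3 * s 4 * s 5 + 82908000 * s 1 ^ 2 * s 2 * s 3 * s 5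
      - 25662000 * s 1 * s 2 ^ 3 * s 5 - 10927350 * s 1 ^ 4 * s 3 * s 5
      - 127314600 * s 1 ^ 3 * s 2 ^ 2 * s 5 - 94143840 * s 1 ^ 5 * s 2 * s 5
      - 14208120 * s 1 ^ 7 * s 5 + 13431600 * s 4 ^ 3 + 80917200 * s 1 * s 3 * s 4 ^ 2
      + 15661800 * s 2 ^ 2 * s 4 ^ 2 + 13570200 * s 2 * s 3 ^ 2 * s 4
      + 36300600 * s 1 ^ 2 * s 2 * s 4 ^ 2 + 6369300 * s 1 ^ 2 * s 3 ^ 2 * s 4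
      - 132778800 * s 1 * s 2 ^ 2 * s 3 * s 4 - 19303200 * s 2 ^ 4 * s 4
      - 6796650 * s 1 ^ 4 * s 4 ^ 2 - 309607200 * s 1 ^ 3 * s 2 * s 3 * s 4
      - 222558000 * s 1 ^ 2 * s 2 ^ 3 * s 4 - 101431260 * s 1 ^ 5 * s 3 * s 4
      - 312440100 * s 1 ^ 4 * s 2 ^ 2 * s 4 - 113306760 * s 1 ^ 6 * s 2 * s 4
      - 10556460 * s 1 ^ 8 * s 4 - 326025 * s 3 ^ 4 - 59648400 * s 1 * s 2 * s 3 ^ 3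
      - 44289000 * s 2 ^ 3 * s 3 ^ 2 - 59213700 * s 1 ^ 3 * s 3 ^ 3
      - 361651500 * s 1 ^ 2 * s 2 ^ 2 * s 3 ^ 2 - 140616000 * s 1 * s 2 ^ 4 * s 3
      - 324702000 * s 1 ^ 4 * s 2 * s 3 ^ 2 - 482092800 * s 1 ^ 3 * s 2 ^ 3 * s 3
      - 57550500 * s 1 ^ 6 * s 3 ^ 2 - 366215220 * s 1 ^ 5 * s 2 ^ 2 * s 3
      - 86632200 * s 1 ^ 7 * s 2 * s 3 - 5830380 * s 1 ^ 9 * s 3 - 5096840 * s 2 ^ 6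
      - 76576920 * s 1 ^ 2 * s 2 ^ 5 - 157414950 * s 1 ^ 4 * s 2 ^ 4
      - 101820600 * s 1 ^ 6 * s 2 ^ 3 - 25977780 * s 1 ^ 8 * s 2 ^ 2 - 2696976 * s 1 ^ 10 * s 2
      - 93798 * s 1 ^ 12 := by
  rw [lineCoeff_fin6]
  simp only [expCoeff_12]
  norm_num
  ring

theorem lineCoeff_012347_12 (s : ℕ → ℂ) :
    lineCoeff ![0, 1, 2, 3, 4, 7] s 12 * (63 / 2) =
      859458600 * s 12 + 2477752200 * s 1 * s 11 + 1415799000 * s 2 * s 10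
      + 3301244100 * s 1 ^ 2 * s 10 + 1031070600 * s 3 * s 9 + 3633525000 * s 1 * s 2 * s 9
      + 2635157700 * s 1 ^ 3 * s 9 + 883537200 * s 4 * s 8 + 2658625200 * s 1 * s 3 * s 8
      + 953505000 * s 2 ^ 2 * s 8 + 4072080600 * s 1 ^ 2 * s 2 * s 8 + 1319374350 * s 1 ^ 4 * s 8
      + 814753800 * s 5 * s 7 + 2293074000 * s 1 * s 4 * s 7 + 1337981400 * s 2 * s 3 * s 7
      + 2930262300 * s 1 ^ 2 * s 3 * s 7 + 1850902200 * s 1 * s 2 ^ 2 * s 7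
      + 2253165600 * s 1 ^ 3 * s 2 * s 7 + 320417790 * s 1 ^ 5 * s 7 + 395999100 * s 6 ^ 2
      + 2133268200 * s 1 * s 5 * s 6 + 1137553200 * s 2 * s 4 * s 6 + 450783900 * s 3 ^ 2 * s 6
      + 2509630200 * s 1 ^ 2 * s 4 * s 6 + 2380114800 * s 1 * s 2 * s 3 * s 6
      + 192813600 * s 2 ^ 3 * s 6 + 1436526000 * s 1 ^ 3 * s 3 * s 6
      + 751174200 * s 1 ^ 2 * s 2 ^ 2 * s 6 - 17356500 * s 1 ^ 4 * s 2 * s 6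
      - 114053940 * s 1 ^ 6 * s 6 + 540886500 * s 2 * s 5 ^ 2 + 779158800 * s 3 * s 4 * s 5
      + 1188044550 * s 1 ^ 2 * s 5 ^ 2 + 1986793200 * s 1 * s 2 * s 4 * s 5
      + 704421900 * s 1 * s 3 ^ 2 * s 5 + 224695800 * s 2 ^ 2 * s 3 * s 5
      + 1163639400 * s 1 ^ 3 * s 4 * s 5 + 172418400 * s 1 ^ 2 * s 2 * s 3 * s 5
      - 470744400 * s 1 * s 2 ^ 3 * s 5 - 393860250 * s 1 ^ 4 * s 3 * s 5
      - 1869264600 * s 1 ^ 3 * s 2 ^ 2 * s 5 - 1280781600 * s 1 ^ 5 * s 2 * s 5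
      - 189286920 * s 1 ^ 7 * s 5 + 118213200 * s 4 ^ 3 + 616921200 * s 1 * s 3 * s 4 ^ 2
      + 78183000 * s 2 ^ 2 * s 4 ^ 2 - 20223000 * s 2 * s 3 ^ 2 * s 4
      - 39526200 * s 1 ^ 2 * s 2 * s 4 ^ 2 - 353675700 * s 1 ^ 2 * s 3 ^ 2 * s 4
      - 2047726800 * s 1 * s 2 ^ 2 * s 3 * s 4 - 246405600 * s 2 ^ 4 * s 4
      - 238138950 * s 1 ^ 4 * s 4 ^ 2 - 4405010400 * s 1 ^ 3 * s 2 * s 3 * s 4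
      - 2824155600 * s 1 ^ 2 * s 2 ^ 3 * s 4 - 1371246660 * s 1 ^ 5 * s 3 * s 4
      - 3965293500 * s 1 ^ 4 * s 2 ^ 2 * s 4 - 1448992440 * s 1 ^ 6 * s 2 * s 4
      - 137476980 * s 1 ^ 8 * s 4 - 15209775 * s 3 ^ 4 - 820335600 * s 1 * s 2 * s 3 ^ 3
      - 540149400 * s 2 ^ 3 * s 3 ^ 2 - 800055900 * s 1 ^ 3 * s 3 ^ 3
      - 4446659700 * s 1 ^ 2 * s 2 ^ 2 * s 3 ^ 2 - 1656547200 * s 1 * s 2 ^ 4 * s 3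
      - 4031974800 * s 1 ^ 4 * s 2 * s 3 ^ 2 - 5785785600 * s 1 ^ 3 * s 2 ^ 3 * s 3
      - 723457980 * s 1 ^ 6 * s 3 ^ 2 - 4493967660 * s 1 ^ 5 * s 2 ^ 2 * s 3
      - 1092529080 * s 1 ^ 7 * s 2 * s 3 - 76115700 * s 1 ^ 9 * s 3 - 58633400 * s 2 ^ 6
      - 900591720 * s 1 ^ 2 * s 2 ^ 5 - 1900391850 * s 1 ^ 4 * s 2 ^ 4
      - 1268192520 * s 1 ^ 6 * s 2 ^ 3 - 335835180 * s 1 ^ 8 * s 2 ^ 2 - 36437040 * s 1 ^ 10 * s 2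
      - 1333098 * s 1 ^ 12 := by
  rw [lineCoeff_fin6]
  simp only [expCoeff_12]
  norm_num
  ring

end

/-! ### Classification of the first coefficients -/

theorem injective_of_natCast {a : Fin 6 → ℂ} (b : Fin 6 → ℕ) (hb : Function.Injective b)
    (h : ∀ i, a i = b i) : Function.Injective a := by
  intro i j hij
  rw [h, h] at hij
  exact hb (Nat.cast_injective hij)

theorem injective_012345 : Function.Injective (![0, 1, 2, 3, 4, 5] : Fin 6 → ℂ) :=
  injective_of_natCast ![0, 1, 2, 3, 4, 5] (by decide) (by intro i; fin_cases i <;> simp)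

theorem injective_012456 : Function.Injective (![0, 1, 2, 4, 5, 6] : Fin 6 → ℂ) :=
  injective_of_natCast ![0, 1, 2, 4, 5, 6] (by decide) (by intro i; fin_cases i <;> simp)

theorem injective_023457 : Function.Injective (![0, 2, 3, 4, 5, 7] : Fin 6 → ℂ) :=
  injective_of_natCast ![0, 2, 3, 4, 5, 7] (by decide) (by intro i; fin_cases i <;> simp)

theorem injective_012346 : Function.Injective (![0, 1, 2, 3, 4, 6] : Fin 6 → ℂ) :=
  injective_of_natCast ![0, 1, 2, 3, 4, 6] (by decide) (by intro i; fin_cases i <;> simp)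

theorem injective_012356 : Function.Injective (![0, 1, 2, 3, 5, 6] : Fin 6 → ℂ) :=
  injective_of_natCast ![0, 1, 2, 3, 5, 6] (by decide) (by intro i; fin_cases i <;> simp)

theorem injective_012347 : Function.Injective (![0, 1, 2, 3, 4, 7] : Fin 6 → ℂ) :=
  injective_of_natCast ![0, 1, 2, 3, 4, 7] (by decide) (by intro i; fin_cases i <;> simp)

set_option maxHeartbeats 2000000 in
/-- Classification of the solutions with `s₁ = 1`. In the coordinates `p` and `y`, given by
`s₂ = p - 3 / 2` and `s₃ = y - 4 p`, the level `3` family is `p = 0` and the level `6` family is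
`y ^ 2 = 18 p`. The variables `e` and `d` measure by how much `s₄` differs from a common expression
for its value in these two families and `s₆` from the value that the differential equation
prescribes. -/
theorem classification_one (s : ℕ → ℂ)
    (h : ∀ a : Fin 6 → ℂ, Function.Injective a → ∀ m, lineCoeff a s m = 0) (h1 : s 1 = 1)
    (d e y p : ℂ)
    (h2 : s 2 = (-3 + 2 * p) / 2)
    (h3 : s 3 = y - 4 * p)
    (h4 : s 4 = (9 + 20 * e - 36 * y + 204 * p - 16 * y * p + 4 * p ^ 2) / 20)
    (h6 : s 6 = (-54 + 210 * d + 180 * e - 324 * y + 2052 * p - 120 * e * p - 135 * y ^ 2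
        + 1152 * y * p - 3528 * p ^ 2 + 96 * y * p ^ 2 + 16 * p ^ 3) / 210) :
    d = 0 ∧ e = 0 ∧ p * (y ^ 2 - 18 * p) = 0 := by
  have c5 := lineCoeff_012345_5 s
  rw [h _ injective_012345, zero_mul] at c5
  have c7 := lineCoeff_012345_7 s
  rw [h _ injective_012345, zero_mul] at c7
  have c8 := lineCoeff_012346_8 s
  rw [h _ injective_012346, zero_mul] at c8
  have c9a := lineCoeff_012345_9 s
  rw [h _ injective_012345, zero_mul] at c9a
  have c9b := lineCoeff_012346_9 s
  rw [h _ injective_012346, zero_mul] at c9b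
  have c10a := lineCoeff_012346_10 s
  rw [h _ injective_012346, zero_mul] at c10a
  have c10b := lineCoeff_012356_10 s
  rw [h _ injective_012356, zero_mul] at c10b
  have c11a := lineCoeff_012345_11 s
  rw [h _ injective_012345, zero_mul] at c11a
  have c11b := lineCoeff_012456_11 s
  rw [h _ injective_012456, zero_mul] at c11b
  have c11c := lineCoeff_023457_11 s
  rw [h _ injective_023457, zero_mul] at c11c
  have c11d := lineCoeff_012346_11 s
  rw [h _ injective_012346, zero_mul] at c11d
  have c12a := lineCoeff_012346_12 s
  rw [h _ injective_012346, zero_mul] at c12a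
  have c12b := lineCoeff_012356_12 s
  rw [h _ injective_012356, zero_mul] at c12b
  have c12c := lineCoeff_012347_12 s
  rw [h _ injective_012347, zero_mul] at c12c
  simp only [h1, h2, h3, h4] at c5
  -- each weight gives the next coefficient from one line; the relations `r9` to `r12c` along the
  -- other lines, from which that coefficient is eliminated, involve `d`, `e`, `y` and `p` only
  have h5 : s 5 = (-30 * e + 9 * y - 36 * p - 6 * y * p + 24 * p ^ 2) / 5 := by
    linear_combination (-1 / 5) * c5
  simp only [h1, h2, h3, h4, h6, h5] at c7
  have h7 : s 7 = (-315 * d + 2250 * e + 108 * y - 432 * p - 210 * e * y + 1440 * e * p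
      + 108 * y ^ 2 - 1224 * y * p + 1008 * p ^ 2 + 168 * y ^ 2 * p - 144 * y * p ^ 2
      - 192 * p ^ 3) / 70 := by
    linear_combination (-1 / 140) * c7
  simp only [h1, h2, h3, h4, h6, h5, h7] at c8
  have h8 : s 8 = (729 + 56700 * d - 563760 * e - 5832 * y + 33048 * p - 8400 * d * p - 1400 * e ^ 2
      + 68040 * e * y - 286560 * e * p - 12636 * y ^ 2 + 124416 * y * p + 115992 * p ^ 2
      + 2240 * e * y * p + 1440 * e * p ^ 2 - 23832 * y ^ 2 * p - 18144 * y * p ^ 2 + 101088 * p ^ 3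
      - 896 * y ^ 2 * p ^ 2 - 1152 * y * p ^ 3 + 144 * p ^ 4) / 4200 := by
    linear_combination (-1 / 105) * c8
  simp only [h1, h2, h3, h4, h6, h5, h7, h8] at c9a
  simp only [h1, h2, h3, h4, h6, h5, h7, h8] at c9b
  have h9 : s 9 = (-59535 * d + 663390 * e + 1458 * y - 5832 * p - 4494 * d * y + 36498 * d * p
      + 19600 * e ^ 2 - 36990 * e * y + 81180 * e * p + 8748 * y ^ 2 - 90396 * y * p
      - 395280 * p ^ 2 - 820 * e * y * p - 58320 * e * p ^ 2 + 810 * y ^ 3 + 22608 * y ^ 2 * p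
      + 83592 * y * p ^ 2 - 32256 * p ^ 3 - 11888 * y ^ 2 * p ^ 2 + 9936 * y * p ^ 3
      + 1728 * p ^ 4) / 1890 := by
    linear_combination (-1 / 37800) * c9a
  have r9 : (-51450 * d * y + 205800 * d * p + 245000 * e ^ 2 + 661500 * e * y - 2205000 * e * p
      - 1587600 * p ^ 2 - 98000 * e * y * p + 88200 * y ^ 2 * p + 1411200 * p ^ 3
      - 78400 * y ^ 2 * p ^ 2) / 9 = 0 := by
    linear_combination (-1 / (5 / 14)) * c9b + ((161 / 81) / (20 / 9)) * c9a
  simp only [h1, h2, h3, h4, h6, h5, h7, h8, h9] at c10a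
  simp only [h1, h2, h3, h4, h6, h5, h7, h8, h9] at c10b
  have h10 : s 10 = (-118098 + 58327290 * d - 688773780 * e - 236196 * y + 1810836 * p
      - 919800 * d * e + 10757145 * d * y - 75529020 * d * p - 32354200 * e ^ 2 - 27294030 * e * y
      + 342188640 * e * p - 5727753 * y ^ 2 + 56896992 * y * p + 526052880 * p ^ 2
      + 735840 * d * y * p + 2109240 * d * p ^ 2 + 550800 * e ^ 2 * p + 3568050 * e * y ^ 2
      - 56624360 * e * y * p + 202973040 * e * p ^ 2 - 1574640 * y ^ 3 - 11959524 * y ^ 2 * p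
      - 101780064 * y * p ^ 2 - 173203200 * p ^ 3 - 881280 * e * y * p ^ 2 - 38880 * e * p ^ 3
      - 2854440 * y ^ 3 * p + 30630236 * y ^ 2 * p ^ 2 - 9937728 * y * p ^ 3 - 22231584 * p ^ 4
      + 352512 * y ^ 2 * p ^ 3 + 31104 * y * p ^ 4 + 15552 * p ^ 5) / 935550 := by
    linear_combination (-1 / 155925) * c10a
  have r10 : (493920 * d * e - 1564080 * d * y + 8034432 * d * p + 2156000 * e ^ 2
      + 20109600 * e * y
      - 105134400 * e * p + 6604416 * p ^ 2 - 395136 * d * y * p - 1270080 * e * y ^ 2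
      + 18188800 * e * y * p - 30481920 * e * p ^ 2 - 366912 * y ^ 2 * p - 18289152 * y * p ^ 2
      + 67286016 * p ^ 3 + 1016064 * y ^ 3 * p - 3738112 * y ^ 2 * p ^ 2) / 27 = 0 := by
    linear_combination (-1 / (15 / 8)) * c10b + ((2 / 3) / (15 / 8)) * c10a
  simp only [h1, h2, h3, h4, h6, h5, h7, h8, h9, h10] at c11a
  simp only [h1, h2, h3, h4, h6, h5, h7, h8, h9, h10] at c11b
  simp only [h1, h2, h3, h4, h6, h5, h7, h8, h9, h10] at c11c
  simp only [h1, h2, h3, h4, h6, h5, h7, h8, h9, h10] at c11d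
  have h11 : s 11 = (-28220304420 * d + 344183499000 * e + 65819952 * y - 263279808 * p
      + 4269395025 * d * e - 10783367805 * d * y + 67819738350 * d * p - 13072859000 * e ^ 2
      + 78143794470 * e * y - 528640910280 * e * p + 1777138704 * y ^ 2 - 17946906912 * y * p
      - 321431462136 * p ^ 2 + 687999060 * d * y * p - 10162136880 * d * p ^ 2
      + 1081637550 * e ^ 2 * y - 10163599200 * e ^ 2 * p - 7109619480 * e * y ^ 2
      + 75252456140 * e * y * p - 161372353680 * e * p ^ 2 + 1162819152 * y ^ 3
      + 2275039260 * y ^ 2 * p + 36214311384 * y * p ^ 2 + 365651600256 * p ^ 3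
      - 1730620080 * e * y ^ 2 * p + 6099913440 * e * y * p ^ 2 + 7280824320 * e * p ^ 3
      + 3648609684 * y ^ 3 * p - 31713018368 * y ^ 2 * p ^ 2 - 18486646848 * y * p ^ 3
      + 11006648064 * p ^ 4 + 692248032 * y ^ 3 * p ^ 2 + 1624772736 * y ^ 2 * p ^ 3
      - 1391157504 * y * p ^ 4 - 52005888 * p ^ 5) / 260706600 := by
    linear_combination (-1 / 154492800) * c11a
  have r11b : (-17771781825 * d * e + 6500827893 * d * y - 31818793566 * d * p
      + 198547794200 * e ^ 2
      - 83582072910 * e * y + 403224381000 * e * p + 21147816312 * p ^ 2 - 790358436 * d * y * p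
      + 8330751072 * d * p ^ 2 - 3321060750 * e ^ 2 * y + 12502173600 * e ^ 2 * p
      + 2828309400 * e * y ^ 2 - 24119437580 * e * y * p - 69201896400 * e * p ^ 2
      - 1174878684 * y ^ 2 * p + 86109042600 * y * p ^ 2 - 566167230720 * p ^ 3
      + 5313697200 * e * y ^ 2 * p - 8102404800 * e * y * p ^ 2 - 4783835700 * y ^ 3 * p
      + 31453735040 * y ^ 2 * p ^ 2 + 38258619840 * y * p ^ 3 + 27350410752 * p ^ 4
      - 2125478880 * y ^ 3 * p ^ 2 - 1519467264 * y ^ 2 * p ^ 3) / 6270 = 0 := by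
    linear_combination (-1 / (175 / 4)) * c11b + ((14197 / 4180) / 280) * c11a
  have r11c : (7443286200 * d * e - 3315989208 * d * y + 16098385296 * d * p - 80700555200 * e ^ 2
      + 42634146960 * e * y - 202851576000 * e * p - 14859588672 * p ^ 2 + 452090016 * d * y * p
      - 4327852032 * d * p ^ 2 + 1519722000 * e ^ 2 * y - 6760281600 * e ^ 2 * p
      - 2183630400 * e * y ^ 2 + 17682920480 * e * y * p + 15846710400 * e * p ^ 2
      + 825532704 * y ^ 2 * p - 38429380800 * y * p ^ 2 + 258254046720 * p ^ 3
      - 2431555200 * e * y ^ 2 * p + 4633804800 * e * y * p ^ 2 + 2134965600 * y ^ 3 * p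
      - 14347447040 * y ^ 2 * p ^ 2 - 17507197440 * y * p ^ 3 - 11151654912 * p ^ 4
      + 972622080 * y ^ 3 * p ^ 2 + 619536384 * y ^ 2 * p ^ 3) / 1045 = 0 := by
    linear_combination (-1 / 1400) * c11c + ((6697 / 1045) / 280) * c11a
  have r11d : (31167509625 * d * e - 16383022845 * d * y + 79036574190 * d * p
      - 334010803000 * e ^ 2
      + 210638865150 * e * y - 991511325000 * e * p - 88823521080 * p ^ 2 + 2436939540 * d * y * p
      - 21751742880 * d * p ^ 2 + 6662958750 * e ^ 2 * y - 33229644000 * e ^ 2 * p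
      - 10855215000 * e * y ^ 2 + 82521306700 * e * y * p + 68475834000 * e * p ^ 2
      + 4934640060 * y ^ 2 * p - 177726263400 * y * p ^ 2 + 1208008368000 * p ^ 3
      - 10660734000 * e * y ^ 2 * p + 22093512000 * e * y * p ^ 2 + 9873681300 * y ^ 3 * p
      - 67111576000 * y ^ 2 * p ^ 2 - 76757284800 * y * p ^ 3 - 64658926080 * p ^ 4
      + 4264293600 * y ^ 3 * p ^ 2 + 3592162560 * y ^ 2 * p ^ 3) / 11286 = 0 := by
    linear_combination (-1 / (105 / 4)) * c11d + ((2523 / 836) / 280) * c11a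
  simp only [h1, h2, h3, h4, h6, h5, h7, h8, h9, h10, h11] at c12a
  simp only [h1, h2, h3, h4, h6, h5, h7, h8, h9, h10, h11] at c12b
  simp only [h1, h2, h3, h4, h6, h5, h7, h8, h9, h10, h11] at c12c
  have r12b : (20052287640 * d ^ 2 + 476105308875 * d * e - 277969848303 * d * y
      + 1409080200906 * d * p
      - 8027241828200 * e ^ 2 + 3573898049610 * e * y - 18281582235000 * e * p
      + 593412461208 * p ^ 2 - 31484930400 * d * e * p - 53983751976 * d * y ^ 2
      + 501602625132 * d * y * p - 1520194714080 * d * p ^ 2 + 803216753850 * e ^ 2 * y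
      - 3670618616000 * e ^ 2 * p + 357803286120 * e * y ^ 2 - 2613140124700 * e * y * p
      + 17296232914800 * e * p ^ 2 - 32967358956 * y ^ 2 * p - 4628937600504 * y * p ^ 2
      + 19903244288256 * p ^ 3 + 25187944320 * d * y * p ^ 2 - 502314934800 * e * y ^ 2 * p
      - 482157256000 * e * y * p ^ 2 + 1943069990400 * e * p ^ 3 + 257163200028 * y ^ 3 * p
      - 1105735793792 * y ^ 2 * p ^ 2 + 2019721943232 * y * p ^ 3 - 9781084776960 * p ^ 4
      - 112206774624 * y ^ 3 * p ^ 2 + 543393598720 * y ^ 2 * p ^ 3) / 28215 = 0 := by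
    linear_combination (-1 / (225 / 14)) * c12b + ((3 / 5) / (45 / 56)) * c12a
  have r12c : (-718918200 * d ^ 2 - 100867890375 * d * e + 104924743035 * d * y
      - 521464863570 * d * p
      + 1144834069000 * e ^ 2 - 1349032410450 * e * y + 6677472375000 * e * p
      + 97473135240 * p ^ 2 + 8268876000 * d * e * p + 11980389960 * d * y ^ 2
      - 120250367580 * d * y * p + 409541754720 * d * p ^ 2 - 112011317250 * e ^ 2 * y
      + 488513176000 * e ^ 2 * p - 42675352200 * e * y ^ 2 + 330774250700 * e * y * p
      - 2825742654000 * e * p ^ 2 - 5415174180 * y ^ 2 * p + 1434586046040 * y * p ^ 2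
      - 7023241186560 * p ^ 3 - 6615100800 * d * y * p ^ 2 + 64955634000 * e * y ^ 2 * p
      + 100305512000 * e * y * p ^ 2 - 510307776000 * e * p ^ 3 - 79699224780 * y ^ 3 * p
      + 390180065920 * y ^ 2 * p ^ 2 - 355009245120 * y * p ^ 3 + 2485151838720 * p ^ 4
      + 19722735840 * y ^ 3 * p ^ 2 - 138063991040 * y ^ 2 * p ^ 3) / 5643 = 0 := by
    linear_combination (-1 / (63 / 2)) * c12c + ((265 / 49) / (45 / 56)) * c12a
  -- in this combination all terms other than `d * e` and `e ^ 2` cancel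
  have hed : e * (7 * d - 45 * e) = 0 := by
    linear_combination (17 / 211680) * r10 + (67 / 6350400) * r11b + (109 / 147000) * r9
      + (271 / 9331200) * r11c + (-73 / 1176000) * r11d + (-43 / 73500) * p * r9
  clear h1 h2 h3 h4 h5 h6 h7 h8 h9 h10 h11
  by_cases he : e = 0
  · subst he
    have hd : d = 0 := by
      refine pow_eq_zero_iff two_ne_zero |>.1 ?_
      linear_combination (157 / 96347328) * r12b + (61 / 49156800) * r12c
          + (-482 / 5702375) * y * r9
        + (58741 / 1412364240) * r10 + (1272539 / 2942425500) * r9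
        + (3529 / 446009760) * r11b + (166027 / 12451864320) * r11c
        + (-172797 / 7846468000) * r11d
    subst hd
    refine ⟨rfl, rfl, ?_⟩
    -- outside the two families the relations leave the point `p = 9 / 8`, `y = 9 / 2`, but it lies
    -- on the curve `y ^ 2 = 18 * p`
    have e1 : p * (y ^ 2 - 18 * p) * (8 * p - 9) = 0 := by
      linear_combination (-9 / 9800) * r9
    have e2 : p * (y ^ 2 - 18 * p) * (2 * y - 9) = 0 := by
      linear_combination 2 * ((1 / 37632) * r10 + (-149 / 352800) * r9)
    by_contra hX
    have hp : p = 9 / 8 := by linear_combination ((mul_eq_zero.1 e1).resolve_left hX) / 8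
    have hy : y = 9 / 2 := by linear_combination ((mul_eq_zero.1 e2).resolve_left hX) / 2
    apply hX
    rw [hp, hy]
    norm_num
  · exfalso
    have hd : d = 45 / 7 * e := by linear_combination ((mul_eq_zero.1 hed).resolve_left he) / 7
    subst hd
    have ea : (100 * e ^ 2 + 135 * e * y - 360 * e * p - 648 * p ^ 2 - 40 * e * y * p
        + 36 * y ^ 2 * p
        + 576 * p ^ 3 - 32 * y ^ 2 * p ^ 2) / 100 = 0 := by
      linear_combination (9 / 245000) * r9
    have eb : (-4455 * e * y + 13770 * e * p + 17496 * p ^ 2 + 2700 * e * y * p - 12240 * e * p ^ 2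
        - 972 * y ^ 2 * p - 15552 * p ^ 3 + 1120 * e * y * p ^ 2
            + 864 * y ^ 2 * p ^ 2) / 1120 = 0 := by
      linear_combination (161069 / 14563584000) * r11d + (914239 / 550503475200) * r11b
        + (-2882353 / 808903065600) * r11c + (-2087443 / 7645881600) * r9
        + (-222227 / 18350115840) * r10 + (523 / 7185024000) * r12c
        + (-41 / 14082647040) * r12b + (577 / 14817600) * y * r9
        + (-641 / 106686720) * p * r10
    have ec : (-45 * e * y + 540 * e * p - 648 * p ^ 2 + 70 * e * y ^ 2 - 520 * e * y * p
        + 640 * e * p ^ 2 + 36 * y ^ 2 * p + 576 * p ^ 3 - 32 * y ^ 2 * p ^ 2) / 70 = 0 := by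
      linear_combination (-10513 / 573441120) * r10 + (-2869 / 9955575) * r9
          + (37 / 179625600) * r12c
        + (-863 / 860161680) * r11b + (-12391 / 1263911040) * r11c + (13 / 352066176) * r12b
        + (2833 / 113778000) * r11d + (13 / 171500) * y * r9 + (-19 / 1333584) * p * r10
    have ef : (-2430 * e * y + 9315 * e * p + 5832 * p ^ 2 + 2160 * e * y * p - 10800 * e * p ^ 2
        - 324 * y ^ 2 * p - 5184 * p ^ 3 + 2240 * e * p ^ 3 + 288 * y ^ 2 * p ^ 2) / 2240 = 0 := by
      linear_combination (893 / 14370048000) * r12c + (2711 / 2265446400) * r11b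
        + (-1744451 / 808903065600) * r11c + (-10389467 / 76458816000) * r9
        + (89 / 28165294080) * r12b + (-104765 / 14680092672) * r10
        + (102631 / 14563584000) * r11d + (41 / 1481760) * y * r9
        + (-121 / 21337344) * p * r10
    have e1 : (p - 9 / 8) * (y * (p - 9 / 4) - 6 * p * (p - 15 / 8)) = 0 := by
      refine (mul_eq_zero.1 ?_).resolve_left he
      linear_combination eb - 6 * ef
    have e2 : 9 / 32 * y ^ 2 - (9 / 8 * p + 81 / 64) * y + p ^ 3 - 9 / 4 * p ^ 2
        + 405 / 64 * p = 0 := by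
      refine (mul_eq_zero.1 ?_).resolve_left he
      linear_combination ef + 9 / 32 * ec
    -- elimination of `y` from `e1` and `e2`
    have hp : p = 9 / 8 ∨ p = 0 ∧ y = 0 := by
      rcases mul_eq_zero.1 e1 with e1 | e1
      · exact Or.inl (by linear_combination e1)
      have e3 : p ^ 2 * (p - 9 / 8) ^ 3 = 0 := by
        linear_combination (p - 9 / 4) ^ 2 * e2 - (9 / 32 * (y * (p - 9 / 4) + 6 * p * (p - 15 / 8))
          - (9 / 8 * p + 81 / 64) * (p - 9 / 4)) * e1
      rcases mul_eq_zero.1 e3 with e3 | e3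
      · have hp := pow_eq_zero_iff two_ne_zero |>.1 e3
        refine Or.inr ⟨hp, ?_⟩
        rw [hp] at e1
        linear_combination -4 / 9 * e1
      · exact Or.inl (by linear_combination pow_eq_zero_iff three_ne_zero |>.1 e3)
    -- at the remaining points `ea` reduces to `e ^ 2 = 0`
    apply he
    refine pow_eq_zero_iff two_ne_zero |>.1 ?_
    rcases hp with hp | ⟨hp, hy⟩
    · have hy : y = 9 / 2 := by
        rw [hp] at e2
        have : (y - 9 / 2) ^ 2 = 0 := by linear_combination 32 / 9 * e2
        linear_combination pow_eq_zero_iff two_ne_zero |>.1 this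
      rw [hp, hy] at ea
      linear_combination ea
    · rw [hp, hy] at ea
      linear_combination ea

set_option maxHeartbeats 2000000 in
/-- Classification of the solutions with `s₁ = 0`. The variable `d` is the difference of `s₆` and
the value that the differential equation prescribes. -/
theorem classification_zero (s : ℕ → ℂ)
    (h : ∀ a : Fin 6 → ℂ, Function.Injective a → ∀ m, lineCoeff a s m = 0) (h1 : s 1 = 0)
    (d s2 s3 s4 : ℂ)
    (h2 : s 2 = s2)
    (h3 : s 3 = s3)
    (h4 : s 4 = s4)
    (h6 : s 6 = (42 * d - 24 * s2 * s4 - 27 * s3 ^ 2 + 8 * s2 ^ 3) / 42) :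
    d = 0 ∧ (s3 = 0 ∨ s2 = 0 ∧ s4 = 0) := by
  have c5 := lineCoeff_012345_5 s
  rw [h _ injective_012345, zero_mul] at c5
  have c7 := lineCoeff_012345_7 s
  rw [h _ injective_012345, zero_mul] at c7
  have c8 := lineCoeff_012346_8 s
  rw [h _ injective_012346, zero_mul] at c8
  have c9a := lineCoeff_012345_9 s
  rw [h _ injective_012345, zero_mul] at c9a
  have c9b := lineCoeff_012346_9 s
  rw [h _ injective_012346, zero_mul] at c9b
  have c10a := lineCoeff_012346_10 s
  rw [h _ injective_012346, zero_mul] at c10a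
  have c10b := lineCoeff_012356_10 s
  rw [h _ injective_012356, zero_mul] at c10b
  have c11a := lineCoeff_012345_11 s
  rw [h _ injective_012345, zero_mul] at c11a
  have c11b := lineCoeff_012456_11 s
  rw [h _ injective_012456, zero_mul] at c11b
  have c11c := lineCoeff_023457_11 s
  rw [h _ injective_023457, zero_mul] at c11c
  have c11d := lineCoeff_012346_11 s
  rw [h _ injective_012346, zero_mul] at c11d
  have c12a := lineCoeff_012346_12 s
  rw [h _ injective_012346, zero_mul] at c12a
  have c12b := lineCoeff_012356_12 s
  rw [h _ injective_012356, zero_mul] at c12b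
  have c12c := lineCoeff_012347_12 s
  rw [h _ injective_012347, zero_mul] at c12c
  simp only [h1, h2, h3, h4] at c5
  -- as above, the first relation of each weight gives the next coefficient
  have h5 : s 5 = -6 * s2 * s3 := by
    linear_combination (-1 / 5) * c5
  simp only [h1, h2, h3, h4, h6, h5] at c7
  have h7 : s 7 = -3 * s3 * s4 + 15 * s2 ^ 2 * s3 := by
    linear_combination (-1 / 140) * c7
  simp only [h1, h2, h3, h4, h6, h5, h7] at c8
  have h8 : s 8 = (-42 * d * s2 - 7 * s4 ^ 2 + 10 * s2 ^ 2 * s4 + 153 * s2 * s3 ^ 2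
      - s2 ^ 4) / 21 := by
    linear_combination (-1 / 105) * c8
  simp only [h1, h2, h3, h4, h6, h5, h7, h8] at c9a
  simp only [h1, h2, h3, h4, h6, h5, h7, h8] at c9b
  have h9 : s 9 = (-749 * d * s3 + 5090 * s2 * s3 * s4 + 135 * s3 ^ 3
      - 7138 * s2 ^ 3 * s3) / 315 := by
    linear_combination (-1 / 37800) * c9a
  have r9 : (-17150 * d * s3 + 98000 * s2 * s3 * s4 - 19600 * s2 ^ 3 * s3) / 3 = 0 := by
    linear_combination (-1 / (5 / 14)) * c9b + ((161 / 81) / (20 / 9)) * c9a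
  simp only [h1, h2, h3, h4, h6, h5, h7, h8, h9] at c10a
  simp only [h1, h2, h3, h4, h6, h5, h7, h8, h9] at c10b
  have h10 : s 10 = (-10220 * d * s4 + 25480 * d * s2 ^ 2 + 6120 * s2 * s4 ^ 2 + 39645 * s3 ^ 2 * s4
      - 2880 * s2 ^ 3 * s4 - 400995 * s2 ^ 2 * s3 ^ 2 + 504 * s2 ^ 5) / 10395 := by
    linear_combination (-1 / 155925) * c10a
  have r10 : (54880 * d * s4 - 10976 * d * s2 ^ 2 - 141120 * s3 ^ 2 * s4
      + 1382976 * s2 ^ 2 * s3 ^ 2) / 3 = 0 := by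
    linear_combination (-1 / (15 / 8)) * c10b + ((2 / 3) / (15 / 8)) * c10a
  simp only [h1, h2, h3, h4, h6, h5, h7, h8, h9, h10] at c11a
  simp only [h1, h2, h3, h4, h6, h5, h7, h8, h9, h10] at c11b
  simp only [h1, h2, h3, h4, h6, h5, h7, h8, h9, h10] at c11c
  simp only [h1, h2, h3, h4, h6, h5, h7, h8, h9, h10] at c11d
  have h11 : s 11 = (5066068 * d * s2 * s3 + 1335355 * s3 * s4 ^ 2 - 13079630 * s2 ^ 2 * s3 * s4
      - 2517390 * s2 * s3 ^ 3 + 8035971 * s2 ^ 4 * s3) / 321860 := by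
    linear_combination (-1 / 154492800) * c11a
  have r11b : (-2501297316 * d * s2 * s3 - 553510125 * s3 * s4 ^ 2 + 2204916210 * s2 ^ 2 * s3 * s4
      - 420198030 * s2 * s3 ^ 3 - 418842837 * s2 ^ 4 * s3) / 1045 = 0 := by
    linear_combination (-1 / (175 / 4)) * c11b + ((14197 / 4180) / 280) * c11a
  have r11c : (6406718976 * d * s2 * s3 + 1519722000 * s3 * s4 ^ 2 - 6790534560 * s2 ^ 2 * s3 * s4
      + 388061280 * s2 * s3 ^ 3 + 1297318032 * s2 ^ 4 * s3) / 1045 = 0 := by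
    linear_combination (-1 / 1400) * c11c + ((6697 / 1045) / 280) * c11a
  have r11d : (1520608180 * d * s2 * s3 + 370164375 * s3 * s4 ^ 2 - 1874394550 * s2 ^ 2 * s3 * s4
      + 66083850 * s2 * s3 ^ 3 + 360072335 * s2 ^ 4 * s3) / 627 = 0 := by
    linear_combination (-1 / (105 / 4)) * c11d + ((2523 / 836) / 280) * c11a
  simp only [h1, h2, h3, h4, h6, h5, h7, h8, h9, h10, h11] at c12a
  simp only [h1, h2, h3, h4, h6, h5, h7, h8, h9, h10, h11] at c12b
  simp only [h1, h2, h3, h4, h6, h5, h7, h8, h9, h10, h11] at c12c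
  have r12b : (10660440 * d ^ 2 - 16738400 * d * s2 * s4 - 28699496 * d * s3 ^ 2
      + 3347680 * d * s2 ^ 3
      + 416178560 * s2 * s3 ^ 2 * s4 - 1248322432 * s2 ^ 3 * s3 ^ 2) / 15 = 0 := by
    linear_combination (-1 / (225 / 14)) * c12b + ((3 / 5) / (45 / 56)) * c12a
  have r12c : (-382200 * d ^ 2 + 4396000 * d * s2 * s4 + 6369160 * d * s3 ^ 2 - 879200 * d * s2 ^ 3
      - 60745600 * s2 * s3 ^ 2 * s4 + 147624320 * s2 ^ 3 * s3 ^ 2) / 3 = 0 := by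
    linear_combination (-1 / (63 / 2)) * c12c + ((265 / 49) / (45 / 56)) * c12a
  clear h1 h2 h3 h4 h5 h6 h7 h8 h9 h10 h11
  have ea : s3 ^ 3 * s2 = 0 := by
    linear_combination (1 / 19600) * s2 * r9 + (-2377 / 457228800) * r11b
        + (-3601 / 671846400) * r11c
      + (241 / 28224000) * r11d
  have eb : s3 ^ 3 * s4 = 0 := by
    linear_combination (-19783 / 223948800) * s2 * r11c + (-1 / 47040) * s3 * r10
        + (-1 / 14700) * s4 * r9
      + (-9551 / 152409600) * s2 * r11b + (4661 / 28224000) * s2 * r11d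
      + (463 / 294000) * s2 ^ 2 * r9
  by_cases h3 : s3 = 0
  · subst h3
    refine ⟨pow_eq_zero_iff two_ne_zero |>.1 ?_, Or.inl rfl⟩
    linear_combination (157 / 96347328) * r12b + (61 / 49156800) * r12c
  · have hs2 := (mul_eq_zero.1 ea).resolve_left (pow_ne_zero _ h3)
    have hs4 := (mul_eq_zero.1 eb).resolve_left (pow_ne_zero _ h3)
    subst hs2 hs4
    refine ⟨(mul_eq_zero.1 ?_).resolve_left h3, Or.inr ⟨rfl, rfl⟩⟩
    linear_combination (-3 / 17150) * r9

section

open Finset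

/-! ### The three families of parameters -/

/-- The coefficients `s_k` of `log Q = ∑ s_k z ^ k`. -/
def logTaylor (Q : PowerSeries ℂ) (k : ℕ) : ℂ := logCoeff Q k / k

theorem natCast_mul_logTaylor (Q : PowerSeries ℂ) (k : ℕ) : k * logTaylor Q k = logCoeff Q k := by
  rcases k with _ | k
  · simp [logCoeff_zero]
  · rw [logTaylor, mul_div_cancel₀ _ (Nat.cast_ne_zero.2 k.succ_ne_zero)]

theorem lineCoeff_logTaylor {Q : PowerSeries ℂ} (h0 : PowerSeries.coeff 0 Q = 1) {n : ℕ}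
    (a : Fin n → ℂ) (m : ℕ) :
    lineCoeff a (logTaylor Q) m = PowerSeries.coeff m (lineSeries a Q) := by
  rw [coeff_lineSeries h0, lineCoeff]
  refine sum_congr rfl fun i _ => ?_
  congr 2
  funext k
  rw [natCast_mul_logTaylor]
  rcases k with _ | k
  · simp [logCoeff_zero]
  · rw [← add_sum_erase univ (fun j => (a j - a i) ^ (k + 1)) (mem_univ i)]
    simp

theorem logCoeff_rescale {Q : PowerSeries ℂ} (h0 : PowerSeries.coeff 0 Q = 1) (c : ℂ) (k : ℕ) :
    logCoeff (PowerSeries.rescale c Q) k = c ^ k * logCoeff Q k := by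
  have h1 : PowerSeries.constantCoeff (PowerSeries.rescale c Q) ≠ 0 := by
    rw [← PowerSeries.coeff_zero_eq_constantCoeff_apply, PowerSeries.coeff_rescale, h0]
    simp
  rw [logCoeff, X_mul_derivative_rescale h0, mul_assoc, PowerSeries.mul_inv_cancel _ h1, mul_one,
    PowerSeries.coeff_mk, mul_comm]

theorem logTaylor_rescale {Q : PowerSeries ℂ} (h0 : PowerSeries.coeff 0 Q = 1) (c : ℂ) (k : ℕ) :
    logTaylor (PowerSeries.rescale c Q) k = c ^ k * logTaylor Q k := by
  rw [logTaylor, logTaylor, logCoeff_rescale h0, mul_div_assoc]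

/-- The first four Taylor coefficients of `exp (s₁ z + s₂ z² + s₃ z³ + s₄ z⁴)`, over any
`ℂ`-algebra. -/
def parametersOfLog {R : Type*} [CommRing R] [Algebra ℂ R] (s₁ s₂ s₃ s₄ : R) : Fin 4 → R :=
  ![s₁, s₂ + (1 / 2 : ℂ) • s₁ ^ 2, s₃ + s₁ * s₂ + (1 / 6 : ℂ) • s₁ ^ 3,
    s₄ + s₁ * s₃ + (1 / 2 : ℂ) • s₂ ^ 2 + (1 / 2 : ℂ) • (s₁ ^ 2 * s₂) + (1 / 24 : ℂ) • s₁ ^ 4]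

/-- The parameters of the series `Q` with `s₁ = s₃ = 0`, where `x` and `y` stand for `s₂` and
`s₄`. The elliptic functions of level `2` are among them. -/
def familyTwo {R : Type*} [CommRing R] [Algebra ℂ R] (x y : R) : Fin 4 → R :=
  parametersOfLog 0 x 0 y

/-- The parameters that satisfy the two relations which the functional equation in three variables
imposes on the first four logarithmic coefficients, where `x` and `y` stand for `s₁` and `s₃`. -/
def familyThree {R : Type*} [CommRing R] [Algebra ℂ R] (x y : R) : Fin 4 → R :=
  parametersOfLog x (-(3 / 2 : ℂ) • x ^ 2) y ((9 / 20 : ℂ) • x ^ 4 - (9 / 5 : ℂ) • (x * y))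

/-- The parameters of the third family of solutions in six variables, which is that of level `6`.
Here `x` stands for `s₁`, and `y` uniformizes the relation between `s₁`, `s₂` and `s₃`. -/
def familySix {R : Type*} [CommRing R] [Algebra ℂ R] (x y : R) : Fin 4 → R :=
  parametersOfLog x (2 * y ^ 2 - (3 / 2 : ℂ) • x ^ 2) (6 * y * x ^ 2 - 8 * y ^ 2 * x)
    ((9 / 20 : ℂ) • x ^ 4 - (54 / 5 : ℂ) • (x ^ 3 * y) + (102 / 5 : ℂ) • (x ^ 2 * y ^ 2)
      - (48 / 5 : ℂ) • (x * y ^ 3) + (4 / 5 : ℂ) • y ^ 4)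

/-- The first four coefficients of `Q`, from the linear one on. -/
def parameters (Q : PowerSeries ℂ) : Fin 4 → ℂ := fun k => PowerSeries.coeff ((k : ℕ) + 1) Q

theorem parameters_eq {Q : PowerSeries ℂ} (h0 : PowerSeries.coeff 0 Q = 1) :
    parameters Q = parametersOfLog (logTaylor Q 1) (logTaylor Q 2) (logTaylor Q 3)
      (logTaylor Q 4) := by
  funext k
  fin_cases k <;>
  simp [parameters, parametersOfLog, coeff_eq_expCoeff_logCoeff h0, expCoeff_1, expCoeff_2,
    expCoeff_3, expCoeff_4, ← natCast_mul_logTaylor] <;> ring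

/-- The value of `s₆` that the differential equation prescribes. -/
def logTaylorSix (s₂ s₃ s₄ : ℂ) : ℂ := 4 / 21 * s₂ ^ 3 - 4 / 7 * s₂ * s₄ - 9 / 14 * s₃ ^ 2

/-- Solutions for `n = 6` lie in one of three two-parameter families, and their sixth logarithmic
coefficient is determined. -/
theorem VanishesOnLines.classification {Q : PowerSeries ℂ} (h0 : PowerSeries.coeff 0 Q = 1)
    (h : VanishesOnLines 6 Q) :
    logTaylor Q 6 = logTaylorSix (logTaylor Q 2) (logTaylor Q 3) (logTaylor Q 4) ∧
    ((logTaylor Q 1 = 0 ∧ logTaylor Q 3 = 0) ∨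
      (logTaylor Q 2 = -3 / 2 * logTaylor Q 1 ^ 2 ∧
        logTaylor Q 4 = 9 / 20 * logTaylor Q 1 ^ 4 - 9 / 5 * logTaylor Q 1 * logTaylor Q 3) ∨
      ∃ t, parameters Q = familySix (logTaylor Q 1) t) := by
  rw [parameters_eq h0]
  have key : ∀ a : Fin 6 → ℂ, Function.Injective a → ∀ m, lineCoeff a (logTaylor Q) m = 0 :=
    fun a ha m => by rw [lineCoeff_logTaylor h0, h a ha, map_zero]
  by_cases h1 : logTaylor Q 1 = 0
  · obtain ⟨hd, hs⟩ := classification_zero (logTaylor Q) key h1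
      (logTaylor Q 6 - logTaylorSix (logTaylor Q 2) (logTaylor Q 3) (logTaylor Q 4))
      (logTaylor Q 2) (logTaylor Q 3) (logTaylor Q 4) rfl rfl rfl (by rw [logTaylorSix]; ring)
    refine ⟨sub_eq_zero.1 hd, ?_⟩
    rcases hs with hs | ⟨hs, hs'⟩
    · exact Or.inl ⟨h1, hs⟩
    · exact Or.inr (Or.inl (by rw [hs, hs', h1]; norm_num))
  · -- normalize the linear coefficient to `1`
    set c := logTaylor Q 1 with hc
    have h0' : PowerSeries.coeff 0 (PowerSeries.rescale c⁻¹ Q) = 1 := by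
      rw [PowerSeries.coeff_rescale, h0]; simp
    have key' : ∀ a : Fin 6 → ℂ, Function.Injective a → ∀ m,
        lineCoeff a (logTaylor (PowerSeries.rescale c⁻¹ Q)) m = 0 :=
      fun a ha m => by rw [lineCoeff_logTaylor h0', h.rescale c⁻¹ a ha, map_zero]
    have hs : ∀ k, logTaylor Q k = c ^ k * logTaylor (PowerSeries.rescale c⁻¹ Q) k := by
      intro k
      rw [logTaylor_rescale h0, ← mul_assoc, ← mul_pow, mul_inv_cancel₀ h1, one_pow, one_mul]
    generalize logTaylor (PowerSeries.rescale c⁻¹ Q) = s at key' hs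
    have hs1 : s 1 = 1 := by
      have := hs 1
      rw [← hc, pow_one] at this
      exact mul_left_cancel₀ h1 (by rw [← this, mul_one])
    obtain ⟨hd, he, hX⟩ := classification_one s key' hs1
      (s 6 - logTaylorSix (s 2) (s 3) (s 4))
      (s 4 - (9 - 36 * (s 3 + 4 * (s 2 + 3 / 2)) + 204 * (s 2 + 3 / 2)
        - 16 * (s 3 + 4 * (s 2 + 3 / 2)) * (s 2 + 3 / 2) + 4 * (s 2 + 3 / 2) ^ 2) / 20)
      (s 3 + 4 * (s 2 + 3 / 2)) (s 2 + 3 / 2) (by ring) (by ring) (by ring)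
      (by rw [logTaylorSix]; ring)
    have hd' := sub_eq_zero.1 hd
    have he' := sub_eq_zero.1 he
    refine ⟨?_, Or.inr ?_⟩
    · rw [hs 6, hs 2, hs 3, hs 4, hd', logTaylorSix, logTaylorSix]
      ring
    rcases mul_eq_zero.1 hX with hp | hp
    · left
      have hs2 : s 2 = -3 / 2 := by linear_combination hp
      rw [hs 2, hs 4, hs 3, he', hs2]
      constructor <;> ring
    · -- the curve `y ^ 2 = 18 p` is parametrized by `t = y / 6`, up to scaling
      right
      have hs2 : s 2 = (s 3 + 4 * (s 2 + 3 / 2)) ^ 2 / 18 - 3 / 2 := by linear_combination -hp / 18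
      refine ⟨c * (s 3 + 4 * (s 2 + 3 / 2)) / 6, ?_⟩
      rw [hs 2, hs 3, hs 4, familySix]
      generalize hy : s 3 + 4 * (s 2 + 3 / 2) = y at *
      have hs3 : s 3 = y - 4 * (s 2 + 3 / 2) := by rw [← hy]; ring
      have e2 : c ^ 2 * s 2 = 2 * (c * y / 6) ^ 2 - (3 / 2 : ℂ) • c ^ 2 := by
        rw [hs2, smul_eq_mul]; ring
      have e3 : c ^ 3 * s 3 = 6 * (c * y / 6) * c ^ 2 - 8 * (c * y / 6) ^ 2 * c := by
        rw [hs3, hs2]; ring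
      have e4 : c ^ 4 * s 4 = (9 / 20 : ℂ) • c ^ 4 - (54 / 5 : ℂ) • (c ^ 3 * (c * y / 6))
          + (102 / 5 : ℂ) • (c ^ 2 * (c * y / 6) ^ 2) - (48 / 5 : ℂ) • (c * (c * y / 6) ^ 3)
          + (4 / 5 : ℂ) • (c * y / 6) ^ 4 := by
        rw [he', hs2]
        simp only [smul_eq_mul]
        ring
      rw [e2, e3, e4]

/-! ### Solutions are polynomial in their first four coefficients -/

/-- The coefficient with which `s m` enters the `m`-th coefficient of the line series, up to
the factor `m`. For `n = 6` and distinct `a j` it vanishes if `m ≤ 4` or `m = 6`. -/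
def leadingCoeff {n : ℕ} (a : Fin n → ℂ) (m : ℕ) : ℂ :=
  ∑ i, (differenceProduct a i)⁻¹ * ∑ j, (a j - a i) ^ m

theorem leadingCoeff_of_even {m : ℕ} (hm : Even m) (h0 : m ≠ 0) :
    leadingCoeff ![0, 1, 2, 3, 4, 6] m * 720 =
      4 * 6 ^ m - 25 * 5 ^ m + 64 * 4 ^ m - 85 * 3 ^ m + 60 * 2 ^ m - 18 := by
  obtain ⟨d0, d1, d2, d3, d4, d5⟩ := differenceProduct_fin6 ![0, 1, 2, 3, 4, 6]
  rw [leadingCoeff, Fin.sum_univ_six, d0, d1, d2, d3, d4, d5]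
  simp only [Fin.sum_univ_six]
  simp
  norm_num [hm.neg_pow, h0]
  ring

theorem leadingCoeff_of_odd {m : ℕ} (hm : Odd m) :
    leadingCoeff ![0, 1, 2, 3, 4, 6] m * 720 =
      6 * 6 ^ m - 23 * 5 ^ m + 36 * 4 ^ m - 33 * 3 ^ m + 22 * 2 ^ m - 10 := by
  have h0 : m ≠ 0 := fun h => by simp [h] at hm
  obtain ⟨d0, d1, d2, d3, d4, d5⟩ := differenceProduct_fin6 ![0, 1, 2, 3, 4, 6]
  rw [leadingCoeff, Fin.sum_univ_six, d0, d1, d2, d3, d4, d5]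
  simp only [Fin.sum_univ_six]
  simp
  norm_num [hm.neg_pow, h0]
  ring

/-- The coefficient is checked one by one for `m < 12`; from there on the term `6 ^ m` dominates
its competitors. -/
theorem leadingCoeff_ne_zero {m : ℕ} (h : m = 5 ∨ 7 ≤ m) :
    leadingCoeff ![0, 1, 2, 3, 4, 6] m ≠ 0 := by
  intro h0
  have e1 : ∀ b : ℕ, 1 ≤ b → (1 : ℕ) ≤ b ^ (m - 12) := fun b hb => Nat.one_le_pow _ _ hb
  have e2 : ∀ b c : ℕ, b ≤ c → b ^ (m - 12) ≤ c ^ (m - 12) := fun b c h => Nat.pow_le_pow_left h _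
  have e3 : ∀ b : ℕ, 12 ≤ m → b ^ m = b ^ 12 * b ^ (m - 12) := fun b hb => by
    rw [← pow_add]; congr 1; omega
  have h56 := e2 5 6 (by norm_num)
  have h36 := e2 3 6 (by norm_num)
  have h16 := e1 6 (by norm_num)
  rcases Nat.even_or_odd m with hm | hm
  · have h1 := leadingCoeff_of_even hm (by omega)
    rw [h0, zero_mul] at h1
    have h2 : 4 * 6 ^ m + 64 * 4 ^ m + 60 * 2 ^ m = 25 * 5 ^ m + 85 * 3 ^ m + 18 := by
      have : ((4 * 6 ^ m + 64 * 4 ^ m + 60 * 2 ^ m : ℕ) : ℂ) =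
          ((25 * 5 ^ m + 85 * 3 ^ m + 18 : ℕ) : ℂ) := by
        push_cast
        linear_combination -h1
      exact_mod_cast this
    by_cases hm12 : 12 ≤ m
    · rw [e3 6 hm12, e3 4 hm12, e3 2 hm12, e3 5 hm12, e3 3 hm12] at h2
      norm_num at h2
      omega
    · have : m = 8 ∨ m = 10 := by
        obtain ⟨k, hk⟩ := hm
        omega
      rcases this with rfl | rfl <;> norm_num at h2
  · have h1 := leadingCoeff_of_odd hm
    rw [h0, zero_mul] at h1
    have h2 : 6 * 6 ^ m + 36 * 4 ^ m + 22 * 2 ^ m = 23 * 5 ^ m + 33 * 3 ^ m + 10 := by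
      have : ((6 * 6 ^ m + 36 * 4 ^ m + 22 * 2 ^ m : ℕ) : ℂ) =
          ((23 * 5 ^ m + 33 * 3 ^ m + 10 : ℕ) : ℂ) := by
        push_cast
        linear_combination -h1
      exact_mod_cast this
    by_cases hm12 : 12 ≤ m
    · rw [e3 6 hm12, e3 4 hm12, e3 2 hm12, e3 5 hm12, e3 3 hm12] at h2
      norm_num at h2
      omega
    · have : m = 5 ∨ m = 7 ∨ m = 9 ∨ m = 11 := by
        obtain ⟨k, hk⟩ := hm
        omega
      rcases this with rfl | rfl | rfl | rfl <;> norm_num at h2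

/-- The series `Q = z / f` of the solutions for `n = 6`. -/
def solutionSeries : Set (PowerSeries ℂ) :=
  {Q | PowerSeries.coeff 0 Q = 1 ∧ VanishesOnLines 6 Q}

/-- A quantity that depends polynomially on the first four coefficients, uniformly on all
solutions. -/
def IsPolynomial (F : PowerSeries ℂ → ℂ) : Prop :=
  ∃ t : MvPolynomial (Fin 4) ℂ, ∀ Q ∈ solutionSeries, F Q = MvPolynomial.eval (parameters Q) t

namespace IsPolynomial

theorem const (c : ℂ) : IsPolynomial fun _ => c :=
  ⟨MvPolynomial.C c, fun Q _ => by simp⟩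

theorem add {F G : PowerSeries ℂ → ℂ} (hF : IsPolynomial F) (hG : IsPolynomial G) :
    IsPolynomial fun Q => F Q + G Q := by
  obtain ⟨s, hs⟩ := hF
  obtain ⟨t, ht⟩ := hG
  exact ⟨s + t, fun Q hQ => by simp only [hs Q hQ, ht Q hQ, map_add]⟩

theorem mul {F G : PowerSeries ℂ → ℂ} (hF : IsPolynomial F) (hG : IsPolynomial G) :
    IsPolynomial fun Q => F Q * G Q := by
  obtain ⟨s, hs⟩ := hF
  obtain ⟨t, ht⟩ := hG
  exact ⟨s * t, fun Q hQ => by simp only [hs Q hQ, ht Q hQ, map_mul]⟩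

theorem sum {ι : Type*} (u : Finset ι) {F : ι → PowerSeries ℂ → ℂ}
    (hF : ∀ i ∈ u, IsPolynomial (F i)) : IsPolynomial fun Q => ∑ i ∈ u, F i Q := by
  classical
  induction u using Finset.induction_on with
  | empty => simpa using const 0
  | insert i u hi ih =>
    simp only [sum_insert hi]
    exact (hF i (mem_insert_self i u)).add (ih fun j hj => hF j (mem_insert_of_mem hj))

theorem congr {F G : PowerSeries ℂ → ℂ} (hF : IsPolynomial F)
    (h : ∀ Q ∈ solutionSeries, G Q = F Q) : IsPolynomial G := by
  obtain ⟨t, ht⟩ := hF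
  exact ⟨t, fun Q hQ => by rw [h Q hQ, ht Q hQ]⟩

theorem expCoeff {x : PowerSeries ℂ → ℕ → ℂ} {m : ℕ}
    (hx : ∀ k ≤ m, IsPolynomial fun Q => x Q k) :
    IsPolynomial fun Q => expCoeff (x Q) m := by
  induction m using Nat.strong_induction_on with
  | _ m ih =>
    rcases m with _ | m
    · simpa only [expCoeff_zero] using const 1
    · simp only [expCoeff_succ, div_eq_mul_inv]
      refine mul (sum _ fun k hk => ?_) (const _)
      have := mem_range.1 hk
      exact (hx _ (Nat.sub_le _ _)).mul (ih k this fun j hj => hx j (by omega))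

end IsPolynomial

theorem isPolynomial_coeff {k : ℕ} (hk : 1 ≤ k) (hk' : k ≤ 4) :
    IsPolynomial fun Q => PowerSeries.coeff k Q := by
  refine ⟨MvPolynomial.X ⟨k - 1, by omega⟩, fun Q _ => ?_⟩
  simp [parameters, Nat.sub_add_cancel hk]

/-- The first logarithmic coefficients in terms of the parameters. -/
theorem logCoeff_succ {Q : PowerSeries ℂ} (h0 : PowerSeries.coeff 0 Q = 1) (m : ℕ) :
    logCoeff Q (m + 1) = PowerSeries.coeff (m + 1) Q * (m + 1) +
      (-1) * ∑ k ∈ range m, logCoeff Q (m - k) * PowerSeries.coeff (k + 1) Q := by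
  have h := congrArg (PowerSeries.coeff (m + 1)) (X_mul_derivative h0)
  rw [PowerSeries.coeff_succ_X_mul, PowerSeries.coeff_derivative, mul_comm (PowerSeries.mk _),
    PowerSeries.coeff_mul, Finset.Nat.sum_antidiagonal_eq_sum_range_succ_mk,
    Finset.sum_range_succ, Finset.sum_range_succ'] at h
  simp only [PowerSeries.coeff_mk, h0, Nat.sub_self, logCoeff_zero, Nat.add_sub_add_right,
    Nat.sub_zero] at h
  rw [h, sum_congr rfl fun k _ => mul_comm (PowerSeries.coeff (k + 1) Q) _]
  ring

/-- The functional equation along one line determines the logarithmic coefficients of index `5`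
and of index at least `7` recursively. -/
theorem isPolynomial_logCoeff_of_line {m : ℕ} (hm : m = 5 ∨ 7 ≤ m)
    (ih : ∀ k < m, IsPolynomial fun Q => logCoeff Q k) : IsPolynomial fun Q => logCoeff Q m := by
  obtain ⟨m, rfl⟩ : ∃ r, m = r + 1 := ⟨m - 1, by omega⟩
  set a : Fin 6 → ℂ := ![0, 1, 2, 3, 4, 6]
  have ha : leadingCoeff a (m + 1) ≠ 0 := leadingCoeff_ne_zero hm
  let x : Fin 6 → PowerSeries ℂ → ℕ → ℂ := fun i Q k => logCoeff Q k * ∑ j, (a j - a i) ^ k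
  have hx : ∀ i, ∀ k < m + 1, IsPolynomial fun Q => x i Q k := fun i k hk =>
    (ih k hk).mul (IsPolynomial.const _)
  have h1 : IsPolynomial fun Q => (-(leadingCoeff a (m + 1))⁻¹) *
      ∑ i, (differenceProduct a i)⁻¹ *
        ∑ k ∈ range m, x i Q (m - k) * expCoeff (x i Q) (k + 1) := by
    refine (IsPolynomial.const _).mul (IsPolynomial.sum _ fun i _ => (IsPolynomial.const _).mul
      (IsPolynomial.sum _ fun k hk => (hx i _ (by omega)).mul
        (IsPolynomial.expCoeff fun j hj => hx i j ?_)))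
    have := mem_range.1 hk
    omega
  refine h1.congr fun Q hQ => ?_
  have h2 : lineCoeff a (logTaylor Q) (m + 1) = 0 := by
    rw [lineCoeff_logTaylor hQ.1, hQ.2 a injective_012346, map_zero]
  have h3 : ∀ i, (fun k : ℕ => (k : ℂ) * logTaylor Q k * ∑ j, (a j - a i) ^ k) = x i Q := by
    intro i
    funext k
    rw [natCast_mul_logTaylor]
  have h5 : ∀ i, expCoeff (x i Q) (m + 1) =
      ((∑ k ∈ range m, x i Q (m - k) * expCoeff (x i Q) (k + 1)) + x i Q (m + 1)) / (m + 1) := by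
    intro i
    rw [expCoeff_succ, sum_range_succ', expCoeff_zero, mul_one, Nat.sub_zero]
    simp only [Nat.add_sub_add_right]
  simp only [lineCoeff, h3, h5] at h2
  have hm1 : (m : ℂ) + 1 ≠ 0 := Nat.cast_add_one_ne_zero m
  have h4 : (∑ i, (differenceProduct a i)⁻¹ *
      ∑ k ∈ range m, x i Q (m - k) * expCoeff (x i Q) (k + 1)) +
      logCoeff Q (m + 1) * leadingCoeff a (m + 1) = 0 := by
    rw [leadingCoeff, mul_sum, ← sum_add_distrib]
    rw [← mul_zero ((m : ℂ) + 1), ← h2, mul_sum]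
    refine sum_congr rfl fun i _ => ?_
    simp only [x]
    field_simp
  rw [eq_neg_of_add_eq_zero_left h4]
  field_simp

/-- The coefficient of index `6`, on which the functional equation along lines gives no linear
condition, is covered by the classification. -/
theorem isPolynomial_logCoeff (m : ℕ) : IsPolynomial fun Q => logCoeff Q m := by
  induction m using Nat.strong_induction_on with
  | _ m ih =>
    by_cases h57 : m = 5 ∨ 7 ≤ m
    · exact isPolynomial_logCoeff_of_line h57 ih
    by_cases h6 : m = 6
    · subst h6
      have h2 : ∀ k < 6, IsPolynomial fun Q => logTaylor Q k := fun k hk => by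
        simp only [logTaylor, div_eq_mul_inv]
        exact (ih k hk).mul (IsPolynomial.const _)
      have t2 := h2 2 (by norm_num)
      have t3 := h2 3 (by norm_num)
      have t4 := h2 4 (by norm_num)
      refine ((((IsPolynomial.const (8 / 7)).mul (t2.mul (t2.mul t2))).add
        ((IsPolynomial.const (-24 / 7)).mul (t2.mul t4))).add
        ((IsPolynomial.const (-27 / 7)).mul (t3.mul t3))).congr fun Q hQ => ?_
      rw [← natCast_mul_logTaylor, (hQ.2.classification hQ.1).1, logTaylorSix]
      push_cast
      ring
    rcases m with _ | m
    · simpa only [logCoeff_zero] using IsPolynomial.const 0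
    · refine (((isPolynomial_coeff (k := m + 1) (by omega) (by omega)).mul
        (IsPolynomial.const (m + 1))).add ((IsPolynomial.const (-1)).mul
        (IsPolynomial.sum (range m) fun k hk => (ih (m - k) (by omega)).mul
          (isPolynomial_coeff (k := k + 1) (by omega) ?_)))).congr
          fun Q hQ => logCoeff_succ hQ.1 m
      have := mem_range.1 hk
      omega

/-- A universal series for the solutions: their coefficients are fixed polynomials in the first
four. -/
theorem exists_universalSeries : ∃ Φ : PowerSeries (MvPolynomial (Fin 4) ℂ),
    ∀ Q ∈ solutionSeries, Q = PowerSeries.map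
      ((MvPolynomial.aeval (parameters Q) : MvPolynomial (Fin 4) ℂ →ₐ[ℂ] ℂ) :
        MvPolynomial (Fin 4) ℂ →+* ℂ) Φ := by
  have h : ∀ m, IsPolynomial fun Q => PowerSeries.coeff m Q := fun m =>
    (IsPolynomial.expCoeff (m := m) fun k _ => isPolynomial_logCoeff k).congr
      fun Q hQ => coeff_eq_expCoeff_logCoeff hQ.1 m
  choose t ht using h
  refine ⟨PowerSeries.mk t, fun Q hQ => ?_⟩
  ext m
  rw [PowerSeries.coeff_map, PowerSeries.coeff_mk]
  exact ht m Q hQ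

end

section

open Filter Topology Complex
open scoped Real

/-! ### A theta function -/

/-- The infinite product `∏ n ≥ 1, (1 - q ^ n * w)`. -/
def qProduct (q w : ℂ) : ℂ := ∏' n : ℕ, (1 - q ^ (n + 1) * w)

section qProduct

variable {q : ℂ}

theorem summable_qProduct (hq : ‖q‖ < 1) (w : ℂ) : Summable fun n : ℕ => ‖-(q ^ (n + 1) * w)‖ := by
  simp only [norm_neg, norm_mul, norm_pow]
  exact ((summable_nat_add_iff 1).mpr
    (summable_geometric_of_lt_one (norm_nonneg _) hq)).mul_right _

theorem multipliable_qProduct (hq : ‖q‖ < 1) (w : ℂ) :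
    Multipliable fun n : ℕ => 1 - q ^ (n + 1) * w := by
  simpa only [sub_eq_add_neg] using multipliable_one_add_of_summable (summable_qProduct hq w)

theorem differentiable_qProduct (hq : ‖q‖ < 1) : Differentiable ℂ (qProduct q) := by
  rw [← differentiableOn_univ]
  have h : MultipliableLocallyUniformlyOn (fun (n : ℕ) w => 1 - q ^ (n + 1) * w)
      (Set.univ : Set ℂ) := by
    use qProduct q
    unfold qProduct
    simp_rw [sub_eq_add_neg]
    apply hasProdLocallyUniformlyOn_of_forall_compact isOpen_univ
    intro K _ hcK
    obtain ⟨B, hB⟩ := hcK.isBounded.exists_norm_le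
    refine (((summable_nat_add_iff 1).mpr (summable_geometric_of_lt_one (norm_nonneg _)
      hq)).mul_right B).hasProdUniformlyOn_nat_one_add hcK (.of_forall fun n w hw => ?_)
      (fun _ => by fun_prop)
    rw [norm_neg, norm_mul, norm_pow]
    exact mul_le_mul_of_nonneg_left (hB w hw) (by positivity)
  exact h.hasProdLocallyUniformlyOn.differentiableOn
    (.of_forall fun _ => by simpa [Finset.prod_fn] using
      DifferentiableOn.finsetProd (fun _ _ => by fun_prop)) isOpen_univ

/-- Splitting off the first factor. -/
theorem qProduct_eq (hq : ‖q‖ < 1) (w : ℂ) :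
    qProduct q w = (1 - q * w) * qProduct q (q * w) := by
  have h : (fun n : ℕ => 1 - q ^ (n + 1 + 1) * w) = fun n : ℕ => 1 - q ^ (n + 1) * (q * w) := by
    funext n
    ring
  rw [qProduct, tprod_eq_zero_mul' (by rw [h]; exact multipliable_qProduct hq (q * w)), h, qProduct]
  simp

theorem qProduct_eq_zero_iff (hq : ‖q‖ < 1) (w : ℂ) :
    qProduct q w = 0 ↔ ∃ n : ℕ, q ^ (n + 1) * w = 1 := by
  constructor
  · contrapose!
    intro h
    have := tprod_one_add_ne_zero_of_summable (f := fun n : ℕ => -(q ^ (n + 1) * w))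
      (fun n => by rw [← sub_eq_add_neg, sub_ne_zero]; exact (h n).symm)
      (summable_qProduct hq w)
    simpa only [qProduct, sub_eq_add_neg] using this
  · rintro ⟨n, hn⟩
    exact tprod_of_exists_eq_zero ⟨n, by rw [hn, sub_self]⟩

end qProduct

/-- The exponential `e ^ (2 π i z)`. -/
def expTwoPiI (z : ℂ) : ℂ := cexp (2 * π * I * z)

theorem expTwoPiI_add (z w : ℂ) : expTwoPiI (z + w) = expTwoPiI z * expTwoPiI w := by
  rw [expTwoPiI, mul_add, Complex.exp_add, expTwoPiI, expTwoPiI]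

theorem expTwoPiI_ne_zero (z : ℂ) : expTwoPiI z ≠ 0 := Complex.exp_ne_zero _

theorem expTwoPiI_zero : expTwoPiI 0 = 1 := by simp [expTwoPiI]

theorem expTwoPiI_neg (z : ℂ) : expTwoPiI (-z) = (expTwoPiI z)⁻¹ := by
  rw [expTwoPiI, mul_neg, Complex.exp_neg, expTwoPiI]

theorem expTwoPiI_eq_one_iff {z : ℂ} : expTwoPiI z = 1 ↔ ∃ m : ℤ, z = m := by
  rw [expTwoPiI, Complex.exp_eq_one_iff]
  have h : (2 * π * I : ℂ) ≠ 0 := Complex.two_pi_I_ne_zero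
  constructor
  · rintro ⟨m, hm⟩
    exact ⟨m, mul_left_cancel₀ h (by rw [hm]; ring)⟩
  · rintro ⟨m, rfl⟩
    exact ⟨m, by ring⟩

theorem expTwoPiI_one : expTwoPiI 1 = 1 := expTwoPiI_eq_one_iff.2 ⟨1, by simp⟩

theorem expTwoPiI_nat_mul (n : ℕ) (z : ℂ) : expTwoPiI (n * z) = expTwoPiI z ^ n := by
  rw [expTwoPiI, expTwoPiI, ← Complex.exp_nat_mul]
  congr 1
  ring

theorem differentiable_expTwoPiI : Differentiable ℂ expTwoPiI := by
  unfold expTwoPiI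
  fun_prop

theorem norm_expTwoPiI_lt_one {τ : ℂ} (hτ : 0 < τ.im) : ‖expTwoPiI τ‖ < 1 := by
  rw [expTwoPiI, Complex.norm_exp]
  have : (2 * π * I * τ).re = -(2 * π * τ.im) := by simp
  rw [this, Real.exp_lt_one_iff]
  have := Real.pi_pos
  have : 0 < 2 * Real.pi * τ.im := by positivity
  linarith

/-- The theta function `(1 - x) ∏ n ≥ 1, (1 - q ^ n x) (1 - q ^ n x⁻¹)`, where
`x = e ^ (2 π i z)` and `q = e ^ (2 π i τ)`. It plays the role of the Weierstrass sigma function. -/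
def theta (τ z : ℂ) : ℂ :=
  (1 - expTwoPiI z) * qProduct (expTwoPiI τ) (expTwoPiI z) *
    qProduct (expTwoPiI τ) (expTwoPiI (-z))

section theta

variable {τ : ℂ}

theorem differentiable_theta (hτ : 0 < τ.im) : Differentiable ℂ (theta τ) := by
  have h := differentiable_qProduct (norm_expTwoPiI_lt_one hτ)
  exact ((differentiable_expTwoPiI.const_sub 1).mul (h.comp differentiable_expTwoPiI)).mul
    (h.comp (differentiable_expTwoPiI.comp differentiable_neg))

theorem theta_add_one (z : ℂ) : theta τ (z + 1) = theta τ z := by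
  simp only [theta, neg_add, expTwoPiI_add, expTwoPiI_neg, expTwoPiI_one, inv_one, mul_one]

theorem theta_add_tau (hτ : 0 < τ.im) (z : ℂ) :
    theta τ (z + τ) = -(expTwoPiI z)⁻¹ * theta τ z := by
  have hq := norm_expTwoPiI_lt_one hτ
  have hq0 := expTwoPiI_ne_zero τ
  have hx0 := expTwoPiI_ne_zero z
  have h1 := qProduct_eq hq (expTwoPiI z)
  have h2 := qProduct_eq hq (expTwoPiI (-(z + τ)))
  have h3 : expTwoPiI τ * expTwoPiI (-(z + τ)) = expTwoPiI (-z) := by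
    rw [← expTwoPiI_add]; congr 1; ring
  rw [h3] at h2
  rw [theta, theta, h1, h2, expTwoPiI_add, mul_comm (expTwoPiI z), expTwoPiI_neg]
  field_simp
  ring

theorem theta_neg (z : ℂ) : theta τ (-z) = -(expTwoPiI z)⁻¹ * theta τ z := by
  have hx0 := expTwoPiI_ne_zero z
  rw [theta, theta, neg_neg, expTwoPiI_neg]
  field_simp
  ring

theorem theta_eq_zero_iff (hτ : 0 < τ.im) (z : ℂ) :
    theta τ z = 0 ↔ ∃ m n : ℤ, z = m + n * τ := by
  have hq := norm_expTwoPiI_lt_one hτ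
  have hpow : ∀ (n : ℕ) (w : ℂ), expTwoPiI τ ^ n * expTwoPiI w = expTwoPiI (n * τ + w) := by
    intro n w
    rw [expTwoPiI_add, expTwoPiI_nat_mul]
  rw [theta, mul_eq_zero, mul_eq_zero, qProduct_eq_zero_iff hq, qProduct_eq_zero_iff hq,
    sub_eq_zero, eq_comm (a := (1 : ℂ)), expTwoPiI_eq_one_iff]
  simp only [hpow, expTwoPiI_eq_one_iff]
  constructor
  · rintro ((⟨m, hm⟩ | ⟨n, m, hm⟩) | ⟨n, m, hm⟩)
    · exact ⟨m, 0, by simp [hm]⟩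
    · exact ⟨m, -(n + 1), by push_cast at hm ⊢; linear_combination hm⟩
    · exact ⟨-m, n + 1, by push_cast at hm ⊢; linear_combination -hm⟩
  · rintro ⟨m, n, h⟩
    rcases lt_trichotomy n 0 with hn | hn | hn
    · obtain ⟨k, rfl⟩ : ∃ k : ℕ, n = -(k + 1) := ⟨(-n - 1).toNat, by omega⟩
      exact Or.inl (Or.inr ⟨k, m, by push_cast at h ⊢; linear_combination h⟩)
    · exact Or.inl (Or.inl ⟨m, by simp [h, hn]⟩)
    · obtain ⟨k, rfl⟩ : ∃ k : ℕ, n = k + 1 := ⟨(n - 1).toNat, by omega⟩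
      exact Or.inr ⟨k, -m, by push_cast at h ⊢; linear_combination -h⟩

theorem deriv_theta_zero_ne_zero (hτ : 0 < τ.im) : deriv (theta τ) 0 ≠ 0 := by
  have hq := norm_expTwoPiI_lt_one hτ
  have h := differentiable_qProduct hq
  set B : ℂ → ℂ := fun z => qProduct (expTwoPiI τ) (expTwoPiI z) *
    qProduct (expTwoPiI τ) (expTwoPiI (-z)) with hB
  have hBd : Differentiable ℂ B := (h.comp differentiable_expTwoPiI).mul
    (h.comp (differentiable_expTwoPiI.comp differentiable_neg))
  have hth : theta τ = fun z => (1 - expTwoPiI z) * B z := by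
    funext z
    rw [theta, hB, mul_assoc]
  have he : HasDerivAt expTwoPiI (2 * π * I) 0 := by
    have := ((hasDerivAt_id (0 : ℂ)).const_mul (2 * π * I)).cexp
    simpa [expTwoPiI] using! this
  have h1 : HasDerivAt (theta τ) (-(2 * π * I) * B 0 + (1 - expTwoPiI 0) * deriv B 0) 0 := by
    rw [hth]
    exact (he.const_sub 1).mul hBd.differentiableAt.hasDerivAt
  -- the only factor that vanishes at `0` is `1 - x`, and it does so to first order
  rw [h1.deriv, expTwoPiI_zero, sub_self, zero_mul, add_zero]
  refine mul_ne_zero (neg_ne_zero.2 Complex.two_pi_I_ne_zero) ?_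
  have hne : qProduct (expTwoPiI τ) 1 ≠ 0 := by
    rw [Ne, qProduct_eq_zero_iff hq]
    rintro ⟨n, hn⟩
    have h2 := congrArg norm hn
    rw [mul_one, norm_pow, norm_one] at h2
    exact (pow_lt_one₀ (norm_nonneg _) hq n.succ_ne_zero).ne h2
  simp only [hB, neg_zero, expTwoPiI_zero]
  exact mul_ne_zero hne hne

end theta

/-! ### Taylor series as formal power series -/

/-- The Taylor series of `f` at the origin. -/
def taylor (f : ℂ → ℂ) : PowerSeries ℂ :=
  PowerSeries.mk fun n => iteratedDeriv n f 0 / (n.factorial : ℂ)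

section taylor

variable {f g : ℂ → ℂ}

theorem coeff_taylor_zero (f : ℂ → ℂ) : PowerSeries.coeff 0 (taylor f) = f 0 := by
  simp [taylor]

theorem taylor_congr (h : f =ᶠ[𝓝 0] g) : taylor f = taylor g := by
  ext n
  simp only [taylor, PowerSeries.coeff_mk, h.iteratedDeriv_eq n]

theorem taylor_add (hf : AnalyticAt ℂ f 0) (hg : AnalyticAt ℂ g 0) :
    taylor (fun z => f z + g z) = taylor f + taylor g := by
  ext n
  simp only [taylor, PowerSeries.coeff_mk, map_add]
  rw [← add_div]
  congr 1
  exact iteratedDeriv_fun_add hf.contDiffAt hg.contDiffAt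

theorem taylor_mul (hf : AnalyticAt ℂ f 0) (hg : AnalyticAt ℂ g 0) :
    taylor (fun z => f z * g z) = taylor f * taylor g := by
  ext n
  rw [PowerSeries.coeff_mul, Finset.Nat.sum_antidiagonal_eq_sum_range_succ_mk]
  simp only [taylor, PowerSeries.coeff_mk]
  rw [iteratedDeriv_fun_mul hf.contDiffAt hg.contDiffAt, Finset.sum_div]
  refine Finset.sum_congr rfl fun k hk => ?_
  have hkn : k ≤ n := Nat.lt_succ_iff.1 (Finset.mem_range.1 hk)
  rw [Nat.cast_choose ℂ hkn]
  have := Nat.factorial_ne_zero n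
  have := Nat.factorial_ne_zero k
  have := Nat.factorial_ne_zero (n - k)
  field_simp

theorem taylor_const (c : ℂ) : taylor (fun _ => c) = PowerSeries.C c := by
  ext n
  rw [taylor, PowerSeries.coeff_mk, iteratedDeriv_const, PowerSeries.coeff_C]
  split_ifs with h <;> simp [h]

theorem taylor_id : taylor (fun z => z) = PowerSeries.X := by
  ext n
  rw [taylor, PowerSeries.coeff_mk, iteratedDeriv_fun_id, PowerSeries.coeff_X]
  rcases n with _ | _ | n <;> simp

theorem taylor_deriv (f : ℂ → ℂ) : taylor (deriv f) = PowerSeries.derivative ℂ (taylor f) := by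
  ext n
  rw [PowerSeries.coeff_derivative, taylor, taylor, PowerSeries.coeff_mk, PowerSeries.coeff_mk,
    iteratedDeriv_succ', Nat.factorial_succ]
  have := Nat.factorial_ne_zero n
  have : (n : ℂ) + 1 ≠ 0 := Nat.cast_add_one_ne_zero n
  push_cast
  field_simp

theorem taylor_comp_mul_left (f : ℂ → ℂ) (c : ℂ) :
    taylor (fun z => f (c * z)) = PowerSeries.rescale c (taylor f) := by
  have h : ∀ n, iteratedDeriv n (fun z => f (c * z)) =
      fun z => c ^ n * iteratedDeriv n f (c * z) := by
    intro n
    induction n with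
    | zero => simp
    | succ n ih =>
      funext z
      rw [iteratedDeriv_succ, ih, deriv_const_mul_field, deriv_comp_mul_left, iteratedDeriv_succ,
        smul_eq_mul]
      ring
  ext n
  rw [PowerSeries.coeff_rescale, taylor, taylor, PowerSeries.coeff_mk, PowerSeries.coeff_mk, h]
  simp only [mul_zero, mul_div_assoc]

theorem taylor_sum {ι : Type*} (s : Finset ι) {f : ι → ℂ → ℂ}
    (hf : ∀ i ∈ s, AnalyticAt ℂ (f i) 0) :
    taylor (fun z => ∑ i ∈ s, f i z) = ∑ i ∈ s, taylor (f i) := by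
  classical
  induction s using Finset.induction_on with
  | empty => simpa using taylor_const 0
  | insert a s ha ih =>
    have hs : ∀ i ∈ s, AnalyticAt ℂ (f i) 0 := fun i hi => hf i (Finset.mem_insert_of_mem hi)
    simp only [Finset.sum_insert ha]
    rw [taylor_add (hf a (Finset.mem_insert_self a s)) (Finset.analyticAt_fun_sum s hs), ih hs]

theorem taylor_prod {ι : Type*} (s : Finset ι) {f : ι → ℂ → ℂ}
    (hf : ∀ i ∈ s, AnalyticAt ℂ (f i) 0) :
    taylor (fun z => ∏ i ∈ s, f i z) = ∏ i ∈ s, taylor (f i) := by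
  classical
  induction s using Finset.induction_on with
  | empty => simpa using taylor_const 1
  | insert a s ha ih =>
    have hs : ∀ i ∈ s, AnalyticAt ℂ (f i) 0 := fun i hi => hf i (Finset.mem_insert_of_mem hi)
    simp only [Finset.prod_insert ha]
    rw [taylor_mul (hf a (Finset.mem_insert_self a s)) (Finset.analyticAt_fun_prod s hs), ih hs]

theorem isExpansionAtZero_taylor (hf : AnalyticAt ℂ f 0) : IsExpansionAtZero (taylor f) f := by
  have := hf.hasFPowerSeriesAt
  simpa only [IsExpansionAtZero, taylor, PowerSeries.coeff_mk] using this

/-- An analytic function is determined near the origin by its Taylor series. -/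
theorem eventuallyEq_of_taylor_eq (hf : AnalyticAt ℂ f 0) (hg : AnalyticAt ℂ g 0)
    (h : taylor f = taylor g) : f =ᶠ[𝓝 0] g := by
  have h1 : HasFPowerSeriesAt f _ 0 := isExpansionAtZero_taylor hf
  have h2 : HasFPowerSeriesAt g _ 0 := isExpansionAtZero_taylor hg
  rw [h] at h1
  filter_upwards [h1.eventually_hasSum, h2.eventually_hasSum] with z hz1 hz2
  simpa using hz1.unique hz2

/-- A function whose Taylor series starts in degree `3` is divisible by `z ^ 3`. -/
theorem exists_eq_pow_three_mul (hf : AnalyticAt ℂ f 0)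
    (h : ∀ k < 3, PowerSeries.coeff k (taylor f) = 0) :
    ∃ g : ℂ → ℂ, AnalyticAt ℂ g 0 ∧ ∀ᶠ z in 𝓝 0, f z = z ^ 3 * g z := by
  have key : ((3 : ℕ) : ℕ∞) ≤ analyticOrderAt f 0 := by
    rw [natCast_le_analyticOrderAt_iff_iteratedDeriv_eq_zero hf]
    intro i hi
    have := h i hi
    rw [taylor, PowerSeries.coeff_mk, div_eq_zero_iff] at this
    exact this.resolve_right (Nat.cast_ne_zero.2 i.factorial_ne_zero)
  obtain ⟨g, hg, hfg⟩ := (natCast_le_analyticOrderAt hf).1 key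
  exact ⟨g, hg, by simpa using hfg⟩

end taylor

/-! ### Doubly periodic functions without poles are constant -/

/-- A continuous function with doubly periodic norm takes all its norms on a compact fundamental
domain. -/
theorem isBounded_range_of_norm_periodic (L : PeriodPair) {g : ℂ → ℂ} (hg : Continuous g)
    (hper : ∀ ω ∈ L.lattice, ∀ z, ‖g (z + ω)‖ = ‖g z‖) : Bornology.IsBounded (Set.range g) := by
  have hK : IsCompact (closure (ZSpan.fundamentalDomain L.basis)) :=
    (ZSpan.fundamentalDomain_isBounded L.basis).isCompact_closure
  obtain ⟨M, hM⟩ := (hK.image hg).isBounded.exists_norm_le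
  refine isBounded_iff_forall_norm_le.2 ⟨M, ?_⟩
  rintro _ ⟨z, rfl⟩
  have hmem : (ZSpan.floor L.basis z : ℂ) ∈ L.lattice := by
    rw [L.lattice_eq_span_range_basis]
    exact (ZSpan.floor L.basis z).2
  have hz : ZSpan.fract L.basis z + (ZSpan.floor L.basis z : ℂ) = z := by
    rw [ZSpan.fract_apply, sub_add_cancel]
  rw [← hz, hper _ hmem]
  exact hM _ ⟨_, subset_closure (ZSpan.fract_mem_fundamentalDomain L.basis z), rfl⟩

/-- Liouville's theorem for doubly periodic functions, in a form that allows a multiplier of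
absolute value `1` and removable singularities. -/
theorem exists_eventually_eq_const_of_norm_periodic (L : PeriodPair) {g : ℂ → ℂ}
    (hg : ∀ z, MeromorphicAt g z) (hlim : ∀ z, Tendsto (fun w => (w - z) * g w) (𝓝[≠] z) (𝓝 0))
    (hper : ∀ ω ∈ L.lattice, ∀ z, ‖g (z + ω)‖ = ‖g z‖) :
    ∃ c, ∀ z, ∀ᶠ w in 𝓝[≠] z, g w = c := by
  have hgU : MeromorphicOn g Set.univ := fun z _ => hg z
  set G := toMeromorphicNFOn g Set.univ with hG
  have hgG : ∀ z, ∀ᶠ w in 𝓝[≠] z, G w = g w := fun z =>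
    hgU.toMeromorphicNFOn_eq_self_on_nhdsNE (Set.mem_univ z)
  have hGan : ∀ z, AnalyticAt ℂ G z := by
    intro z
    have hord : 0 ≤ meromorphicOrderAt g z := by
      have h1 : MeromorphicAt (fun w : ℂ => w - z) z := by fun_prop
      have h2 : 0 < meromorphicOrderAt (fun w => (w - z) * g w) z :=
        (tendsto_zero_iff_meromorphicOrderAt_pos (h1.mul (hg z))).1 (hlim z)
      have h3 : meromorphicOrderAt (fun w => (w - z) * g w) z = 1 + meromorphicOrderAt g z := by
        rw [show (fun w => (w - z) * g w) = (fun w => w - z) * g from rfl,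
          meromorphicOrderAt_mul h1 (hg z)]
        congr 1
        exact meromorphicOrderAt_id_sub_const (𝕜 := ℂ) (x := z)
      rw [h3] at h2
      cases h : meromorphicOrderAt g z with
      | top => exact le_top
      | coe m =>
        rw [h] at h2
        have h4 : (0 : WithTop ℤ) < ((1 + m : ℤ) : WithTop ℤ) := by exact_mod_cast h2
        have h5 : 0 < 1 + m := by exact_mod_cast h4
        exact_mod_cast (by omega : 0 ≤ m)
    have hNF := meromorphicNFOn_toMeromorphicNFOn g Set.univ (Set.mem_univ z)
    refine hNF.meromorphicOrderAt_nonneg_iff_analyticAt.1 ?_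
    rwa [meromorphicOrderAt_toMeromorphicNFOn hgU (Set.mem_univ z)]
  have hGc : Continuous G := continuous_iff_continuousAt.2 fun z => (hGan z).continuousAt
  have hGper : ∀ ω ∈ L.lattice, ∀ z, ‖G (z + ω)‖ = ‖G z‖ := by
    intro ω hω z
    have hshift : Tendsto (fun w => w + ω) (𝓝[≠] z) (𝓝[≠] (z + ω)) := by
      refine tendsto_nhdsWithin_of_tendsto_nhds_of_eventually_within _
        ((continuous_add_const ω).continuousAt.tendsto.mono_left nhdsWithin_le_nhds) ?_
      filter_upwards [self_mem_nhdsWithin] with w hw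
      simpa using hw
    have hev : (fun w => ‖G (w + ω)‖) =ᶠ[𝓝[≠] z] fun w => ‖G w‖ := by
      filter_upwards [hgG z, hshift.eventually (hgG (z + ω))] with w h1 h2
      rw [h1, h2, hper ω hω]
    have t1 : Tendsto (fun w => ‖G (w + ω)‖) (𝓝[≠] z) (𝓝 ‖G (z + ω)‖) :=
      ((hGc.norm.comp (continuous_add_const ω)).tendsto z).mono_left nhdsWithin_le_nhds
    have t2 : Tendsto (fun w => ‖G w‖) (𝓝[≠] z) (𝓝 ‖G z‖) :=
      (hGc.norm.tendsto z).mono_left nhdsWithin_le_nhds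
    exact tendsto_nhds_unique t1 (t2.congr' hev.symm)
  have hGd : Differentiable ℂ G := fun z => (hGan z).differentiableAt
  refine ⟨G 0, fun z => ?_⟩
  filter_upwards [hgG z] with w hw
  rw [← hw]
  exact hGd.apply_eq_apply_of_bounded (isBounded_range_of_norm_periodic L hGc hGper) w 0

/-! ### Elliptic functions of level `N` -/

/-- The data that determine an elliptic function of level `N` whose pole is an `N`-th part of the
first period: a point `τ` of the upper half-plane, the level and a nonzero scaling
factor. The function has lattice `scale⁻¹ (ℤ + ℤ τ)` and a pole at `1 / (N scale)`. -/
structure LevelDatum where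
  τ : ℂ
  im_pos : 0 < τ.im
  N : ℕ
  two_le : 2 ≤ N
  scale : ℂ
  scale_ne_zero : scale ≠ 0

namespace LevelDatum

variable (D : LevelDatum)

/-- The lattice `scale⁻¹ (ℤ + ℤ τ)`. -/
def lattice : PeriodPair where
  ω₁ := D.scale⁻¹
  ω₂ := D.τ * D.scale⁻¹
  indep := by
    rw [LinearIndependent.pair_iff]
    intro s t h
    have h1 : ((s : ℂ) + t * D.τ) * D.scale⁻¹ = 0 := by
      rw [← h]
      simp only [real_smul]
      ring
    have h2 := (mul_eq_zero.1 h1).resolve_right (inv_ne_zero D.scale_ne_zero)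
    have h3 : t * D.τ.im = 0 := by simpa using congrArg Complex.im h2
    have ht : t = 0 := (mul_eq_zero.1 h3).resolve_right D.im_pos.ne'
    have h4 := congrArg Complex.re h2
    exact ⟨by simpa [ht] using h4, ht⟩

theorem mem_lattice_iff {z : ℂ} : z ∈ D.lattice.lattice ↔ theta D.τ (D.scale * z) = 0 := by
  rw [theta_eq_zero_iff D.im_pos, PeriodPair.mem_lattice]
  have h := D.scale_ne_zero
  refine exists_congr fun m => exists_congr fun n => ?_
  rw [lattice]
  constructor
  · rintro rfl
    field_simp
  · intro hz
    rw [eq_comm, ← mul_right_inj' h, hz]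
    field_simp

/-- The pole `1 / (N scale)`. -/
def pole : ℂ := (D.N * D.scale)⁻¹

/-- The numerator of the elliptic function, normalized so that the quotient has derivative `1`
at the origin. -/
def num (z : ℂ) : ℂ := theta D.τ (-(D.N : ℂ)⁻¹) / deriv (theta D.τ) 0 * theta D.τ (D.scale * z)

/-- The denominator of the elliptic function. -/
def den (z : ℂ) : ℂ := D.scale * theta D.τ (D.scale * z - (D.N : ℂ)⁻¹)

/-- The elliptic function of level `N` with a zero at the origin and a pole at `D.pole`. Its value
at the poles is `0`. -/
def fn (z : ℂ) : ℂ := D.num z / D.den z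

/-- The factor by which the elliptic function is multiplied under translation by the second
period. -/
def multiplier : ℂ := expTwoPiI (-(D.N : ℂ)⁻¹)

theorem natCast_ne_zero : (D.N : ℂ) ≠ 0 := Nat.cast_ne_zero.2 (by have := D.two_le; omega)

theorem multiplier_isPrimitiveRoot : IsPrimitiveRoot D.multiplier D.N := by
  have h := (Complex.isPrimitiveRoot_exp D.N (by have := D.two_le; omega)).inv
  have h1 : D.multiplier = (cexp (2 * π * I / D.N))⁻¹ := by
    rw [multiplier, expTwoPiI_neg, expTwoPiI, div_eq_mul_inv]
  rwa [h1]

theorem inv_natCast_ne {m n : ℤ} : (D.N : ℂ)⁻¹ ≠ m + n * D.τ := by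
  intro h
  have h1 : (n : ℝ) * D.τ.im = 0 := by
    have := congrArg Complex.im h
    rw [← Complex.ofReal_natCast, ← Complex.ofReal_inv, Complex.ofReal_im] at this
    simpa using this.symm
  have hn : n = 0 := by exact_mod_cast (mul_eq_zero.1 h1).resolve_right D.im_pos.ne'
  rw [hn, Int.cast_zero, zero_mul, add_zero] at h
  have h2 : (1 : ℂ) = m * D.N := by rw [← h, inv_mul_cancel₀ D.natCast_ne_zero]
  have h3 : (1 : ℤ) = m * D.N := by exact_mod_cast h2
  have h4 : (D.N : ℤ) ∣ 1 := ⟨m, by rw [h3]; ring⟩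
  have h5 := Int.le_of_dvd one_pos h4
  have := D.two_le
  omega

theorem theta_neg_inv_ne_zero : theta D.τ (-(D.N : ℂ)⁻¹) ≠ 0 := by
  rw [Ne, theta_eq_zero_iff D.im_pos]
  rintro ⟨m, n, h⟩
  refine D.inv_natCast_ne (m := -m) (n := -n) ?_
  push_cast
  linear_combination -h

theorem scale_mul_pole : D.scale * D.pole = (D.N : ℂ)⁻¹ := by
  have := D.scale_ne_zero
  have := D.natCast_ne_zero
  rw [pole]
  field_simp

theorem differentiable_num : Differentiable ℂ D.num :=
  ((differentiable_theta D.im_pos).comp (differentiable_id.const_mul D.scale)).const_mul _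

theorem differentiable_den : Differentiable ℂ D.den :=
  ((differentiable_theta D.im_pos).comp
    ((differentiable_id.const_mul D.scale).sub_const _)).const_mul _

theorem analyticAt_num (z : ℂ) : AnalyticAt ℂ D.num z := D.differentiable_num.analyticAt z

theorem analyticAt_den (z : ℂ) : AnalyticAt ℂ D.den z := D.differentiable_den.analyticAt z

theorem num_eq_zero_iff {z : ℂ} : D.num z = 0 ↔ z ∈ D.lattice.lattice := by
  rw [num, mul_eq_zero, mem_lattice_iff, or_iff_right]
  exact div_ne_zero D.theta_neg_inv_ne_zero (deriv_theta_zero_ne_zero D.im_pos)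

theorem den_eq_zero_iff {z : ℂ} : D.den z = 0 ↔ z - D.pole ∈ D.lattice.lattice := by
  rw [den, mul_eq_zero, or_iff_right D.scale_ne_zero, mem_lattice_iff, mul_sub, scale_mul_pole]

theorem pole_notMem : D.pole ∉ D.lattice.lattice := by
  rw [mem_lattice_iff, theta_eq_zero_iff D.im_pos, scale_mul_pole]
  rintro ⟨m, n, h⟩
  exact D.inv_natCast_ne h

theorem sub_pole_notMem {z : ℂ} (hz : z ∈ D.lattice.lattice) : z - D.pole ∉ D.lattice.lattice :=
  fun h => D.pole_notMem (by simpa using sub_mem hz h)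

theorem num_ne_zero_or_den_ne_zero (z : ℂ) : D.num z ≠ 0 ∨ D.den z ≠ 0 := by
  by_contra! h
  exact D.sub_pole_notMem (D.num_eq_zero_iff.1 h.1) (D.den_eq_zero_iff.1 h.2)

/-- The second alternative accounts for the value `0` at the poles. -/
theorem fn_eq_zero_iff {z : ℂ} :
    D.fn z = 0 ↔ z ∈ D.lattice.lattice ∨ z - D.pole ∈ D.lattice.lattice := by
  rw [fn, div_eq_zero_iff, num_eq_zero_iff, den_eq_zero_iff]

theorem fn_add_period_one (z : ℂ) : D.fn (z + D.lattice.ω₁) = D.fn z := by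
  have h := D.scale_ne_zero
  have h1 : D.scale * (z + D.scale⁻¹) = D.scale * z + 1 := by field_simp
  have h2 : D.scale * z + 1 - (D.N : ℂ)⁻¹ = D.scale * z - (D.N : ℂ)⁻¹ + 1 := by ring
  rw [fn, fn, num, den, lattice]
  simp only [h1, h2, theta_add_one]
  rfl

theorem fn_add_period_two (z : ℂ) : D.fn (z + D.lattice.ω₂) = D.multiplier * D.fn z := by
  have h := D.scale_ne_zero
  have h1 : D.scale * (z + D.τ * D.scale⁻¹) = D.scale * z + D.τ := by field_simp
  have h2 : D.scale * z + D.τ - (D.N : ℂ)⁻¹ = D.scale * z - (D.N : ℂ)⁻¹ + D.τ := by ring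
  rw [fn, fn, num, den, lattice]
  simp only [h1, h2, theta_add_tau D.im_pos]
  rw [sub_eq_add_neg, expTwoPiI_add, num, den, multiplier, ← sub_eq_add_neg]
  have e1 := expTwoPiI_ne_zero (D.scale * z)
  have e2 := expTwoPiI_ne_zero (-(D.N : ℂ)⁻¹)
  by_cases h0 : theta D.τ (D.scale * z - (D.N : ℂ)⁻¹) = 0
  · simp [h0]
  · have := deriv_theta_zero_ne_zero D.im_pos
    field_simp

theorem fn_add_int_mul_period_one (m : ℤ) (z : ℂ) : D.fn (z + m * D.lattice.ω₁) = D.fn z :=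
  (Function.Periodic.int_mul (f := D.fn) (c := D.lattice.ω₁) D.fn_add_period_one m) z

theorem multiplier_ne_zero : D.multiplier ≠ 0 := expTwoPiI_ne_zero _

theorem fn_add_int_mul_period_two (n : ℤ) (z : ℂ) :
    D.fn (z + n * D.lattice.ω₂) = D.multiplier ^ n * D.fn z := by
  have h0 := D.multiplier_ne_zero
  induction n using Int.induction_on generalizing z with
  | zero => simp
  | succ n ih =>
    have : z + ((n + 1 : ℤ) : ℂ) * D.lattice.ω₂ = z + (n : ℤ) * D.lattice.ω₂ + D.lattice.ω₂ := by
      push_cast; ring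
    rw [this, fn_add_period_two, ih, zpow_add_one₀ h0]
    ring
  | pred n ih =>
    have : z + ((-n : ℤ) : ℂ) * D.lattice.ω₂ =
        z + ((-n - 1 : ℤ) : ℂ) * D.lattice.ω₂ + D.lattice.ω₂ := by
      push_cast; ring
    have h1 := ih z
    rw [this, fn_add_period_two] at h1
    rw [← mul_right_inj' h0, h1, ← mul_assoc, ← zpow_one_add₀ h0]
    congr 2
    ring

/-- Translations by periods multiply the elliptic function by `N`-th roots of unity. -/
theorem exists_multiplier {ω : ℂ} (hω : ω ∈ D.lattice.lattice) :
    ∃ χ : ℂ, χ ^ D.N = 1 ∧ ∀ z, D.fn (z + ω) = χ * D.fn z := by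
  obtain ⟨m, n, rfl⟩ := PeriodPair.mem_lattice.1 hω
  refine ⟨D.multiplier ^ n, ?_, fun z => ?_⟩
  · rw [← zpow_natCast, ← zpow_mul, mul_comm, zpow_mul, zpow_natCast,
      D.multiplier_isPrimitiveRoot.pow_eq_one, one_zpow]
  · rw [← add_assoc, fn_add_int_mul_period_two, fn_add_int_mul_period_one]

/-- The reflection `z ↦ D.pole - z` interchanges the zero and the pole. -/
theorem exists_fn_pole_sub : ∃ K : ℂ, K ≠ 0 ∧ ∀ z, D.fn (D.pole - z) = K / D.fn z := by
  have hth := D.theta_neg_inv_ne_zero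
  have hd := deriv_theta_zero_ne_zero D.im_pos
  have hs := D.scale_ne_zero
  have hN := expTwoPiI_ne_zero (-(D.N : ℂ)⁻¹)
  refine ⟨(theta D.τ (-(D.N : ℂ)⁻¹) / deriv (theta D.τ) 0 / D.scale) ^ 2 *
    (expTwoPiI (-(D.N : ℂ)⁻¹))⁻¹, ?_, fun z => ?_⟩
  · positivity
  have h1 : D.scale * (D.pole - z) = -(D.scale * z - (D.N : ℂ)⁻¹) := by
    rw [mul_sub, scale_mul_pole]; ring
  have h2 : -(D.scale * z - (D.N : ℂ)⁻¹) - (D.N : ℂ)⁻¹ = -(D.scale * z) := by ring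
  have e1 := expTwoPiI_ne_zero (D.scale * z)
  rw [fn, fn, num, den, num, den, h1, h2, theta_neg (D.scale * z - (D.N : ℂ)⁻¹),
    theta_neg (D.scale * z), sub_eq_add_neg, expTwoPiI_add, ← sub_eq_add_neg]
  by_cases h0 : theta D.τ (D.scale * z - (D.N : ℂ)⁻¹) = 0
  · simp [h0]
  by_cases h3 : theta D.τ (D.scale * z) = 0
  · simp [h3]
  field_simp

theorem den_zero_ne_zero : D.den 0 ≠ 0 := by
  rw [Ne, den_eq_zero_iff]
  exact D.sub_pole_notMem (zero_mem _)

theorem fn_zero : D.fn 0 = 0 := D.fn_eq_zero_iff.2 (Or.inl (zero_mem _))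

theorem hasDerivAt_fn_zero : HasDerivAt D.fn 1 0 := by
  have hd := deriv_theta_zero_ne_zero D.im_pos
  have h1 : HasDerivAt D.num (D.den 0) 0 := by
    have hl : HasDerivAt (fun z => D.scale * z) D.scale 0 := by
      simpa using (hasDerivAt_id (0 : ℂ)).const_mul D.scale
    have ht : HasDerivAt (theta D.τ) (deriv (theta D.τ) 0) (D.scale * 0) := by
      rw [mul_zero]
      exact (differentiable_theta D.im_pos 0).hasDerivAt
    have h : HasDerivAt D.num _ 0 :=
      (ht.comp 0 hl).const_mul (theta D.τ (-(D.N : ℂ)⁻¹) / deriv (theta D.τ) 0)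
    refine h.congr_deriv ?_
    rw [den, mul_zero, zero_sub]
    field_simp
  have h2 : HasDerivAt D.fn _ 0 := h1.div (D.differentiable_den 0).hasDerivAt D.den_zero_ne_zero
  refine h2.congr_deriv ?_
  have h3 : D.num 0 = 0 := D.num_eq_zero_iff.2 (zero_mem _)
  have := D.den_zero_ne_zero
  rw [h3]
  field_simp
  ring

theorem analyticAt_fn {z : ℂ} (hz : z - D.pole ∉ D.lattice.lattice) : AnalyticAt ℂ D.fn z :=
  (D.analyticAt_num z).div (D.analyticAt_den z) (mt D.den_eq_zero_iff.1 hz)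

theorem analyticAt_fn_zero : AnalyticAt ℂ D.fn 0 :=
  D.analyticAt_fn (D.sub_pole_notMem (zero_mem _))

theorem meromorphicAt_fn (z : ℂ) : MeromorphicAt D.fn z :=
  (D.analyticAt_num z).meromorphicAt.div (D.analyticAt_den z).meromorphicAt

theorem meromorphicNFAt_fn (z : ℂ) : MeromorphicNFAt D.fn z :=
  MeromorphicNFOn.div (D.analyticAt_num z) (D.analyticAt_den z).meromorphicNFAt
    (D.num_ne_zero_or_den_ne_zero z).symm

theorem meromorphicOrderAt_fn_zero : meromorphicOrderAt D.fn 0 = 1 := by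
  have h : analyticOrderAt D.fn 0 = 1 := by
    have := D.analyticAt_fn_zero.analyticOrderAt_sub_eq_one_of_deriv_ne_zero
      (by rw [D.hasDerivAt_fn_zero.deriv]; exact one_ne_zero)
    simpa [D.fn_zero] using this
  rw [D.analyticAt_fn_zero.meromorphicOrderAt_eq, h]
  rfl

theorem meromorphicOrderAt_fn_of_mem {ω : ℂ} (hω : ω ∈ D.lattice.lattice) :
    meromorphicOrderAt D.fn ω = 1 := by
  obtain ⟨χ, hχ, hper⟩ := D.exists_multiplier hω
  have hχ0 : χ ≠ 0 := by
    rintro rfl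
    rw [zero_pow (by have := D.two_le; omega)] at hχ
    exact zero_ne_one hχ
  have h1 : D.fn ∘ (· + ω) = (fun _ => χ) * D.fn := by
    funext z
    exact hper z
  have h2 := meromorphicOrderAt_comp_add_const_eq_meromorphicOrderAt (f := D.fn) (x := 0) (c := ω)
  rw [zero_add] at h2
  rw [← h2, h1, meromorphicOrderAt_mul_of_ne_zero analyticAt_const hχ0, meromorphicOrderAt_fn_zero]

theorem meromorphicOrderAt_fn_of_sub_mem {z : ℂ} (hz : z - D.pole ∈ D.lattice.lattice) :
    meromorphicOrderAt D.fn z = -1 := by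
  obtain ⟨K, hK, h⟩ := D.exists_fn_pole_sub
  have h1 : D.fn ∘ (fun w => D.pole - w) = (fun _ => K) * D.fn⁻¹ := by
    funext w
    simp [h w, div_eq_mul_inv]
  have h2 := meromorphicOrderAt_comp_of_deriv_ne_zero (f := D.fn) (g := fun w => D.pole - w)
    (x := D.pole - z) (by fun_prop) (by simp)
  rw [h1, meromorphicOrderAt_mul_of_ne_zero analyticAt_const hK, meromorphicOrderAt_inv,
    D.meromorphicOrderAt_fn_of_mem (by simpa using neg_mem hz), sub_sub_cancel] at h2
  exact h2.symm

theorem meromorphicOrderAt_fn {z : ℂ} (h1 : z ∉ D.lattice.lattice)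
    (h2 : z - D.pole ∉ D.lattice.lattice) : meromorphicOrderAt D.fn z = 0 := by
  rw [(D.meromorphicNFAt_fn z).meromorphicOrderAt_eq_zero_iff, Ne, fn_eq_zero_iff]
  tauto

open Classical in
theorem hasLevelProperty_fn : HasLevelProperty D.lattice D.N D.fn where
  meromorphic := fun z _ => D.meromorphicNFAt_fn z
  map_zero := D.fn_zero
  deriv_zero := D.hasDerivAt_fn_zero
  periodic := by
    intro ω hω z
    obtain ⟨χ, hχ, hper⟩ := D.exists_multiplier hω
    rw [hper, mul_pow, hχ, one_mul]
  divisor := by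
    refine ⟨D.pole, fun z => ?_⟩
    rw [show (fun w => D.fn w ^ D.N) = D.fn ^ D.N from rfl,
      meromorphicOrderAt_pow (D.meromorphicAt_fn z)]
    by_cases h1 : z ∈ D.lattice.lattice
    · rw [if_pos h1, if_neg (D.sub_pole_notMem h1), D.meromorphicOrderAt_fn_of_mem h1]
      simp
    · by_cases h2 : z - D.pole ∈ D.lattice.lattice
      · rw [if_neg h1, if_pos h2, D.meromorphicOrderAt_fn_of_sub_mem h2]
        change ((D.N : ℤ) : WithTop ℤ) * ((-1 : ℤ) : WithTop ℤ) = _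
        rw [← WithTop.coe_mul]
        congr 1
        ring
      · rw [if_neg h1, if_neg h2, D.meromorphicOrderAt_fn h1 h2]
        simp

theorem exists_fn_ne_zero : ∃ z, D.fn z ≠ 0 := by
  by_contra! h
  have h1 : D.fn = fun _ => 0 := funext h
  have h2 := D.hasDerivAt_fn_zero
  rw [h1] at h2
  exact one_ne_zero (h2.unique (hasDerivAt_const 0 0))

/-- The level is not smaller than `N`, because the multiplier of the second period is a primitive
`N`-th root of unity. -/
theorem isEllipticOfLevel_fn : IsEllipticOfLevel D.lattice D.N D.fn := by
  refine ⟨⟨by have := D.two_le; omega, D.hasLevelProperty_fn⟩, ?_⟩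
  rintro k ⟨hk, hlev⟩
  obtain ⟨z, hz⟩ := D.exists_fn_ne_zero
  have h1 := hlev.periodic _ D.lattice.ω₂_mem_lattice z
  rw [fn_add_period_two, mul_pow] at h1
  have h2 : D.multiplier ^ k = 1 := mul_right_cancel₀ (pow_ne_zero k hz) (by rw [h1, one_mul])
  exact Nat.le_of_dvd hk (D.multiplier_isPrimitiveRoot.dvd_of_pow_eq_one k h2)

end LevelDatum

/-! ### The functional equation for elliptic functions of level `N` -/

theorem tendsto_sub_const_nhdsNE (ω z : ℂ) :
    Tendsto (fun w => w - ω) (𝓝[≠] z) (𝓝[≠] (z - ω)) := by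
  refine tendsto_nhdsWithin_of_tendsto_nhds_of_eventually_within _
    ((continuous_sub_right ω).continuousAt.tendsto.mono_left nhdsWithin_le_nhds) ?_
  filter_upwards [self_mem_nhdsWithin] with w hw
  simpa using hw

theorem tendsto_const_sub_nhdsNE (ω z : ℂ) :
    Tendsto (fun w => ω - w) (𝓝[≠] z) (𝓝[≠] (ω - z)) := by
  refine tendsto_nhdsWithin_of_tendsto_nhds_of_eventually_within _
    ((continuous_sub_left ω).continuousAt.tendsto.mono_left nhdsWithin_le_nhds) ?_
  filter_upwards [self_mem_nhdsWithin] with w hw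
  simpa using hw

namespace LevelDatum

variable (D : LevelDatum)

/-- The reciprocal of the elliptic function; its value at the lattice points is `0`. -/
def recip (z : ℂ) : ℂ := (D.fn z)⁻¹

theorem analyticAt_recip {z : ℂ} (hz : z ∉ D.lattice.lattice) : AnalyticAt ℂ D.recip z := by
  have h : D.recip = D.den / D.num := by
    funext w
    rw [recip, fn, inv_div, Pi.div_apply]
  rw [h]
  exact (D.analyticAt_den z).div (D.analyticAt_num z) (mt D.num_eq_zero_iff.1 hz)

theorem meromorphicAt_recip (z : ℂ) : MeromorphicAt D.recip z := (D.meromorphicAt_fn z).inv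

theorem tendsto_mul_recip : Tendsto (fun w => w * D.recip w) (𝓝[≠] 0) (𝓝 1) := by
  have h := hasDerivAt_iff_tendsto_slope.1 D.hasDerivAt_fn_zero
  have h1 := h.inv₀ one_ne_zero
  rw [inv_one] at h1
  refine h1.congr fun w => ?_
  rw [slope_def_field, D.fn_zero, sub_zero, sub_zero, inv_div, recip, div_eq_mul_inv]

theorem exists_recip_multiplier {ω : ℂ} (hω : ω ∈ D.lattice.lattice) :
    ∃ χ : ℂ, χ ^ D.N = 1 ∧ (∀ z, D.recip (z + ω) = χ⁻¹ * D.recip z) ∧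
      ∀ z, D.recip (z - ω) = χ * D.recip z := by
  obtain ⟨χ, hχ, h⟩ := D.exists_multiplier hω
  have hχ0 : χ ≠ 0 := by
    rintro rfl
    rw [zero_pow (by have := D.two_le; omega)] at hχ
    exact zero_ne_one hχ
  have h1 : ∀ z, D.recip (z + ω) = χ⁻¹ * D.recip z := fun z => by
    rw [recip, h, mul_inv, recip]
  refine ⟨χ, hχ, h1, fun z => ?_⟩
  have h2 := h1 (z - ω)
  rw [sub_add_cancel] at h2
  rw [h2, mul_inv_cancel_left₀ hχ0]

theorem recip_add_period_two (z : ℂ) :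
    D.recip (z + D.lattice.ω₂) = D.multiplier⁻¹ * D.recip z := by
  rw [recip, fn_add_period_two, mul_inv, recip]

theorem recip_sub_period_two (z : ℂ) :
    D.recip (z - D.lattice.ω₂) = D.multiplier * D.recip z := by
  have h := D.recip_add_period_two (z - D.lattice.ω₂)
  rw [sub_add_cancel] at h
  rw [h, mul_inv_cancel_left₀ D.multiplier_ne_zero]

section FunctionalEquation

variable {ι : Type*} [DecidableEq ι] (s : Finset ι) (b : ι → ℂ)

/-- The left-hand side of the functional equation as a function of one of the variables, the others
being `b i` for `i ∈ s`. -/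
def equationSum (z : ℂ) : ℂ :=
  ∏ j ∈ s, D.recip (b j - z) +
    ∑ i ∈ s, D.recip (z - b i) * ∏ j ∈ s.erase i, D.recip (b j - b i)

theorem meromorphicAt_equationSum (z : ℂ) : MeromorphicAt (D.equationSum s b) z := by
  have h1 : ∀ j, MeromorphicAt (fun w => D.recip (b j - w)) z := fun j =>
    (D.meromorphicAt_recip (b j - z)).comp_analyticAt (by fun_prop)
  have h2 : ∀ j, MeromorphicAt (fun w => D.recip (w - b j)) z := fun j =>
    (D.meromorphicAt_recip (z - b j)).comp_analyticAt (g := fun w => w - b j) (by fun_prop)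
  exact (MeromorphicAt.fun_prod fun j _ => h1 j).add
    (MeromorphicAt.fun_sum fun i _ => (h2 i).mul (MeromorphicAt.const _ _))

theorem analyticAt_recip_sub {z c : ℂ} (h : z - c ∉ D.lattice.lattice) :
    AnalyticAt ℂ (fun w => D.recip (w - c)) z :=
  (D.analyticAt_recip h).fun_comp (f := fun w => w - c) (by fun_prop)

theorem analyticAt_recip_sub' {z c : ℂ} (h : z - c ∉ D.lattice.lattice) :
    AnalyticAt ℂ (fun w => D.recip (c - w)) z :=
  (D.analyticAt_recip (z := c - z) fun h' => h (by simpa using neg_mem h')).fun_comp (by fun_prop)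

theorem analyticAt_equationSum {z : ℂ} (hz : ∀ i ∈ s, z - b i ∉ D.lattice.lattice) :
    AnalyticAt ℂ (D.equationSum s b) z :=
  (Finset.analyticAt_fun_prod s fun j hj => D.analyticAt_recip_sub' (hz j hj)).add
    (Finset.analyticAt_fun_sum s fun i hi =>
      (D.analyticAt_recip_sub (hz i hi)).mul analyticAt_const)

variable {s b}

/-- The residues of the summands at `z = b k` cancel. -/
theorem tendsto_mul_equationSum {k : ι} (hk : k ∈ s)
    (hb : ∀ i ∈ s, i ≠ k → b k - b i ∉ D.lattice.lattice) :
    Tendsto (fun w => (w - b k) * D.equationSum s b w) (𝓝[≠] (b k)) (𝓝 0) := by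
  have t0 : Tendsto (fun w => w - b k) (𝓝[≠] (b k)) (𝓝 0) := by
    have := (tendsto_sub_const_nhdsNE (b k) (b k)).mono_right nhdsWithin_le_nhds
    rwa [sub_self] at this
  have t1 : Tendsto (fun w => (w - b k) * D.recip (w - b k)) (𝓝[≠] (b k)) (𝓝 1) := by
    have := tendsto_sub_const_nhdsNE (b k) (b k)
    rw [sub_self] at this
    exact D.tendsto_mul_recip.comp this
  have t2 : Tendsto (fun w => (w - b k) * D.recip (b k - w)) (𝓝[≠] (b k)) (𝓝 (-1)) := by
    have := tendsto_const_sub_nhdsNE (b k) (b k)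
    rw [sub_self] at this
    refine (D.tendsto_mul_recip.comp this).neg.congr fun w => ?_
    simp only [Function.comp_apply]
    ring
  have t3 : Tendsto (fun w => ∏ j ∈ s.erase k, D.recip (b j - w)) (𝓝[≠] (b k))
      (𝓝 (∏ j ∈ s.erase k, D.recip (b j - b k))) := by
    refine tendsto_finsetProd _ fun j hj => ?_
    exact (D.analyticAt_recip_sub' (hb j (Finset.mem_of_mem_erase hj)
      (Finset.ne_of_mem_erase hj))).continuousAt.tendsto.mono_left nhdsWithin_le_nhds
  have t4 : Tendsto (fun w => ∑ i ∈ s.erase k, D.recip (w - b i) *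
      ∏ j ∈ s.erase i, D.recip (b j - b i)) (𝓝[≠] (b k))
      (𝓝 (∑ i ∈ s.erase k, D.recip (b k - b i) * ∏ j ∈ s.erase i, D.recip (b j - b i))) := by
    refine tendsto_finsetSum _ fun i hi => Tendsto.mul_const _ ?_
    exact (D.analyticAt_recip_sub (hb i (Finset.mem_of_mem_erase hi)
      (Finset.ne_of_mem_erase hi))).continuousAt.tendsto.mono_left nhdsWithin_le_nhds
  have key := ((t2.mul t3).add (t1.mul_const (∏ j ∈ s.erase k, D.recip (b j - b k)))).add
    (t0.mul t4)
  have hzero : (-1 * ∏ j ∈ s.erase k, D.recip (b j - b k)) +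
      1 * (∏ j ∈ s.erase k, D.recip (b j - b k)) +
      0 * (∑ i ∈ s.erase k, D.recip (b k - b i) * ∏ j ∈ s.erase i, D.recip (b j - b i)) = 0 := by
    ring
  rw [hzero] at key
  refine key.congr fun w => ?_
  rw [equationSum, ← Finset.mul_prod_erase s _ hk, ← Finset.add_sum_erase s _ hk]
  ring

/-- Under a translation that multiplies `1 / f` by `χ⁻¹`, the first product is multiplied by
`χ ^ s.card` and the other terms by `χ⁻¹`. -/
theorem equationSum_add {χ ω : ℂ} (hχ : χ ^ (s.card + 1) = 1)
    (h1 : ∀ z, D.recip (z + ω) = χ⁻¹ * D.recip z) (h2 : ∀ z, D.recip (z - ω) = χ * D.recip z)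
    (z : ℂ) : D.equationSum s b (z + ω) = χ⁻¹ * D.equationSum s b z := by
  have hχ0 : χ ≠ 0 := by
    rintro rfl
    simp at hχ
  have hpow : χ ^ s.card = χ⁻¹ := by
    exact eq_inv_of_mul_eq_one_left (by rw [← pow_succ, hχ])
  rw [equationSum, equationSum, mul_add, Finset.mul_sum]
  congr 1
  · rw [← hpow, ← Finset.prod_const, ← Finset.prod_mul_distrib]
    refine Finset.prod_congr rfl fun j _ => ?_
    rw [← sub_sub, h2]
  · refine Finset.sum_congr rfl fun i _ => ?_
    rw [add_sub_right_comm, h1, mul_assoc]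

/-- The functional equation holds for elliptic functions of level `N` as soon as `N` divides the
number of variables: in each variable the left-hand side is a doubly periodic function without
poles, up to a nontrivial multiplier. -/
theorem equationSum_eq_zero (hs : D.N ∣ s.card + 1)
    (hb : ∀ i ∈ s, ∀ j ∈ s, j ≠ i → b i - b j ∉ D.lattice.lattice) {z : ℂ}
    (hz : ∀ i ∈ s, z - b i ∉ D.lattice.lattice) : D.equationSum s b z = 0 := by
  have hroot : ∀ χ : ℂ, χ ^ D.N = 1 → χ ^ (s.card + 1) = 1 := by
    intro χ hχ
    obtain ⟨m, hm⟩ := hs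
    rw [hm, pow_mul, hχ, one_pow]
  have hlim : ∀ z, Tendsto (fun w => (w - z) * D.equationSum s b w) (𝓝[≠] z) (𝓝 0) := by
    intro z
    by_cases hgood : ∀ i ∈ s, z - b i ∉ D.lattice.lattice
    · have hc := (D.analyticAt_equationSum s b hgood).continuousAt
      have hc' : ContinuousAt (fun w => (w - z) * D.equationSum s b w) z := by fun_prop
      have := hc'.tendsto.mono_left (nhdsWithin_le_nhds (s := {z}ᶜ))
      simpa using this
    · push Not at hgood
      obtain ⟨k, hk, hω⟩ := hgood
      -- translate `z` by a period to `b k`, where the residues cancel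
      obtain ⟨χ, hχ, h1, h2⟩ := D.exists_recip_multiplier hω
      have hshift := tendsto_sub_const_nhdsNE (z - b k) z
      rw [sub_sub_cancel] at hshift
      have := ((D.tendsto_mul_equationSum hk fun i hi hik => hb k hk i hi hik).comp
        hshift).const_mul χ⁻¹
      rw [mul_zero] at this
      refine this.congr fun w => ?_
      have h3 := D.equationSum_add (s := s) (b := b) (hroot χ hχ) h1 h2 (w - (z - b k))
      rw [sub_add_cancel] at h3
      simp only [Function.comp_apply]
      rw [h3]
      ring
  obtain ⟨c, hc⟩ := exists_eventually_eq_const_of_norm_periodic D.lattice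
    (D.meromorphicAt_equationSum s b) hlim (by
      intro ω hω z
      obtain ⟨χ, hχ, h1, h2⟩ := D.exists_recip_multiplier hω
      rw [D.equationSum_add (hroot χ hχ) h1 h2, norm_mul, norm_inv,
        Complex.norm_eq_one_of_pow_eq_one hχ (by have := D.two_le; omega), inv_one, one_mul])
  -- the constant is multiplied by a nontrivial root of unity under the second period
  have hc0 : c = 0 := by
    have hm : D.multiplier ^ D.N = 1 := D.multiplier_isPrimitiveRoot.pow_eq_one
    have hm1 : D.multiplier ≠ 1 := D.multiplier_isPrimitiveRoot.ne_one D.two_le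
    have hsh := tendsto_sub_const_nhdsNE D.lattice.ω₂ 0
    obtain ⟨w, hw1, hw2⟩ := ((hc 0).and (hsh.eventually (hc _))).exists
    have h3 := D.equationSum_add (s := s) (b := b) (hroot _ hm) D.recip_add_period_two
      D.recip_sub_period_two (w - D.lattice.ω₂)
    rw [sub_add_cancel, hw1, hw2] at h3
    by_contra hc0
    have h4 : D.multiplier⁻¹ = 1 := mul_right_cancel₀ hc0 (by rw [← h3, one_mul])
    exact hm1 (inv_eq_one.1 h4)
  have ht : Tendsto (D.equationSum s b) (𝓝[≠] z) (𝓝 (D.equationSum s b z)) :=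
    (D.analyticAt_equationSum s b hz).continuousAt.tendsto.mono_left nhdsWithin_le_nhds
  have ht' : Tendsto (D.equationSum s b) (𝓝[≠] z) (𝓝 0) := by
    refine tendsto_const_nhds.congr' ?_
    filter_upwards [hc z] with w hw
    rw [hw, hc0]
  exact tendsto_nhds_unique ht ht'

/-- The functional equation in symmetric form. -/
theorem sum_prod_recip_eq_zero {ι : Type*} [Fintype ι] [DecidableEq ι] [Nonempty ι]
    (hN : D.N ∣ Fintype.card ι) {b : ι → ℂ}
    (hb : ∀ i j, i ≠ j → b i - b j ∉ D.lattice.lattice) :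
    ∑ i, ∏ j ∈ Finset.univ.erase i, D.recip (b j - b i) = 0 := by
  let k : ι := Classical.arbitrary ι
  have hk := Finset.mem_univ k
  have h := D.equationSum_eq_zero (s := Finset.univ.erase k) (b := b) (z := b k)
    (by rw [Finset.card_erase_add_one hk]; exact hN) (fun i _ j _ hij => hb i j hij.symm)
    (fun i hi => hb k i (Finset.ne_of_mem_erase hi).symm)
  rw [← Finset.add_sum_erase _ _ hk, ← h, equationSum]
  congr 1
  refine Finset.sum_congr rfl fun i hi => ?_
  rw [← Finset.mul_prod_erase (Finset.univ.erase i) _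
    (Finset.mem_erase.2 ⟨(Finset.ne_of_mem_erase hi).symm, hk⟩), Finset.erase_right_comm]

end FunctionalEquation

/-- The holomorphic function `z / fn z` near the origin. -/
def reduced (z : ℂ) : ℂ := (dslope D.fn 0 z)⁻¹

theorem dslope_fn_zero : dslope D.fn 0 0 = 1 := by
  rw [dslope_same, D.hasDerivAt_fn_zero.deriv]

theorem analyticAt_dslope : AnalyticAt ℂ (dslope D.fn 0) 0 := by
  obtain ⟨p, hp⟩ := D.analyticAt_fn_zero
  exact hp.has_fpower_series_dslope_fslope.analyticAt

theorem analyticAt_reduced : AnalyticAt ℂ D.reduced 0 :=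
  D.analyticAt_dslope.inv (by rw [dslope_fn_zero]; exact one_ne_zero)

theorem reduced_of_ne {z : ℂ} (hz : z ≠ 0) : D.reduced z = z * D.recip z := by
  rw [reduced, dslope_of_ne _ hz, slope_def_field, D.fn_zero, sub_zero, sub_zero, inv_div, recip,
    div_eq_mul_inv]

/-- The expansion at the origin of the elliptic function. -/
def series : PowerSeries ℂ := taylor D.fn

theorem isNormalized_series : IsNormalized D.series := by
  constructor
  · rw [series, coeff_taylor_zero, D.fn_zero]
  · simp [series, taylor, iteratedDeriv_one, D.hasDerivAt_fn_zero.deriv]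

theorem qSeries_series : qSeries D.series = taylor D.reduced := by
  have h1 : taylor D.reduced * D.series = PowerSeries.X := by
    rw [series, ← taylor_mul D.analyticAt_reduced D.analyticAt_fn_zero, ← taylor_id]
    refine taylor_congr ?_
    have h : ∀ᶠ z in 𝓝 (0 : ℂ), dslope D.fn 0 z ≠ 0 :=
      D.analyticAt_dslope.continuousAt.eventually_ne (by rw [dslope_fn_zero]; exact one_ne_zero)
    filter_upwards [h] with z hz
    have h2 := sub_smul_dslope D.fn 0 z
    rw [D.fn_zero, sub_zero, sub_zero, smul_eq_mul] at h2
    rw [reduced, ← h2]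
    field_simp
  have h2 := qSeries_mul D.isNormalized_series
  refine mul_right_cancel₀ (b := D.series) ?_ (h2.trans h1.symm)
  intro h0
  have := D.isNormalized_series.2
  rw [h0, map_zero] at this
  exact zero_ne_one this

theorem coeff_zero_qSeries : PowerSeries.coeff 0 (qSeries D.series) = 1 := by
  rw [qSeries_series, coeff_taylor_zero, reduced, dslope_fn_zero, inv_one]

theorem eventually_notMem_lattice {c : ℂ} (hc : c ≠ 0) :
    ∀ᶠ t in 𝓝[≠] (0 : ℂ), c * t ∉ D.lattice.lattice := by
  have h1 := D.lattice.compl_lattice_sdiff_singleton_mem_nhds 0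
  have h2 : Tendsto (fun t : ℂ => c * t) (𝓝 0) (𝓝 0) := by
    have : ContinuousAt (fun t : ℂ => c * t) 0 := by fun_prop
    simpa using this.tendsto
  filter_upwards [(h2.eventually h1).filter_mono nhdsWithin_le_nhds, self_mem_nhdsWithin]
    with t ht ht0
  intro hmem
  exact ht ⟨hmem, mul_ne_zero hc ht0⟩

/-- Near the origin, the functional equation along a line is the vanishing of the line series. -/
theorem lineSeries_eq_zero_iff {n : ℕ} {a : Fin n → ℂ} (ha : Function.Injective a) :
    lineSeries a (qSeries D.series) = 0 ↔ ∀ᶠ t in 𝓝[≠] (0 : ℂ),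
      ∑ i, ∏ j ∈ Finset.univ.erase i, D.recip ((a j - a i) * t) = 0 := by
  have hdif : ∀ i j, i ≠ j → a i - a j ≠ 0 := fun i j hij => sub_ne_zero.2 (ha.ne hij)
  set F : ℂ → ℂ := fun t => ∑ i, (differenceProduct a i)⁻¹ *
    ∏ j ∈ Finset.univ.erase i, D.reduced ((a j - a i) * t) with hF
  have han : ∀ i j, AnalyticAt ℂ (fun t => D.reduced ((a j - a i) * t)) 0 := by
    intro i j
    refine AnalyticAt.fun_comp (g := D.reduced) ?_ (by fun_prop)
    rw [mul_zero]
    exact D.analyticAt_reduced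
  have hprod : ∀ i, AnalyticAt ℂ
      (fun t => ∏ j ∈ Finset.univ.erase i, D.reduced ((a j - a i) * t)) 0 :=
    fun i => Finset.analyticAt_fun_prod _ fun j _ => han i j
  have hterm : ∀ i, AnalyticAt ℂ (fun t => (differenceProduct a i)⁻¹ *
      ∏ j ∈ Finset.univ.erase i, D.reduced ((a j - a i) * t)) 0 :=
    fun i => analyticAt_const.mul (hprod i)
  have hFan : AnalyticAt ℂ F 0 := Finset.analyticAt_fun_sum _ fun i _ => hterm i
  have htay : lineSeries a (qSeries D.series) = taylor F := by
    rw [hF, taylor_sum _ fun i _ => hterm i, lineSeries]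
    refine Finset.sum_congr rfl fun i _ => ?_
    rw [taylor_mul analyticAt_const (hprod i), taylor_const, taylor_prod _ fun j _ => han i j,
      qSeries_series]
    congr 1
    refine Finset.prod_congr rfl fun j _ => ?_
    rw [taylor_comp_mul_left]
    rfl
  have hFt : ∀ t, t ≠ 0 → F t = t ^ (n - 1) *
      ∑ i, ∏ j ∈ Finset.univ.erase i, D.recip ((a j - a i) * t) := by
    intro t ht0
    rw [hF, Finset.mul_sum]
    refine Finset.sum_congr rfl fun i _ => ?_
    have h3 : ∀ j ∈ Finset.univ.erase i, D.reduced ((a j - a i) * t) =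
        (a j - a i) * (t * D.recip ((a j - a i) * t)) := by
      intro j hj
      rw [D.reduced_of_ne (mul_ne_zero (hdif j i (Finset.ne_of_mem_erase hj)) ht0), mul_assoc]
    rw [Finset.prod_congr rfl h3, Finset.prod_mul_distrib, Finset.prod_mul_distrib,
      Finset.prod_const, Finset.card_erase_of_mem (Finset.mem_univ i), Finset.card_univ,
      Fintype.card_fin, ← mul_assoc]
    have h4 : (differenceProduct a i)⁻¹ * ∏ j ∈ Finset.univ.erase i, (a j - a i) = 1 :=
      inv_mul_cancel₀ (differenceProduct_ne_zero ha i)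
    rw [h4, one_mul]
  have h1 : lineSeries a (qSeries D.series) = 0 ↔ F =ᶠ[𝓝 0] fun _ => 0 := by
    rw [htay]
    constructor
    · intro h
      exact eventuallyEq_of_taylor_eq hFan analyticAt_const (by rw [h, taylor_const, map_zero])
    · intro h
      rw [taylor_congr h, taylor_const, map_zero]
  rw [h1, ← ContinuousAt.eventuallyEq_nhds_iff_eventuallyEq_nhdsNE hFan.continuousAt
    continuousAt_const]
  refine eventually_congr ?_
  filter_upwards [self_mem_nhdsWithin] with t ht
  rw [hFt t ht, mul_eq_zero, or_iff_right (pow_ne_zero _ ht)]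

/-- The expansion at the origin of an elliptic function of level `N ∣ n` solves the functional
equation in `n` variables. -/
theorem vanishesOnLines {n : ℕ} (hn : n ≠ 0) (hN : D.N ∣ n) :
    VanishesOnLines n (qSeries D.series) := by
  intro a ha
  have : Nonempty (Fin n) := ⟨⟨0, Nat.pos_of_ne_zero hn⟩⟩
  have hdif : ∀ i j, i ≠ j → a i - a j ≠ 0 := fun i j hij => sub_ne_zero.2 (ha.ne hij)
  rw [D.lineSeries_eq_zero_iff ha]
  have hev : ∀ᶠ t in 𝓝[≠] (0 : ℂ), ∀ i j, i ≠ j → (a i - a j) * t ∉ D.lattice.lattice := by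
    refine eventually_all.2 fun i => eventually_all.2 fun j => ?_
    by_cases hij : i = j
    · exact Eventually.of_forall fun t h => absurd hij h
    · filter_upwards [D.eventually_notMem_lattice (hdif i j hij)] with t ht _ using ht
  filter_upwards [hev] with t ht
  simp only [sub_mul]
  exact D.sum_prod_recip_eq_zero (b := fun i => a i * t) (by simpa using hN)
    (fun i j hij => by rw [← sub_mul]; exact ht i j hij)

end LevelDatum

end

section

open Filter Topology Complex

/-! ### The differential equation for elliptic functions of level `N` -/

/-- For parameters read off from `Q = z / f`, the two sides of the differential equation agree up to
the third order. -/
theorem coeff_ode_eq_zero {f : PowerSeries ℂ} (hf : IsNormalized f) {k : ℕ} (hk : k < 3) :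
    PowerSeries.coeff k (f * PowerSeries.derivative ℂ (PowerSeries.derivative ℂ
        (PowerSeries.derivative ℂ f))
      - 3 * PowerSeries.derivative ℂ f * PowerSeries.derivative ℂ (PowerSeries.derivative ℂ f)
      - (PowerSeries.C (6 * PowerSeries.coeff 1 (qSeries f)) * PowerSeries.derivative ℂ f ^ 2
        + PowerSeries.C (12 * PowerSeries.coeff 2 (qSeries f)) * f * PowerSeries.derivative ℂ f
        + PowerSeries.C (12 * PowerSeries.coeff 3 (qSeries f)) * f ^ 2)) = 0 := by
  have hQ := qSeries_mul hf
  obtain ⟨h0, h1⟩ := hf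
  have c : ∀ n, PowerSeries.coeff n (qSeries f * f) = PowerSeries.coeff n PowerSeries.X :=
    fun n => by rw [hQ]
  have c1 := c 1
  have c2 := c 2
  have c3 := c 3
  have c4 := c 4
  simp only [PowerSeries.coeff_mul, Finset.Nat.sum_antidiagonal_eq_sum_range_succ_mk,
    Finset.sum_range_succ, Finset.sum_range_zero, PowerSeries.coeff_X] at c1 c2 c3 c4
  norm_num [h0, h1] at c1 c2 c3 c4
  rw [c1, one_mul] at c2 c3 c4
  have e1 := eq_neg_of_add_eq_zero_right c2
  have e2 := eq_neg_of_add_eq_zero_right c3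
  have e3 := eq_neg_of_add_eq_zero_right c4
  rw [mul_assoc 3, mul_assoc (PowerSeries.C _) f, ← map_ofNat PowerSeries.C 3, e3, e2, e1]
  simp only [map_sub, map_add, PowerSeries.coeff_C_mul, pow_two]
  interval_cases k <;>
  simp only [PowerSeries.coeff_mul, Finset.Nat.sum_antidiagonal_eq_sum_range_succ_mk,
    Finset.sum_range_succ, Finset.sum_range_zero, PowerSeries.coeff_derivative] <;>
  norm_num [h0, h1] <;>
  ring

namespace LevelDatum

variable (D : LevelDatum)

/-- The difference of the two sides of the differential equation with parameters `q₁, q₂, q₃`. -/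
def odeDefect (q₁ q₂ q₃ : ℂ) (z : ℂ) : ℂ :=
  D.fn z * deriv (deriv (deriv D.fn)) z - 3 * deriv D.fn z * deriv (deriv D.fn) z -
    (6 * q₁ * deriv D.fn z ^ 2 + 12 * q₂ * D.fn z * deriv D.fn z + 12 * q₃ * D.fn z ^ 2)

/-- The quotient of `odeDefect` by the square of the elliptic function. In terms of the logarithmic
derivative `h` it is `h'' - 2 h³ - 6 q₁ h² - 12 q₂ h - 12 q₃`. -/
def odeQuotient (q₁ q₂ q₃ : ℂ) (z : ℂ) : ℂ := D.odeDefect q₁ q₂ q₃ z / D.fn z ^ 2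

variable {q₁ q₂ q₃ : ℂ}

theorem deriv_add_of_forall {g : ℂ → ℂ} {χ ω : ℂ} (h : ∀ z, g (z + ω) = χ * g z) (z : ℂ) :
    deriv g (z + ω) = χ * deriv g z := by
  have h1 : (fun z => g (z + ω)) = fun z => χ * g z := funext h
  rw [← deriv_comp_add_const, h1, deriv_const_mul_field]

theorem odeQuotient_add {ω : ℂ} (hω : ω ∈ D.lattice.lattice) (z : ℂ) :
    D.odeQuotient q₁ q₂ q₃ (z + ω) = D.odeQuotient q₁ q₂ q₃ z := by
  obtain ⟨χ, hχ, h⟩ := D.exists_multiplier hω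
  have hχ0 : χ ≠ 0 := by
    rintro rfl
    rw [zero_pow (by have := D.two_le; omega)] at hχ
    exact zero_ne_one hχ
  have h1 := deriv_add_of_forall h
  have h2 := deriv_add_of_forall h1
  have h3 := deriv_add_of_forall h2
  rw [odeQuotient, odeDefect, h, h1, h2, h3, odeQuotient, odeDefect,
    ← mul_div_mul_left _ (D.fn z ^ 2) (pow_ne_zero 2 hχ0)]
  congr 1 <;> ring

/-- The set of points that are neither zeros nor poles. -/
def regularSet : Set ℂ := {z | z ∉ D.lattice.lattice ∧ z - D.pole ∉ D.lattice.lattice}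

theorem isOpen_regularSet : IsOpen D.regularSet := by
  have h := D.lattice.isClosed_lattice.isOpen_compl
  exact h.inter (h.preimage (continuous_sub_right D.pole))

theorem fn_ne_zero {z : ℂ} (hz : z ∈ D.regularSet) : D.fn z ≠ 0 := by
  rw [Ne, fn_eq_zero_iff]
  exact not_or.2 hz

/-- If `g (ρ - z) = G z` on the set of regular points, then `g' (ρ - z) = - G' z` there. -/
theorem deriv_pole_sub {g G G' : ℂ → ℂ} (h : ∀ z ∈ D.regularSet, g (D.pole - z) = G z)
    (hG : ∀ z ∈ D.regularSet, HasDerivAt G (-G' z) z) :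
    ∀ z ∈ D.regularSet, deriv g (D.pole - z) = G' z := by
  intro z hz
  have h1 : (fun w => g (D.pole - w)) =ᶠ[𝓝 z] G := by
    filter_upwards [D.isOpen_regularSet.mem_nhds hz] with w hw using h w hw
  have h2 := h1.deriv_eq
  rw [deriv_comp_const_sub, (hG z hz).deriv] at h2
  exact neg_injective h2

/-- The differential expression is invariant under the reflection that interchanges the zero and
the pole of the elliptic function. -/
theorem odeQuotient_pole_sub {z : ℂ} (hz : z ∈ D.regularSet) :
    D.odeQuotient q₁ q₂ q₃ (D.pole - z) = D.odeQuotient q₁ q₂ q₃ z := by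
  obtain ⟨K, hK, h⟩ := D.exists_fn_pole_sub
  have d0 : ∀ z ∈ D.regularSet, HasDerivAt D.fn (deriv D.fn z) z := fun z hz =>
    (D.analyticAt_fn hz.2).differentiableAt.hasDerivAt
  have d1 : ∀ z ∈ D.regularSet, HasDerivAt (deriv D.fn) (deriv (deriv D.fn) z) z := fun z hz =>
    (D.analyticAt_fn hz.2).deriv.differentiableAt.hasDerivAt
  have d2 : ∀ z ∈ D.regularSet,
      HasDerivAt (deriv (deriv D.fn)) (deriv (deriv (deriv D.fn)) z) z := fun z hz =>
    (D.analyticAt_fn hz.2).deriv.deriv.differentiableAt.hasDerivAt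
  have h1 : ∀ z ∈ D.regularSet, deriv D.fn (D.pole - z) = K * deriv D.fn z / D.fn z ^ 2 := by
    refine D.deriv_pole_sub (G := fun z => K / D.fn z) (fun z _ => h z) fun z hz => ?_
    have hne := D.fn_ne_zero hz
    refine ((hasDerivAt_const z K).div (d0 z hz) hne).congr_deriv ?_
    field_simp
    ring
  have h2 : ∀ z ∈ D.regularSet, deriv (deriv D.fn) (D.pole - z) =
      -(K * deriv (deriv D.fn) z / D.fn z ^ 2 - 2 * K * deriv D.fn z ^ 2 / D.fn z ^ 3) := by
    refine D.deriv_pole_sub h1 fun z hz => ?_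
    have hne := D.fn_ne_zero hz
    refine (((d1 z hz).const_mul K).div ((d0 z hz).pow 2) (pow_ne_zero 2 hne)).congr_deriv ?_
    simp only [Pi.pow_apply]
    field_simp
    ring
  have h3 : ∀ z ∈ D.regularSet, deriv (deriv (deriv D.fn)) (D.pole - z) =
      K * deriv (deriv (deriv D.fn)) z / D.fn z ^ 2
        - 6 * K * deriv D.fn z * deriv (deriv D.fn) z / D.fn z ^ 3
        + 6 * K * deriv D.fn z ^ 3 / D.fn z ^ 4 := by
    refine D.deriv_pole_sub h2 fun z hz => ?_
    have hne := D.fn_ne_zero hz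
    refine ((((d2 z hz).const_mul K).div ((d0 z hz).pow 2) (pow_ne_zero 2 hne)).sub
      ((((d1 z hz).pow 2).const_mul (2 * K)).div ((d0 z hz).pow 3)
        (pow_ne_zero 3 hne))).neg.congr_deriv ?_
    simp only [Pi.pow_apply]
    field_simp
    ring
  have hne := D.fn_ne_zero hz
  rw [odeQuotient, odeDefect, h, h1 z hz, h2 z hz, h3 z hz, odeQuotient, odeDefect]
  field_simp
  ring

theorem analyticAt_odeDefect {z : ℂ} (hz : z - D.pole ∉ D.lattice.lattice) :
    AnalyticAt ℂ (D.odeDefect q₁ q₂ q₃) z := by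
  have h0 := D.analyticAt_fn hz
  have h1 := h0.deriv
  have h2 := h1.deriv
  have h3 := h2.deriv
  unfold odeDefect
  fun_prop

theorem analyticAt_odeQuotient {z : ℂ} (hz : z ∈ D.regularSet) :
    AnalyticAt ℂ (D.odeQuotient q₁ q₂ q₃) z :=
  (D.analyticAt_odeDefect hz.2).div ((D.analyticAt_fn hz.2).pow 2) (pow_ne_zero 2 (D.fn_ne_zero hz))

theorem meromorphicAt_odeQuotient (z : ℂ) : MeromorphicAt (D.odeQuotient q₁ q₂ q₃) z := by
  have h0 := D.meromorphicAt_fn z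
  have h1 := h0.deriv
  have h2 := h1.deriv
  have h3 := h2.deriv
  unfold odeQuotient odeDefect
  fun_prop

theorem taylor_odeDefect : taylor (D.odeDefect q₁ q₂ q₃) =
    D.series * PowerSeries.derivative ℂ (PowerSeries.derivative ℂ
        (PowerSeries.derivative ℂ D.series))
      - 3 * PowerSeries.derivative ℂ D.series *
        PowerSeries.derivative ℂ (PowerSeries.derivative ℂ D.series)
      - (PowerSeries.C (6 * q₁) * PowerSeries.derivative ℂ D.series ^ 2
        + PowerSeries.C (12 * q₂) * D.series * PowerSeries.derivative ℂ D.series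
        + PowerSeries.C (12 * q₃) * D.series ^ 2) := by
  have h0 := D.analyticAt_fn_zero
  have h1 := h0.deriv
  have h2 := h1.deriv
  have h3 := h2.deriv
  have c : ∀ c : ℂ, AnalyticAt ℂ (fun _ : ℂ => c) 0 := fun c => analyticAt_const
  have e : D.odeDefect q₁ q₂ q₃ = fun z => (D.fn z * deriv (deriv (deriv D.fn)) z +
      (-3) * (deriv D.fn z * deriv (deriv D.fn) z)) + ((-(6 * q₁)) * (deriv D.fn z * deriv D.fn z) +
      ((-(12 * q₂)) * (D.fn z * deriv D.fn z) + (-(12 * q₃)) * (D.fn z * D.fn z))) := by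
    funext z
    rw [odeDefect]
    ring
  have a1 := h0.fun_mul h3
  have a2 := h1.fun_mul h2
  have a3 := h1.fun_mul h1
  have a4 := h0.fun_mul h1
  have a5 := h0.fun_mul h0
  have b2 := (c (-3)).fun_mul a2
  have b3 := (c (-(6 * q₁))).fun_mul a3
  have b4 := (c (-(12 * q₂))).fun_mul a4
  have b5 := (c (-(12 * q₃))).fun_mul a5
  rw [e, taylor_add (a1.fun_add b2) (b3.fun_add (b4.fun_add b5)), taylor_add a1 b2,
    taylor_add b3 (b4.fun_add b5), taylor_add b4 b5, taylor_mul h0 h3, taylor_mul (c _) a2,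
    taylor_mul (c _) a3, taylor_mul (c _) a4, taylor_mul (c _) a5, taylor_mul h1 h2,
    taylor_mul h1 h1, taylor_mul h0 h1, taylor_mul h0 h0]
  simp only [taylor_const, taylor_deriv, map_neg]
  rw [map_ofNat, ← series]
  ring

/-- The parameters are such that the expression vanishes to third order at the origin, while the
denominator vanishes to second order. -/
theorem tendsto_odeQuotient_zero :
    Tendsto (D.odeQuotient (PowerSeries.coeff 1 (qSeries D.series))
      (PowerSeries.coeff 2 (qSeries D.series)) (PowerSeries.coeff 3 (qSeries D.series)))
      (𝓝[≠] 0) (𝓝 0) := by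
  obtain ⟨g, hg, hE⟩ := exists_eq_pow_three_mul
    (D.analyticAt_odeDefect (q₁ := PowerSeries.coeff 1 (qSeries D.series))
      (q₂ := PowerSeries.coeff 2 (qSeries D.series)) (q₃ := PowerSeries.coeff 3 (qSeries D.series))
      (D.sub_pole_notMem (zero_mem _))) (fun k hk => by
        rw [taylor_odeDefect]
        exact coeff_ode_eq_zero D.isNormalized_series hk)
  have hlim : Tendsto (fun z => z * g z * D.reduced z ^ 2) (𝓝[≠] 0) (𝓝 0) := by
    have hc := hg.continuousAt
    have hr := D.analyticAt_reduced.continuousAt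
    have : ContinuousAt (fun z => z * g z * D.reduced z ^ 2) 0 := by fun_prop
    simpa using this.tendsto.mono_left (nhdsWithin_le_nhds (s := {0}ᶜ))
  refine hlim.congr' ?_
  filter_upwards [hE.filter_mono nhdsWithin_le_nhds, self_mem_nhdsWithin] with z hz hz0
  rw [odeQuotient, hz, D.reduced_of_ne hz0, recip, div_eq_mul_inv, ← inv_pow]
  ring

theorem eventually_mem_regularSet (z : ℂ) : ∀ᶠ w in 𝓝[≠] z, w ∈ D.regularSet := by
  have h : ∀ c : ℂ, ∀ᶠ w in 𝓝[≠] c, w ∉ D.lattice.lattice := by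
    intro c
    filter_upwards [nhdsWithin_le_nhds (D.lattice.compl_lattice_sdiff_singleton_mem_nhds c),
      self_mem_nhdsWithin] with w hw hw0 hmem
    exact hw ⟨hmem, hw0⟩
  filter_upwards [h z, (tendsto_sub_const_nhdsNE D.pole z).eventually (h _)] with w h1 h2
  exact ⟨h1, h2⟩

/-- The expansion of an elliptic function of level `N` solves the differential equation: the
quotient `odeQuotient` is doubly periodic, tends to `0` at the zeros of the elliptic function and,
by the reflection, at its poles, so Liouville's theorem makes it `0`. -/
theorem isODESolution_series : IsODESolution (parameters (qSeries D.series)) D.series where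
  normalized := D.isNormalized_series
  coeff_q := fun k => rfl
  ode := by
    set q₁ := PowerSeries.coeff 1 (qSeries D.series) with hq₁
    set q₂ := PowerSeries.coeff 2 (qSeries D.series) with hq₂
    set q₃ := PowerSeries.coeff 3 (qSeries D.series) with hq₃
    have hz := D.tendsto_odeQuotient_zero
    rw [← hq₁, ← hq₂, ← hq₃] at hz
    have hlat : ∀ ω ∈ D.lattice.lattice, Tendsto (D.odeQuotient q₁ q₂ q₃) (𝓝[≠] ω) (𝓝 0) := by
      intro ω hω
      have h1 := tendsto_sub_const_nhdsNE ω ω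
      rw [sub_self] at h1
      refine (hz.comp h1).congr fun w => ?_
      rw [Function.comp_apply, ← D.odeQuotient_add hω, sub_add_cancel]
    have hlim : ∀ z, Tendsto (fun w => (w - z) * D.odeQuotient q₁ q₂ q₃ w) (𝓝[≠] z) (𝓝 0) := by
      intro z
      have h0 : Tendsto (fun w => w - z) (𝓝[≠] z) (𝓝 0) := by
        have := (tendsto_sub_const_nhdsNE z z).mono_right nhdsWithin_le_nhds
        rwa [sub_self] at this
      suffices h : ∃ c, Tendsto (D.odeQuotient q₁ q₂ q₃) (𝓝[≠] z) (𝓝 c) by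
        obtain ⟨c, hc⟩ := h
        simpa using h0.mul hc
      by_cases h1 : z ∈ D.lattice.lattice
      · exact ⟨0, hlat z h1⟩
      by_cases h2 : z - D.pole ∈ D.lattice.lattice
      · -- near a pole, reflect to a zero
        refine ⟨0, ((hlat (D.pole - z) (by simpa using neg_mem h2)).comp
          (tendsto_const_sub_nhdsNE D.pole z)).congr' ?_⟩
        filter_upwards [D.eventually_mem_regularSet z] with w hw
        exact D.odeQuotient_pole_sub hw
      · exact ⟨_, (D.analyticAt_odeQuotient ⟨h1, h2⟩).continuousAt.tendsto.mono_left
          nhdsWithin_le_nhds⟩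
    obtain ⟨c, hc⟩ := exists_eventually_eq_const_of_norm_periodic D.lattice
      D.meromorphicAt_odeQuotient hlim fun ω hω z => by rw [D.odeQuotient_add hω]
    have hc0 : c = 0 :=
      tendsto_nhds_unique (tendsto_const_nhds.congr' ((hc 0).mono fun w hw => hw.symm)) hz
    have hE : D.odeDefect q₁ q₂ q₃ =ᶠ[𝓝 0] fun _ => 0 := by
      refine (ContinuousAt.eventuallyEq_nhds_iff_eventuallyEq_nhdsNE
        (D.analyticAt_odeDefect (D.sub_pole_notMem (zero_mem _))).continuousAt
        continuousAt_const).1 ?_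
      filter_upwards [hc 0, D.eventually_mem_regularSet 0] with w hw hreg
      rw [odeQuotient, hc0, div_eq_zero_iff] at hw
      exact hw.resolve_right (pow_ne_zero 2 (D.fn_ne_zero hreg))
    have h := D.taylor_odeDefect (q₁ := q₁) (q₂ := q₂) (q₃ := q₃)
    rw [taylor_congr hE, taylor_const, map_zero] at h
    exact sub_eq_zero.1 h.symm

end LevelDatum

/-! ### Scaling and comparison of elliptic functions -/

namespace LevelDatum

variable (D D' : LevelDatum)

/-- The datum of the function `c⁻¹ * f (c * z)`. -/
def withScale (c : ℂ) (hc : c ≠ 0) : LevelDatum :=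
  { D with
    scale := c * D.scale
    scale_ne_zero := mul_ne_zero hc D.scale_ne_zero }

theorem fn_withScale (c : ℂ) (hc : c ≠ 0) (z : ℂ) :
    (D.withScale c hc).fn z = c⁻¹ * D.fn (c * z) := by
  simp only [fn, num, den, withScale]
  rw [show c * D.scale * z = D.scale * (c * z) by ring]
  by_cases h0 : theta D.τ (D.scale * (c * z) - (D.N : ℂ)⁻¹) = 0
  · simp [h0]
  · have := D.scale_ne_zero
    have := deriv_theta_zero_ne_zero D.im_pos
    field_simp

theorem qSeries_eq_of_mul_eq {f Q : PowerSeries ℂ} (hf : IsNormalized f)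
    (h : Q * f = PowerSeries.X) : qSeries f = Q := by
  refine mul_right_cancel₀ (b := f) ?_ ((qSeries_mul hf).trans h.symm)
  rintro rfl
  have := hf.2
  rw [map_zero] at this
  exact zero_ne_one this

theorem qSeries_series_withScale (c : ℂ) (hc : c ≠ 0) :
    qSeries (D.withScale c hc).series = PowerSeries.rescale c (qSeries D.series) := by
  refine qSeries_eq_of_mul_eq (isNormalized_series _) ?_
  have hcomp : AnalyticAt ℂ (fun z => D.fn (c * z)) 0 := by
    refine AnalyticAt.fun_comp (g := D.fn) ?_ (by fun_prop)
    rw [mul_zero]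
    exact D.analyticAt_fn_zero
  have h : (D.withScale c hc).series =
      PowerSeries.C c⁻¹ * PowerSeries.rescale c D.series := by
    rw [series, show (D.withScale c hc).fn = fun z => c⁻¹ * D.fn (c * z) from
      funext (D.fn_withScale c hc), taylor_mul analyticAt_const hcomp, taylor_const,
      taylor_comp_mul_left, series]
  rw [h, mul_left_comm, rescale_mul_rescale_qSeries D.isNormalized_series, ← mul_assoc, ← map_mul,
    inv_mul_cancel₀ hc, map_one, one_mul]

variable {D D'}

/-- Elliptic functions with the same expansion at the origin agree everywhere. The identity is
cleared of denominators, so that it also holds at the poles. -/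
theorem num_mul_den_eq (h : qSeries D.series = qSeries D'.series) (z : ℂ) :
    D.num z * D'.den z = D'.num z * D.den z := by
  have hs : D.series = D'.series := by
    have h1 := qSeries_mul D.isNormalized_series
    have h2 := qSeries_mul D'.isNormalized_series
    rw [← h, ← h1] at h2
    refine (mul_left_cancel₀ ?_ h2).symm
    intro h0
    have := D.coeff_zero_qSeries
    rw [h0, map_zero] at this
    exact zero_ne_one this
  have hev := eventuallyEq_of_taylor_eq D.analyticAt_fn_zero D'.analyticAt_fn_zero hs
  have hloc : (fun z => D.num z * D'.den z) =ᶠ[𝓝 0] fun z => D'.num z * D.den z := by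
    filter_upwards [hev, D.differentiable_den.continuous.continuousAt.eventually_ne
      D.den_zero_ne_zero, D'.differentiable_den.continuous.continuousAt.eventually_ne
      D'.den_zero_ne_zero] with w hw h1 h2
    rw [fn, fn, div_eq_div_iff h1 h2] at hw
    exact hw
  exact congrFun (AnalyticOnNhd.eq_of_eventuallyEq
    (fun z _ => (D.analyticAt_num z).mul (D'.analyticAt_den z))
    (fun z _ => (D'.analyticAt_num z).mul (D.analyticAt_den z)) hloc) z

theorem lattice_le_of_qSeries_eq (h : qSeries D.series = qSeries D'.series) :
    D.lattice.lattice ≤ D'.lattice.lattice := by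
  intro z hz
  have h0 := D.num_eq_zero_iff.2 hz
  have h1 := num_mul_den_eq h z
  rw [h0, zero_mul, eq_comm, mul_eq_zero] at h1
  exact D'.num_eq_zero_iff.1
    (h1.resolve_right ((D.num_ne_zero_or_den_ne_zero z).resolve_left (not_not.2 h0)))

variable (D)

/-- For level `2` the pole is a half period, and the function is odd. -/
theorem fn_neg_of_level_two (h2 : D.N = 2) (z : ℂ) : D.fn (-z) = -D.fn z := by
  have e : expTwoPiI ((D.N : ℂ)⁻¹) = -1 := by
    rw [h2, expTwoPiI]
    convert Complex.exp_pi_mul_I using 2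
    push_cast
    ring
  have e1 := expTwoPiI_ne_zero (D.scale * z)
  have h1 : D.scale * -z - (D.N : ℂ)⁻¹ = -(D.scale * z + (D.N : ℂ)⁻¹) := by ring
  have h3 : D.scale * z + (D.N : ℂ)⁻¹ = D.scale * z - (D.N : ℂ)⁻¹ + 1 := by
    rw [h2]
    push_cast
    ring
  have h4 : theta D.τ (D.scale * -z - (D.N : ℂ)⁻¹) =
      (expTwoPiI (D.scale * z))⁻¹ * theta D.τ (D.scale * z - (D.N : ℂ)⁻¹) := by
    rw [h1, theta_neg, expTwoPiI_add, e, h3, theta_add_one]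
    field_simp
  rw [fn, fn, num, den, num, den, h4, mul_neg D.scale z, theta_neg (D.scale * z)]
  by_cases h0 : theta D.τ (D.scale * z - (D.N : ℂ)⁻¹) = 0
  · simp [h0]
  · have := D.scale_ne_zero
    have := deriv_theta_zero_ne_zero D.im_pos
    field_simp

theorem taylor_fn_neg : taylor (fun z => D.fn (-z)) = PowerSeries.rescale (-1) D.series := by
  rw [series, ← taylor_comp_mul_left]
  simp only [neg_one_mul]

theorem qSeries_even_of_level_two (h2 : D.N = 2) :
    PowerSeries.rescale (-1) (qSeries D.series) = qSeries D.series := by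
  symm
  refine qSeries_eq_of_mul_eq D.isNormalized_series ?_
  have h : D.series = PowerSeries.C (-1) * PowerSeries.rescale (-1) D.series := by
    rw [← taylor_fn_neg, ← taylor_const, ← taylor_mul analyticAt_const]
    · simp only [D.fn_neg_of_level_two h2, neg_mul_neg, one_mul]
      rfl
    · simp only [D.fn_neg_of_level_two h2]
      exact D.analyticAt_fn_zero.fun_neg
  have h1 : PowerSeries.rescale (-1) (qSeries D.series) * D.series = PowerSeries.C (-1) *
      (PowerSeries.rescale (-1) (qSeries D.series) * PowerSeries.rescale (-1) D.series) := by
    rw [mul_left_comm, ← h]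
  rw [h1, rescale_mul_rescale_qSeries D.isNormalized_series, ← mul_assoc, ← map_mul]
  simp

/-- If `Q` is even, then the level is `2`, since the pole is congruent to its negative. -/
theorem level_eq_two_of_even (h : PowerSeries.rescale (-1) (qSeries D.series) = qSeries D.series) :
    D.N = 2 := by
  have h1 := num_mul_den_eq (D := D.withScale (-1) (by norm_num)) (D' := D)
    (by rw [qSeries_series_withScale, h]) D.pole
  have h2 : D.den D.pole = 0 := D.den_eq_zero_iff.2 (by simp)
  have h3 : D.num D.pole ≠ 0 := (D.num_ne_zero_or_den_ne_zero _).resolve_right (not_not.2 h2)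
  rw [h2, mul_zero, eq_comm, mul_eq_zero] at h1
  have h4 := h1.resolve_left h3
  rw [den_eq_zero_iff, mem_lattice_iff, theta_eq_zero_iff (im_pos _), mul_sub,
    scale_mul_pole] at h4
  obtain ⟨m, n, h5⟩ := h4
  have h6 : (D.withScale (-1) (by norm_num)).scale * D.pole = -(D.N : ℂ)⁻¹ := by
    rw [withScale, ← D.scale_mul_pole]
    ring
  rw [h6] at h5
  change -(D.N : ℂ)⁻¹ - (D.N : ℂ)⁻¹ = m + n * D.τ at h5
  have h7 : (n : ℝ) * D.τ.im = 0 := by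
    have := congrArg Complex.im h5
    rw [← Complex.ofReal_natCast, ← Complex.ofReal_inv, Complex.sub_im, Complex.neg_im,
      Complex.ofReal_im] at this
    simpa using this.symm
  have hn : n = 0 := by exact_mod_cast (mul_eq_zero.1 h7).resolve_right D.im_pos.ne'
  rw [hn, Int.cast_zero, zero_mul, add_zero] at h5
  have h8 : (-2 : ℂ) = m * D.N := by
    rw [← h5]
    have := D.natCast_ne_zero
    field_simp
    norm_num
  have h9 : (-2 : ℤ) = m * D.N := by exact_mod_cast h8
  have h10 : (D.N : ℤ) ∣ 2 := ⟨-m, by linear_combination -h9⟩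
  have h11 := Int.le_of_dvd two_pos h10
  have := D.two_le
  omega

/-- The functional equation along lines implies the functional equation for the meromorphic
function. -/
theorem sum_prod_recip_eq_zero_of_vanishesOnLines {n : ℕ}
    (h : VanishesOnLines n (qSeries D.series)) {b : Fin n → ℂ}
    (hb : ∀ i j, i ≠ j → b i - b j ∉ D.lattice.lattice) :
    ∑ i, ∏ j ∈ Finset.univ.erase i, D.recip (b j - b i) = 0 := by
  have hdif : ∀ i j, i ≠ j → b i - b j ≠ 0 := fun i j hij h0 => hb i j hij (by
    rw [h0]; exact zero_mem _)
  have hinj : Function.Injective b := fun i j hij => by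
    by_contra hne
    exact hdif i j hne (sub_eq_zero.2 hij)
  have hsmall := (D.lineSeries_eq_zero_iff hinj).1 (h b hinj)
  set S : ℂ → ℂ := fun t => ∑ i, ∏ j ∈ Finset.univ.erase i, D.recip ((b j - b i) * t) with hS
  have hmer : ∀ z, MeromorphicAt S z := fun z => by
    refine MeromorphicAt.fun_sum fun i _ => MeromorphicAt.fun_prod fun j _ => ?_
    exact (D.meromorphicAt_recip ((b j - b i) * z)).comp_analyticAt
      (g := fun t => (b j - b i) * t) (by fun_prop)
  -- the sum vanishes near `t = 0`, hence near `t = 1` by the identity theorem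
  have htop0 : meromorphicOrderAt S 0 = ⊤ := meromorphicOrderAt_eq_top_iff.2 hsmall
  have htop1 : meromorphicOrderAt S 1 = ⊤ := by
    by_contra hne
    exact MeromorphicOn.meromorphicOrderAt_ne_top_of_isPreconnected (U := Set.univ)
      (fun z _ => hmer z) isPreconnected_univ (Set.mem_univ 1) (Set.mem_univ 0) hne htop0
  have han : AnalyticAt ℂ S 1 := by
    refine Finset.analyticAt_fun_sum _ fun i _ => Finset.analyticAt_fun_prod _ fun j hj => ?_
    refine AnalyticAt.fun_comp (g := D.recip) (f := fun t => (b j - b i) * t) ?_ (by fun_prop)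
    rw [mul_one]
    exact D.analyticAt_recip (hb j i (Finset.ne_of_mem_erase hj))
  have h1 : S =ᶠ[𝓝 1] fun _ => 0 :=
    (ContinuousAt.eventuallyEq_nhds_iff_eventuallyEq_nhdsNE han.continuousAt
      continuousAt_const).1 (meromorphicOrderAt_eq_top_iff.1 htop1)
  have h2 := h1.eq_of_nhds
  simpa [hS] using h2

/-- If the functional equation in three variables holds, then the level divides `3`: otherwise its
terms have different multipliers under the second period. -/
theorem level_dvd_three (h : VanishesOnLines 3 (qSeries D.series)) : D.N ∣ 3 := by
  obtain ⟨x, hx⟩ := (D.eventually_mem_regularSet 0).exists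
  have hxy : ∀ᶠ y in 𝓝[≠] x, y - x ∉ D.lattice.lattice := by
    have h1 := tendsto_sub_const_nhdsNE x x
    rw [sub_self] at h1
    filter_upwards [h1.eventually (D.eventually_mem_regularSet 0)] with y hy using hy.1
  obtain ⟨y, hy, hxy⟩ := ((D.eventually_mem_regularSet x).and hxy).exists
  -- the functional equation at the points `0`, `y - x` and `ω - x`
  have key : ∀ ω ∈ D.lattice.lattice, D.recip (y - x) * D.recip (-x + ω)
      + D.recip (x - y) * D.recip (-y + ω) + D.recip (x - ω) * D.recip (y - ω) = 0 := by
    intro ω hω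
    have hmem : ∀ {z : ℂ}, z ∉ D.lattice.lattice → z - ω ∉ D.lattice.lattice := fun hz hz' =>
      hz (by simpa using add_mem hz' hω)
    have hneg : ∀ {z : ℂ}, z ∉ D.lattice.lattice → -z ∉ D.lattice.lattice := fun hz hz' =>
      hz (by simpa using neg_mem hz')
    have hd : ∀ i j : Fin 3, i ≠ j →
        (![0, y - x, -x + ω] : Fin 3 → ℂ) i - (![0, y - x, -x + ω] : Fin 3 → ℂ) j ∉
          D.lattice.lattice := by
      intro i j hij
      fin_cases i <;> fin_cases j <;> simp at hij ⊢
      · simpa using hneg hxy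
      · simpa [sub_eq_add_neg, add_comm] using hmem hx.1
      · exact hxy
      · rw [show y - x - (-x + ω) = y - ω by ring]
        exact hmem hy.1
      · rw [show -x + ω = -(x - ω) by ring]
        exact hneg (hmem hx.1)
      · rw [show -x + ω - (y - x) = -(y - ω) by ring]
        exact hneg (hmem hy.1)
    have h1 := D.sum_prod_recip_eq_zero_of_vanishesOnLines h hd
    have e0 : (Finset.univ.erase 0 : Finset (Fin 3)) = {1, 2} := by decide
    have e1 : (Finset.univ.erase 1 : Finset (Fin 3)) = {0, 2} := by decide
    have e2 : (Finset.univ.erase 2 : Finset (Fin 3)) = {0, 1} := by decide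
    rw [Fin.sum_univ_three, e0, e1, e2, Finset.prod_pair (by decide), Finset.prod_pair (by decide),
      Finset.prod_pair (by decide)] at h1
    simp only [Matrix.cons_val_zero, Matrix.cons_val_one, Matrix.cons_val, sub_zero,
      zero_sub] at h1
    rw [← h1]
    congr 3 <;> ring_nf
  have k0 := key 0 (zero_mem _)
  have k1 := key _ D.lattice.ω₂_mem_lattice
  rw [add_zero, add_zero, sub_zero, sub_zero] at k0
  -- the second period multiplies the first two terms by `χ⁻¹` and the last by `χ ^ 2`
  rw [recip_add_period_two, recip_add_period_two, recip_sub_period_two,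
    recip_sub_period_two] at k1
  have hm := D.multiplier_ne_zero
  have hux : D.recip x ≠ 0 := inv_ne_zero (D.fn_ne_zero hx)
  have huy : D.recip y ≠ 0 := inv_ne_zero (D.fn_ne_zero hy)
  have h3 : (D.multiplier ^ 3 - 1) * (D.recip x * D.recip y) = 0 := by
    field_simp at k1
    linear_combination k1 - k0
  have h4 := sub_eq_zero.1 ((mul_eq_zero.1 h3).resolve_right (mul_ne_zero hux huy))
  exact D.multiplier_isPrimitiveRoot.dvd_of_pow_eq_one 3 h4

end LevelDatum

/-! ### An infinite family of lattices -/

/-- The datum with the lattice `ℤ + ℤ (k + 2) i`. -/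
def rectangularDatum (N : ℕ) (hN : 2 ≤ N) (k : ℕ) : LevelDatum where
  τ := (k + 2) * I
  im_pos := by
    have : (((k : ℂ) + 2) * I).im = k + 2 := by simp
    rw [this]
    positivity
  N := N
  two_le := hN
  scale := 1
  scale_ne_zero := one_ne_zero

theorem mem_lattice_rectangularDatum {N : ℕ} {hN : 2 ≤ N} {k : ℕ} {c : ℂ} {hc : c ≠ 0} {z : ℂ} :
    z ∈ ((rectangularDatum N hN k).withScale c hc).lattice.lattice ↔
      ∃ m n : ℤ, c * z = m + n * ((k + 2) * I) := by
  rw [LevelDatum.mem_lattice_iff, theta_eq_zero_iff (LevelDatum.im_pos _)]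
  simp [LevelDatum.withScale, rectangularDatum]

/-- The rectangular lattices are pairwise not homothetic, since their vectors of minimal length are
unique up to sign. -/
theorem eq_of_qSeries_rectangularDatum_eq {N : ℕ} {hN : 2 ≤ N} {k l : ℕ} {c : ℂ} (hc : c ≠ 0)
    (h : qSeries (rectangularDatum N hN k).series =
      PowerSeries.rescale c (qSeries (rectangularDatum N hN l).series)) : k = l := by
  have h1 : ∀ z, (∃ m n : ℤ, z = m + n * ((k + 2) * I)) ↔
      ∃ m n : ℤ, c * z = m + n * ((l + 2) * I) := by
    intro z
    have e : qSeries ((rectangularDatum N hN k).withScale 1 one_ne_zero).series =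
        qSeries ((rectangularDatum N hN l).withScale c hc).series := by
      rw [LevelDatum.qSeries_series_withScale, LevelDatum.qSeries_series_withScale, ← h,
        PowerSeries.rescale_one, RingHom.id_apply]
    have e1 :=
      mem_lattice_rectangularDatum (N := N) (hN := hN) (k := k) (hc := one_ne_zero) (z := z)
    rw [one_mul] at e1
    rw [← e1, ← mem_lattice_rectangularDatum (N := N) (hN := hN) (hc := hc)]
    exact ⟨fun hz => LevelDatum.lattice_le_of_qSeries_eq e hz,
      fun hz => LevelDatum.lattice_le_of_qSeries_eq e.symm hz⟩
  have hnorm : ∀ (m n : ℤ) (k : ℕ), Complex.normSq (m + n * ((k + 2) * I)) =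
      ((m ^ 2 + n ^ 2 * (k + 2) ^ 2 : ℤ) : ℝ) := by
    intro m n k
    rw [Complex.normSq_apply]
    simp
    ring
  obtain ⟨a, b, hab⟩ := (h1 1).1 ⟨1, 0, by simp⟩
  obtain ⟨a', b', hab'⟩ := (h1 c⁻¹).2 ⟨1, 0, by simp [hc]⟩
  rw [mul_one] at hab
  -- both factors are squared norms of lattice vectors, namely of `c` and `c⁻¹`
  have hprod : (a ^ 2 + b ^ 2 * ((l : ℤ) + 2) ^ 2) * (a' ^ 2 + b' ^ 2 * ((k : ℤ) + 2) ^ 2) = 1 := by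
    have h2 : Complex.normSq c * Complex.normSq c⁻¹ = 1 := by
      rw [← Complex.normSq_mul, mul_inv_cancel₀ hc, Complex.normSq_one]
    rw [hab', hnorm] at h2
    rw [hab, hnorm] at h2
    exact_mod_cast h2
  have hone : a ^ 2 + b ^ 2 * ((l : ℤ) + 2) ^ 2 = 1 :=
    Int.eq_one_of_mul_eq_one_right (by positivity) hprod
  -- the vectors of norm `1` in a rectangular lattice are `1` and `-1`, so `c = a` is one of them
  have hb : b = 0 := by
    by_contra hb
    have : 0 < b ^ 2 := by positivity
    nlinarith [sq_nonneg a, sq_nonneg (l : ℤ), Int.natCast_nonneg l]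
  have ha : a ^ 2 = 1 := by rw [hb] at hone; linarith
  have hca : c = a := by rw [hab, hb]; simp
  have haa : (a : ℂ) * a = 1 := by exact_mod_cast (by rw [← ha]; ring : a * a = 1)
  have key : ∀ p q : ℕ, (∃ m n : ℤ, (a : ℂ) * ((p + 2) * I) = m + n * ((q + 2) * I)) →
      (q + 2 : ℤ) ∣ (p + 2 : ℤ) := by
    rintro p q ⟨m, n, hmn⟩
    have h3 := congrArg Complex.im hmn
    have h4 : (a : ℝ) * (p + 2) = n * (q + 2) := by simpa using h3
    have h5 : a * (p + 2) = n * (q + 2) := by exact_mod_cast h4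
    refine ⟨a * n, ?_⟩
    have h6 : a * a = 1 := by rw [← ha]; ring
    linear_combination a * h5 - (p + 2) * h6
  have hd1 := key k l (by
    have := (h1 ((k + 2) * I)).1 ⟨0, 1, by simp⟩
    rwa [hca] at this)
  have hd2 := key l k ((h1 ((a : ℂ) * ((l + 2) * I))).2 ⟨0, 1, by
    rw [hca, ← mul_assoc, haa]
    simp⟩)
  have := Int.le_of_dvd (by positivity) hd1
  have := Int.le_of_dvd (by positivity) hd2
  omega

end

/-! ### Identities that extend from elliptic functions to the whole family -/

/-- The numerator of the derivative of `A / Q ^ n`, over the denominator `Q ^ (n + 1)`. -/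
def derivNumerator {R : Type*} [CommRing R] (n : ℕ) (Q A : PowerSeries R) : PowerSeries R :=
  Q * PowerSeries.derivative R A - n * PowerSeries.derivative R Q * A

/-- The difference of the two sides of the differential equation for `f = z / Q`, multiplied by
`Q ^ 5`. -/
def odeSeries {R : Type*} [CommRing R] (Q : PowerSeries R) : PowerSeries R :=
  let A₁ := derivNumerator 1 Q PowerSeries.X
  let A₂ := derivNumerator 2 Q A₁
  let A₃ := derivNumerator 3 Q A₂
  PowerSeries.X * A₃ - 3 * A₁ * A₂ -
    (PowerSeries.C (6 * PowerSeries.coeff 1 Q) * A₁ ^ 2 * Q +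
      PowerSeries.C (12 * PowerSeries.coeff 2 Q) * PowerSeries.X * A₁ * Q ^ 2 +
      PowerSeries.C (12 * PowerSeries.coeff 3 Q) * PowerSeries.X ^ 2 * Q ^ 3)

theorem map_derivative {R S : Type*} [CommRing R] [CommRing S] (φ : R →+* S) (Q : PowerSeries R) :
    PowerSeries.map φ (PowerSeries.derivative R Q) =
      PowerSeries.derivative S (PowerSeries.map φ Q) := by
  ext n
  simp [PowerSeries.coeff_derivative]

theorem map_derivNumerator {R S : Type*} [CommRing R] [CommRing S] (φ : R →+* S) (n : ℕ)
    (Q A : PowerSeries R) : PowerSeries.map φ (derivNumerator n Q A) =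
      derivNumerator n (PowerSeries.map φ Q) (PowerSeries.map φ A) := by
  simp [derivNumerator, map_derivative]

theorem map_odeSeries {R S : Type*} [CommRing R] [CommRing S] (φ : R →+* S) (Q : PowerSeries R) :
    PowerSeries.map φ (odeSeries Q) = odeSeries (PowerSeries.map φ Q) := by
  simp [odeSeries, map_derivNumerator, map_ofNat]

/-- `derivNumerator` computes the derivative of `g = A / Q ^ n` without division. -/
theorem pow_succ_mul_derivative {R : Type*} [CommRing R] {n : ℕ} {Q A g : PowerSeries R}
    (h : Q ^ n * g = A) :
    Q ^ (n + 1) * PowerSeries.derivative R g = derivNumerator n Q A := by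
  rw [← h, derivNumerator, Derivation.leibniz, Derivation.leibniz_pow]
  rcases n with _ | n
  · simp
  · simp only [smul_eq_mul, nsmul_eq_mul, Nat.add_sub_cancel]
    push_cast
    ring

theorem odeSeries_qSeries {f : PowerSeries ℂ} (hf : IsNormalized f) :
    odeSeries (qSeries f) = qSeries f ^ 5 *
      (f * PowerSeries.derivative ℂ (PowerSeries.derivative ℂ (PowerSeries.derivative ℂ f))
      - 3 * PowerSeries.derivative ℂ f * PowerSeries.derivative ℂ (PowerSeries.derivative ℂ f)
      - (PowerSeries.C (6 * PowerSeries.coeff 1 (qSeries f)) * PowerSeries.derivative ℂ f ^ 2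
        + PowerSeries.C (12 * PowerSeries.coeff 2 (qSeries f)) * f * PowerSeries.derivative ℂ f
        + PowerSeries.C (12 * PowerSeries.coeff 3 (qSeries f)) * f ^ 2)) := by
  have h0 : qSeries f ^ 1 * f = PowerSeries.X := by rw [pow_one, qSeries_mul hf]
  have h1 := pow_succ_mul_derivative h0
  have h2 := pow_succ_mul_derivative h1
  have h3 := pow_succ_mul_derivative h2
  simp only [odeSeries]
  rw [← h3, ← h2, ← h1, ← h0]
  ring

theorem ode_iff_odeSeries_eq_zero {f : PowerSeries ℂ} (hf : IsNormalized f) :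
    IsODESolution (parameters (qSeries f)) f ↔ odeSeries (qSeries f) = 0 := by
  have hQ : qSeries f ^ 5 ≠ 0 := by
    refine pow_ne_zero 5 fun h => ?_
    have := qSeries_mul hf
    rw [h, zero_mul] at this
    exact PowerSeries.X_ne_zero this.symm
  rw [odeSeries_qSeries hf, mul_eq_zero, or_iff_right hQ, sub_eq_zero]
  exact ⟨fun h => h.ode, fun h => ⟨hf, fun _ => rfl, h⟩⟩

/-- A function of two variables that is polynomial in each variable separately vanishes if it does
so on the orbits of infinitely many inequivalent points under a weighted action of `ℂˣ`. -/
theorem eq_zero_of_forall_orbit {g : ℂ → ℂ → ℂ}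
    (hg₁ : ∀ y, ∃ P : Polynomial ℂ, ∀ x, P.eval x = g x y)
    (hg₂ : ∀ x, ∃ P : Polynomial ℂ, ∀ y, P.eval y = g x y) {w₁ w₂ : ℕ} (hw₁ : w₁ ≠ 0)
    (hw₂ : w₂ ≠ 0) {x y : ℕ → ℂ}
    (hinj : ∀ m n c, c ≠ 0 → x m = c ^ w₁ * x n → y m = c ^ w₂ * y n → m = n)
    (hz : ∀ n c, c ≠ 0 → g (c ^ w₁ * x n) (c ^ w₂ * y n) = 0) (a b : ℂ) : g a b = 0 := by
  -- all points with `x n = 0` lie on one of two orbits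
  have hfin : {n | x n = 0}.Finite := by
    have h1 : {n | x n = 0 ∧ y n = 0}.Subsingleton := fun m hm n hn =>
      hinj m n 1 one_ne_zero (by rw [hm.1, hn.1, mul_zero]) (by rw [hm.2, hn.2, mul_zero])
    have h2 : {n | x n = 0 ∧ y n ≠ 0}.Subsingleton := by
      rintro m ⟨hm, hm'⟩ n ⟨hn, hn'⟩
      obtain ⟨c, hc⟩ := IsAlgClosed.exists_pow_nat_eq (y m / y n) (Nat.pos_of_ne_zero hw₂)
      refine hinj m n c ?_ (by rw [hm, hn, mul_zero]) (by rw [hc, div_mul_cancel₀ _ hn'])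
      rintro rfl
      rw [zero_pow hw₂] at hc
      exact div_ne_zero hm' hn' hc.symm
    refine (h1.finite.union h2.finite).subset fun n hn => ?_
    by_cases h : y n = 0
    · exact Or.inl ⟨hn, h⟩
    · exact Or.inr ⟨hn, h⟩
  have hinf : {n | x n ≠ 0}.Infinite := hfin.infinite_compl
  have key : ∀ a, a ≠ 0 → ∀ b, g a b = 0 := by
    intro a ha b
    have hc : ∀ n, ∃ c : ℂ, x n ≠ 0 → c ^ w₁ * x n = a ∧ c ≠ 0 := by
      intro n
      by_cases hn : x n = 0
      · exact ⟨0, fun h => absurd hn h⟩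
      · obtain ⟨c, hc⟩ := IsAlgClosed.exists_pow_nat_eq (a / x n) (Nat.pos_of_ne_zero hw₁)
        refine ⟨c, fun _ => ⟨by rw [hc, div_mul_cancel₀ _ hn], ?_⟩⟩
        rintro rfl
        rw [zero_pow hw₁] at hc
        exact div_ne_zero ha hn hc.symm
    choose c hc using hc
    obtain ⟨P, hP⟩ := hg₂ a
    -- each orbit with `x n ≠ 0` meets the line with first coordinate `a`, and different orbits
    -- meet it in different points
    have hinjOn : Set.InjOn (fun n => c n ^ w₂ * y n) {n | x n ≠ 0} := by
      intro m hm n hn hmn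
      obtain ⟨h1, h2⟩ := hc m hm
      obtain ⟨h3, h4⟩ := hc n hn
      have h5 := pow_ne_zero w₁ h2
      have h6 := pow_ne_zero w₂ h2
      refine hinj m n (c n / c m) (div_ne_zero h4 h2) ?_ ?_
      · rw [div_pow, div_mul_eq_mul_div, h3, eq_div_iff h5, mul_comm, h1]
      · rw [div_pow, div_mul_eq_mul_div, eq_div_iff h6, mul_comm]
        exact hmn
    have hP0 : P = 0 := by
      refine Polynomial.eq_zero_of_infinite_isRoot P ((hinf.image hinjOn).mono ?_)
      rintro _ ⟨n, hn, rfl⟩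
      obtain ⟨h1, h2⟩ := hc n hn
      change P.eval _ = 0
      have := hz n (c n) h2
      rw [h1] at this
      rw [hP, this]
    rw [← hP, hP0, Polynomial.eval_zero]
  obtain ⟨P, hP⟩ := hg₁ b
  have hP0 : P = 0 := by
    refine Polynomial.eq_zero_of_infinite_isRoot P
      ((Set.finite_singleton (0 : ℂ)).infinite_compl.mono fun a ha => ?_)
    change P.eval a = 0
    rw [hP, key a ha]
  rw [← hP, hP0, Polynomial.eval_zero]

/-- A family of parameters that depends polynomially on two quantities of weights `w₁` and `w₂`, in
a way compatible with rescaling the variable. -/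
structure IsWeightedFamily (w₁ w₂ : ℕ) (F : ℂ → ℂ → Fin 4 → ℂ) : Prop where
  ne_zero_left : w₁ ≠ 0
  ne_zero_right : w₂ ≠ 0
  polynomial_left : ∀ y k, ∃ P : Polynomial ℂ, ∀ x, P.eval x = F x y k
  polynomial_right : ∀ x k, ∃ P : Polynomial ℂ, ∀ y, P.eval y = F x y k
  scale : ∀ c x y, F (c ^ w₁ * x) (c ^ w₂ * y) = fun k : Fin 4 => c ^ ((k : ℕ) + 1) * F x y k

theorem exists_polynomial_eval_eq {F : ℂ → Fin 4 → ℂ}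
    (h : ∀ k, ∃ P : Polynomial ℂ, ∀ x, P.eval x = F x k) (p : MvPolynomial (Fin 4) ℂ) :
    ∃ P : Polynomial ℂ, ∀ x, P.eval x = MvPolynomial.eval (F x) p := by
  choose P hP using h
  refine ⟨MvPolynomial.aeval P p, fun x => ?_⟩
  rw [← Polynomial.coe_aeval_eq_eval, ← MvPolynomial.aeval_eq_eval]
  have h1 : F x = fun k => Polynomial.aeval x (P k) := by
    funext k
    rw [Polynomial.coe_aeval_eq_eval, hP]
  rw [h1]
  exact (MvPolynomial.comp_aeval_apply _ _ p)

theorem parameters_rescale (Q : PowerSeries ℂ) (c : ℂ) :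
    parameters (PowerSeries.rescale c Q) = fun k : Fin 4 => c ^ ((k : ℕ) + 1) * parameters Q k := by
  funext k
  rw [parameters, PowerSeries.coeff_rescale, parameters]

theorem LevelDatum.qSeries_mem_solutionSeries (D : LevelDatum) (h : D.N ∣ 6) :
    qSeries D.series ∈ solutionSeries :=
  ⟨D.coeff_zero_qSeries, D.vanishesOnLines (by norm_num) h⟩

/-- Solutions are determined by their first four coefficients. -/
theorem eq_of_parameters_eq {Q Q' : PowerSeries ℂ} (hQ : Q ∈ solutionSeries)
    (hQ' : Q' ∈ solutionSeries) (h : parameters Q = parameters Q') : Q = Q' := by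
  obtain ⟨Φ, hΦ⟩ := exists_universalSeries
  rw [hΦ Q hQ, hΦ Q' hQ', h]

theorem rescale_mem_solutionSeries {Q : PowerSeries ℂ} (hQ : Q ∈ solutionSeries) (c : ℂ) :
    PowerSeries.rescale c Q ∈ solutionSeries :=
  ⟨by rw [PowerSeries.coeff_rescale, hQ.1, pow_zero, one_mul], hQ.2.rescale c⟩

/-- The elliptic functions of level `N` are Zariski dense in any weighted family that contains
them: they form infinitely many orbits under scaling. -/
theorem IsWeightedFamily.eval_eq_zero {w₁ w₂ : ℕ} {F : ℂ → ℂ → Fin 4 → ℂ}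
    (hF : IsWeightedFamily w₁ w₂ F) {N : ℕ} (hN : 2 ≤ N) (hN6 : N ∣ 6)
    (hmem : ∀ D : LevelDatum, D.N = N → ∃ x y, parameters (qSeries D.series) = F x y)
    {p : MvPolynomial (Fin 4) ℂ}
    (hp : ∀ D : LevelDatum, D.N = N → MvPolynomial.eval (parameters (qSeries D.series)) p = 0)
    (x y : ℂ) : MvPolynomial.eval (F x y) p = 0 := by
  choose u v huv using fun n => hmem (rectangularDatum N hN n) rfl
  have hsol : ∀ n, qSeries (rectangularDatum N hN n).series ∈ solutionSeries := fun n =>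
    LevelDatum.qSeries_mem_solutionSeries _ hN6
  have hscale : ∀ n c, parameters (PowerSeries.rescale c
      (qSeries (rectangularDatum N hN n).series)) = F (c ^ w₁ * u n) (c ^ w₂ * v n) := by
    intro n c
    rw [parameters_rescale, hF.scale, huv]
  refine eq_zero_of_forall_orbit (g := fun x y => MvPolynomial.eval (F x y) p)
    (fun y => exists_polynomial_eval_eq (F := fun x => F x y) (hF.polynomial_left y) p)
    (fun x => exists_polynomial_eval_eq (hF.polynomial_right x) p)
    hF.ne_zero_left hF.ne_zero_right (x := u) (y := v) (fun m n c hc hu hv => ?_)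
    (fun n c hc => ?_) x y
  · refine eq_of_qSeries_rectangularDatum_eq (N := N) (hN := hN) hc ?_
    refine eq_of_parameters_eq (hsol m) (rescale_mem_solutionSeries (hsol n) c) ?_
    rw [hscale, huv, hu, hv]
  · have := hp ((rectangularDatum N hN n).withScale c hc) rfl
    rwa [LevelDatum.qSeries_series_withScale, hscale] at this

/-- A weighted family that contains the elliptic functions of level `N` lies in the Zariski closure
`M_N`. -/
theorem IsWeightedFamily.mem_levelVariety {w₁ w₂ : ℕ} {F : ℂ → ℂ → Fin 4 → ℂ}
    (hF : IsWeightedFamily w₁ w₂ F) {N : ℕ} (hN : 2 ≤ N) (hN6 : N ∣ 6)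
    (hmem : ∀ D : LevelDatum, D.N = N → ∃ x y, parameters (qSeries D.series) = F x y)
    (x y : ℂ) : F x y ∈ levelVariety N := by
  rw [levelVariety, MvPolynomial.mem_zeroLocus_iff]
  intro p hp
  rw [MvPolynomial.mem_vanishingIdeal_iff] at hp
  rw [MvPolynomial.aeval_eq_eval]
  refine hF.eval_eq_zero hN hN6 hmem (fun D hD => ?_) x y
  rw [← MvPolynomial.aeval_eq_eval]
  exact hp _ ⟨D.series, D.isODESolution_series, D.lattice, D.fn, hD ▸ D.isEllipticOfLevel_fn,
    isExpansionAtZero_taylor D.analyticAt_fn_zero⟩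

/-- An identity between power series that holds for the elliptic functions of level `N` holds for
all solutions with parameters in the family. The operation `T` on power series has to be defined
over all `ℂ`-algebras, so that it can be applied to the universal series. -/
theorem IsWeightedFamily.map_eq_zero {w₁ w₂ : ℕ} {F : ℂ → ℂ → Fin 4 → ℂ}
    (hF : IsWeightedFamily w₁ w₂ F) {N : ℕ} (hN : 2 ≤ N) (hN6 : N ∣ 6)
    (hmem : ∀ D : LevelDatum, D.N = N → ∃ x y, parameters (qSeries D.series) = F x y)
    (T : ∀ {R : Type} [CommRing R] [Algebra ℂ R], PowerSeries R → PowerSeries R)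
    (hT : ∀ {R S : Type} [CommRing R] [Algebra ℂ R] [CommRing S] [Algebra ℂ S] (φ : R →ₐ[ℂ] S)
      (Q : PowerSeries R),
        PowerSeries.map (φ : R →+* S) (T Q) = T (PowerSeries.map (φ : R →+* S) Q))
    (h : ∀ D : LevelDatum, D.N = N → T (qSeries D.series) = 0)
    {Q : PowerSeries ℂ} (hQ : Q ∈ solutionSeries) {x y : ℂ} (hxy : parameters Q = F x y) :
    T Q = 0 := by
  obtain ⟨Φ, hΦ⟩ := exists_universalSeries
  have hT' : ∀ Q ∈ solutionSeries, ∀ m, PowerSeries.coeff m (T Q) =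
      MvPolynomial.eval (parameters Q) (PowerSeries.coeff m (T Φ)) := by
    intro Q hQ m
    conv_lhs => rw [hΦ Q hQ]
    rw [← hT, PowerSeries.coeff_map]
    rfl
  ext m
  rw [hT' Q hQ, hxy, map_zero]
  refine hF.eval_eq_zero hN hN6 hmem (fun D hD => ?_) x y
  rw [← hT' _ (D.qSeries_mem_solutionSeries (hD ▸ hN6)), h D hD, map_zero]

/-- The parameters of the solution lie in `M_N`, and the differential equation extends from the
elliptic functions to the family. -/
theorem IsWeightedFamily.correspondsToLevel {w₁ w₂ : ℕ} {F : ℂ → ℂ → Fin 4 → ℂ}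
    (hF : IsWeightedFamily w₁ w₂ F) {N : ℕ} (hN : 2 ≤ N) (hN6 : N ∣ 6)
    (hmem : ∀ D : LevelDatum, D.N = N → ∃ x y, parameters (qSeries D.series) = F x y)
    {f : PowerSeries ℂ} (hf : IsNormalized f) (hQ : qSeries f ∈ solutionSeries) {x y : ℂ}
    (hxy : parameters (qSeries f) = F x y) : CorrespondsToLevel N f := by
  refine ⟨parameters (qSeries f), hxy ▸ hF.mem_levelVariety hN hN6 hmem x y, ?_⟩
  rw [ode_iff_odeSeries_eq_zero hf]
  refine hF.map_eq_zero hN hN6 hmem (fun Q => odeSeries Q) (fun φ Q => map_odeSeries _ Q)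
    (fun D _ => ?_) hQ hxy
  exact (ode_iff_odeSeries_eq_zero D.isNormalized_series).1 D.isODESolution_series

/-! ### The families of level `2`, `3` and `6` -/

section Families

variable {R S : Type*} [CommRing R] [Algebra ℂ R] [CommRing S] [Algebra ℂ S]

theorem map_parametersOfLog (φ : R →ₐ[ℂ] S) (s₁ s₂ s₃ s₄ : R) (k : Fin 4) :
    φ (parametersOfLog s₁ s₂ s₃ s₄ k) = parametersOfLog (φ s₁) (φ s₂) (φ s₃) (φ s₄) k := by
  fin_cases k <;> simp [parametersOfLog, map_smul]

theorem parametersOfLog_scale (c s₁ s₂ s₃ s₄ : ℂ) :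
    parametersOfLog (c * s₁) (c ^ 2 * s₂) (c ^ 3 * s₃) (c ^ 4 * s₄) =
      fun k : Fin 4 => c ^ ((k : ℕ) + 1) * parametersOfLog s₁ s₂ s₃ s₄ k := by
  funext k
  fin_cases k <;> simp [parametersOfLog] <;> ring

theorem map_familyTwo (φ : R →ₐ[ℂ] S) (x y : R) (k : Fin 4) :
    φ (familyTwo x y k) = familyTwo (φ x) (φ y) k := by
  simp [familyTwo, map_parametersOfLog]

theorem map_familyThree (φ : R →ₐ[ℂ] S) (x y : R) (k : Fin 4) :
    φ (familyThree x y k) = familyThree (φ x) (φ y) k := by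
  simp [familyThree, map_parametersOfLog, map_smul]

theorem map_familySix (φ : R →ₐ[ℂ] S) (x y : R) (k : Fin 4) :
    φ (familySix x y k) = familySix (φ x) (φ y) k := by
  simp [familySix, map_parametersOfLog, map_smul, map_ofNat]

/-- A family that is defined over all `ℂ`-algebras and commutes with their homomorphisms is
polynomial, as its values at the polynomial variable show. -/
theorem isWeightedFamily_of_map {w₁ w₂ : ℕ} (h₁ : w₁ ≠ 0) (h₂ : w₂ ≠ 0)
    (F : ∀ {R : Type} [CommRing R] [Algebra ℂ R], R → R → Fin 4 → R)
    (hF : ∀ {R S : Type} [CommRing R] [Algebra ℂ R] [CommRing S] [Algebra ℂ S] (φ : R →ₐ[ℂ] S)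
      (x y : R) (k : Fin 4), φ (F x y k) = F (φ x) (φ y) k)
    (hscale : ∀ c x y : ℂ,
      F (c ^ w₁ * x) (c ^ w₂ * y) = fun k : Fin 4 => c ^ ((k : ℕ) + 1) * F x y k) :
    IsWeightedFamily w₁ w₂ (fun x y : ℂ => F x y) where
  ne_zero_left := h₁
  ne_zero_right := h₂
  polynomial_left := fun y k => ⟨F Polynomial.X (Polynomial.C y) k, fun x => by
    rw [← Polynomial.coe_aeval_eq_eval, hF]
    simp⟩
  polynomial_right := fun x k => ⟨F (Polynomial.C x) Polynomial.X k, fun y => by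
    rw [← Polynomial.coe_aeval_eq_eval, hF]
    simp⟩
  scale := hscale

theorem isWeightedFamily_familyTwo : IsWeightedFamily 2 4 (familyTwo (R := ℂ)) :=
  isWeightedFamily_of_map two_ne_zero four_ne_zero (fun x y => familyTwo x y)
    (fun φ x y k => map_familyTwo φ x y k) fun c x y => by
      simp only [familyTwo, ← parametersOfLog_scale, mul_zero]

theorem isWeightedFamily_familyThree : IsWeightedFamily 1 3 (familyThree (R := ℂ)) :=
  isWeightedFamily_of_map one_ne_zero three_ne_zero (fun x y => familyThree x y)
    (fun φ x y k => map_familyThree φ x y k) fun c x y => by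
      simp only [familyThree, ← parametersOfLog_scale, smul_eq_mul]
      congr 1 <;> ring

theorem isWeightedFamily_familySix : IsWeightedFamily 1 1 (familySix (R := ℂ)) :=
  isWeightedFamily_of_map one_ne_zero one_ne_zero (fun x y => familySix x y)
    (fun φ x y k => map_familySix φ x y k) fun c x y => by
      simp only [familySix, ← parametersOfLog_scale, smul_eq_mul]
      congr 1 <;> ring

theorem parameters_eq_familyTwo {Q : PowerSeries ℂ} (h0 : PowerSeries.coeff 0 Q = 1)
    (h1 : logTaylor Q 1 = 0) (h3 : logTaylor Q 3 = 0) :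
    parameters Q = familyTwo (logTaylor Q 2) (logTaylor Q 4) := by
  rw [parameters_eq h0, h1, h3, familyTwo]

theorem parameters_eq_familyThree {Q : PowerSeries ℂ} (h0 : PowerSeries.coeff 0 Q = 1)
    (h2 : logTaylor Q 2 = -3 / 2 * logTaylor Q 1 ^ 2)
    (h4 : logTaylor Q 4 = 9 / 20 * logTaylor Q 1 ^ 4 - 9 / 5 * logTaylor Q 1 * logTaylor Q 3) :
    parameters Q = familyThree (logTaylor Q 1) (logTaylor Q 3) := by
  rw [parameters_eq h0, h2, h4, familyThree, smul_eq_mul, smul_eq_mul, smul_eq_mul]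
  congr 1 <;> ring

/-- The level `2` functions are odd, so that `Q` is even. -/
theorem exists_familyTwo (D : LevelDatum) (hD : D.N = 2) :
    ∃ x y, parameters (qSeries D.series) = familyTwo x y := by
  have h0 := D.coeff_zero_qSeries
  have h : ∀ k, (-1) ^ k * logTaylor (qSeries D.series) k = logTaylor (qSeries D.series) k :=
    fun k => by rw [← logTaylor_rescale h0, D.qSeries_even_of_level_two hD]
  refine ⟨_, _, parameters_eq_familyTwo h0 ?_ ?_⟩
  · linear_combination (-1 / 2 : ℂ) * h 1
  · linear_combination (-1 / 2 : ℂ) * h 3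

/-- The coefficients of weight `2` and `4` of the functional equation in three variables determine
`s₂` and `s₄`. -/
theorem parameters_eq_familyThree_of_vanishesOnLines {Q : PowerSeries ℂ}
    (h0 : PowerSeries.coeff 0 Q = 1) (h : VanishesOnLines 3 Q) :
    parameters Q = familyThree (logTaylor Q 1) (logTaylor Q 3) := by
  have hinj : Function.Injective (![0, 1, 2] : Fin 3 → ℂ) := by
    intro i j hij
    fin_cases i <;> fin_cases j <;> simp at hij ⊢
  have key : ∀ m, lineCoeff ![0, 1, 2] (logTaylor Q) m = 0 := fun m => by
    rw [lineCoeff_logTaylor h0, h _ hinj, map_zero]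
  have e0 : (Finset.univ.erase 0 : Finset (Fin 3)) = {1, 2} := by decide
  have e1 : (Finset.univ.erase 1 : Finset (Fin 3)) = {0, 2} := by decide
  have e2 : (Finset.univ.erase 2 : Finset (Fin 3)) = {0, 1} := by decide
  have k2 := key 2
  have k4 := key 4
  rw [lineCoeff, Fin.sum_univ_three] at k2 k4
  simp only [differenceProduct, e0, e1, e2, expCoeff_2, expCoeff_4, Fin.sum_univ_three,
    Finset.prod_pair (show (1 : Fin 3) ≠ 2 by decide),
    Finset.prod_pair (show (0 : Fin 3) ≠ 2 by decide),
    Finset.prod_pair (show (0 : Fin 3) ≠ 1 by decide)] at k2 k4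
  simp only [Matrix.cons_val] at k2 k4
  norm_num at k2 k4
  have h2 : logTaylor Q 2 = -3 / 2 * logTaylor Q 1 ^ 2 := by
    linear_combination (1 / 3 : ℂ) * k2
  refine parameters_eq_familyThree h0 h2 ?_
  rw [h2] at k4
  linear_combination (1 / 15 : ℂ) * k4

theorem exists_familyThree (D : LevelDatum) (hD : D.N = 3) :
    ∃ x y, parameters (qSeries D.series) = familyThree x y :=
  ⟨_, _, parameters_eq_familyThree_of_vanishesOnLines D.coeff_zero_qSeries
    (D.vanishesOnLines (by norm_num) hD.dvd)⟩

/-- A level `6` function satisfies neither of the identities that characterize the levels `2` and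
`3`, so it lies in the third family. -/
theorem exists_familySix (D : LevelDatum) (hD : D.N = 6) :
    ∃ x y, parameters (qSeries D.series) = familySix x y := by
  have hQ := D.qSeries_mem_solutionSeries hD.dvd
  obtain ⟨-, ⟨h1, h3⟩ | ⟨h2, h4⟩ | ⟨t, ht⟩⟩ := hQ.2.classification hQ.1
  · have heven : PowerSeries.rescale (-1) (qSeries D.series) = qSeries D.series := by
      have hQ' := rescale_mem_solutionSeries hQ (-1)
      refine eq_of_parameters_eq hQ' hQ ?_
      rw [parameters_eq hQ'.1, parameters_eq hQ.1]
      simp only [logTaylor_rescale hQ.1, h1, h3]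
      norm_num
    have := D.level_eq_two_of_even heven
    omega
  · have hthree : VanishesOnLines 3 (qSeries D.series) := fun a ha =>
      isWeightedFamily_familyThree.map_eq_zero (by norm_num) (by norm_num) exists_familyThree
        (fun Q => lineSeries a Q) (fun φ Q => map_lineSeries a φ Q)
        (fun D' hD' => D'.vanishesOnLines (by norm_num) hD'.dvd a ha) hQ
        (parameters_eq_familyThree hQ.1 h2 h4)
    have := Nat.le_of_dvd (by norm_num) (D.level_dvd_three hthree)
    omega
  · exact ⟨_, t, ht⟩

end Families

end

end Hirzebruch

theorem mainTheorem3 (f : PowerSeries ℂ) (hf : Hirzebruch.IsNormalized f)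
    (hsol : Hirzebruch.SolvesFunctionalEquation 6 0 f) :
    Hirzebruch.CorrespondsToLevel 2 f ∨ Hirzebruch.CorrespondsToLevel 3 f ∨
      Hirzebruch.CorrespondsToLevel 6 f := by
  open Hirzebruch in
  have h0 : PowerSeries.coeff 0 (qSeries f) = 1 := by
    have h := congrArg (PowerSeries.coeff 1) (qSeries_mul hf)
    rw [PowerSeries.coeff_mul, Finset.Nat.sum_antidiagonal_eq_sum_range_succ_mk] at h
    simpa [Finset.sum_range_succ, hf.1, hf.2] using h
  have hQ : qSeries f ∈ solutionSeries :=
    ⟨h0, vanishesOnLines_of_solvesFunctionalEquation hf hsol⟩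
  obtain ⟨-, ⟨h1, h3⟩ | ⟨h2, h4⟩ | ⟨t, ht⟩⟩ := hQ.2.classification h0
  · exact Or.inl (isWeightedFamily_familyTwo.correspondsToLevel (by norm_num) (by norm_num)
      exists_familyTwo hf hQ (parameters_eq_familyTwo h0 h1 h3))
  · exact Or.inr (Or.inl (isWeightedFamily_familyThree.correspondsToLevel (by norm_num)
      (by norm_num) exists_familyThree hf hQ (parameters_eq_familyThree h0 h2 h4)))
  · exact Or.inr (Or.inr (isWeightedFamily_familySix.correspondsToLevel (by norm_num)
      (by norm_num) exists_familySix hf hQ ht))
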